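/- Let $S$ be a scheme, let $G$ be a group scheme over $S$ acting on an $S$-scheme $X$, and let $H\subseteq G$ be a normal subgroup scheme. Let $G/H$ be the quotient sheaf of groups on the big étale site of $S$, i.e. the étale sheafification of $T\mapsto G(T)/H(T)$ (when $H$ is smooth over $S$ and the quotient group scheme $G/H$ exists, it is the sheaf represented by it). For a group sheaf $\Gamma$ acting on a scheme or a stack $\mathcal{Y}$ over $S$ (on a stack: with associativity and unit isomorphisms subject to the usual coherence conditions), let $[\mathcal{Y}/\Gamma]$ be the category over $\mathrm{Sch}_S$ whose objects over $T$ are étale $\Gamma$-torsors $P\to T$ (as sheaves) together with a $\Gamma$-equivariant morphism $P\to\mathcal{Y}$, and whose morphisms are the equivariant maps of torsors over morphisms $T'\to T$, compatible with the morphisms to $\mathcal{Y}$ (for a stack: together with an equivariant 2-isomorphism). Let $G/H$ act on $[X/H]$ by the action induced by that of $G$ on $X$: a section $c$ of $G/H$ over $T$ with preimage $L_c\subseteq G\times_S T$ sends an $H$-torsor $P\to T$ with its equivariant morphism $\pi:P\to X$ to the contracted product $L_c\times^H P$ with the morphism $(g,p)\mapsto g\,\pi(p)$. Then there is an isomorphism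 of quotient stacks, i.e. an equivalence of categories over $\mathrm{Sch}_S$ (functors over $\mathrm{Sch}_S$ in both directions, mutually inverse up to natural isomorphisms lying over identities), $$[X/G]\;\cong\;[[X/H]/(G/H)].$$ -/

import Mathlib

open CategoryTheory Opposite

universe u v w a b a' b'

noncomputable section

namespace QuotStack

/-! ## Presheaves of sets and of groups: restriction maps and gluing -/

section Presheaves

variable {C : Type u} [Category.{v} C]

/-- Restriction of a section of a presheaf of sets along `f : V ⟶ U`. -/
def rs (P : Cᵒᵖ ⥤ Type w) {V U : C} (f : V ⟶ U) (x : P.obj (op U)) : P.obj (op V) :=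
  P.map f.op x

/-- Restriction of a section of a presheaf of groups along `f : V ⟶ U`. -/
def rg (G : Cᵒᵖ ⥤ GrpCat.{w}) {V U : C} (f : V ⟶ U) : G.obj (op U) →* G.obj (op V) :=
  (G.map f.op).hom

/-- The value on sections over `U` of a homomorphism of presheaves of groups. -/
def ga {G K : Cᵒᵖ ⥤ GrpCat.{w}} (φ : G ⟶ K) {U : C} : G.obj (op U) →* K.obj (op U) :=
  (φ.app (op U)).hom

theorem rs_id (P : Cᵒᵖ ⥤ Type w) {U : C} (x : P.obj (op U)) : rs P (𝟙 U) x = x := by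
  simp [rs]

theorem rs_comp (P : Cᵒᵖ ⥤ Type w) {W V U : C} (g : W ⟶ V) (f : V ⟶ U) (x : P.obj (op U)) :
    rs P (g ≫ f) x = rs P g (rs P f x) := by
  simp [rs]

theorem rg_id (G : Cᵒᵖ ⥤ GrpCat.{w}) {U : C} (x : G.obj (op U)) : rg G (𝟙 U) x = x := by
  simp [rg]

theorem rg_comp (G : Cᵒᵖ ⥤ GrpCat.{w}) {W V U : C} (g : W ⟶ V) (f : V ⟶ U)
    (x : G.obj (op U)) : rg G (g ≫ f) x = rg G g (rg G f x) := by
  simp [rg]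

theorem ga_rg {G K : Cᵒᵖ ⥤ GrpCat.{w}} (φ : G ⟶ K) {V U : C} (f : V ⟶ U) (x : G.obj (op U)) :
    ga φ (rg G f x) = rg K f (ga φ x) := by
  have := congrArg (fun t => t.hom x) (φ.naturality f.op)
  simpa [ga, rg] using this

variable {J : GrothendieckTopology C}

theorem sep {P : Cᵒᵖ ⥤ Type w} (hP : Presieve.IsSheaf J P) {U : C} {S : Sieve U} (hS : S ∈ J U)
    {p p' : P.obj (op U)} (h : ∀ ⦃V : C⦄ (k : V ⟶ U), S k → rs P k p = rs P k p') : p = p' :=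
  (hP S hS).isSeparatedFor.ext fun _ k hk => h k hk

theorem glue {P : Cᵒᵖ ⥤ Type w} (hP : Presieve.IsSheaf J P) {U : C} {S : Sieve U} (hS : S ∈ J U)
    (x : ∀ ⦃V : C⦄ (k : V ⟶ U), S k → P.obj (op V))
    (hx : ∀ ⦃W V : C⦄ (j : W ⟶ V) (k : V ⟶ U) (hk : S k),
      rs P j (x k hk) = x (j ≫ k) (S.downward_closed hk j)) :
    ∃ p : P.obj (op U), ∀ ⦃V : C⦄ (k : V ⟶ U) (hk : S k), rs P k p = x k hk := by
  obtain ⟨p, hp, -⟩ := hP S hS (fun V k hk => x k hk)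
    ((Presieve.compatible_iff_sieveCompatible _).2 fun V W k j hk => (hx j k hk).symm)
  exact ⟨p, fun V k hk => hp k hk⟩

/-- Gluing sections that are characterised locally. -/
theorem glueUnique {P : Cᵒᵖ ⥤ Type w} (hP : Presieve.IsSheaf J P) {U : C} {S : Sieve U}
    (hS : S ∈ J U) (Φ : ∀ ⦃V : C⦄, (V ⟶ U) → P.obj (op V) → Prop)
    (ex : ∀ ⦃V : C⦄ (k : V ⟶ U), S k → ∃ p, Φ k p)
    (uniq : ∀ ⦃V : C⦄ (k : V ⟶ U) (p p' : P.obj (op V)), Φ k p → Φ k p' → p = p')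
    (stab : ∀ ⦃W V : C⦄ (j : W ⟶ V) (k : V ⟶ U) (p : P.obj (op V)), Φ k p →
      Φ (j ≫ k) (rs P j p)) :
    ∃ p : P.obj (op U), ∀ ⦃V : C⦄ (k : V ⟶ U), S k → Φ k (rs P k p) := by
  choose x hx using ex
  obtain ⟨p, hp⟩ := glue hP hS x fun W V j k hk =>
    uniq _ _ _ (stab j k _ (hx k hk)) (hx _ _)
  exact ⟨p, fun V k hk => hp k hk ▸ hx k hk⟩

end Presheaves

/-! ## Categories over a base category -/

/-- A category over `C` (a category `𝒳` with a functor `𝒳 ⥤ C`), presented by its classes of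
objects over the various `T : C`, so that no transport along equalities of objects of `C` is ever
needed: `Fib T` are the objects lying over `T`, `Hom x y` are all morphisms of the total category,
and `base` is the projection to `C`. -/
structure CatOver (C : Type u) [Category.{v} C] where
  Fib : C → Type a
  Hom : ∀ {T' T : C}, Fib T' → Fib T → Type b
  base : ∀ {T' T : C} {x : Fib T'} {y : Fib T}, Hom x y → (T' ⟶ T)
  id : ∀ {T : C} (x : Fib T), Hom x x
  comp : ∀ {T'' T' T : C} {x : Fib T''} {y : Fib T'} {z : Fib T}, Hom x y → Hom y z → Hom x z
  id_comp : ∀ {T' T : C} {x : Fib T'} {y : Fib T} (f : Hom x y), comp (id x) f = f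
  comp_id : ∀ {T' T : C} {x : Fib T'} {y : Fib T} (f : Hom x y), comp f (id y) = f
  assoc : ∀ {T₁ T₂ T₃ T₄ : C} {x : Fib T₁} {y : Fib T₂} {z : Fib T₃} {t : Fib T₄}
    (f : Hom x y) (g : Hom y z) (h : Hom z t), comp (comp f g) h = comp f (comp g h)
  base_id : ∀ {T : C} (x : Fib T), base (id x) = 𝟙 T
  base_comp : ∀ {T'' T' T : C} {x : Fib T''} {y : Fib T'} {z : Fib T} (f : Hom x y)
    (g : Hom y z), base (comp f g) = base f ≫ base g

namespace CatOver

variable {C : Type u} [Category.{v} C]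

/-- A vertical isomorphism: an invertible morphism lying over an identity of `C`. -/
structure IsVertIso (𝒳 : CatOver.{u, v, a, b} C) {T : C} {x y : 𝒳.Fib T} (f : 𝒳.Hom x y) :
    Prop where
  base_eq : 𝒳.base f = 𝟙 T
  exists_inv : ∃ g : 𝒳.Hom y x, 𝒳.comp f g = 𝒳.id x ∧ 𝒳.comp g f = 𝒳.id y

/-- A functor over `C`. -/
structure Fun (𝒳 : CatOver.{u, v, a, b} C) (𝒴 : CatOver.{u, v, a', b'} C) where
  obj : ∀ {T : C}, 𝒳.Fib T → 𝒴.Fib T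
  map : ∀ {T' T : C} {x : 𝒳.Fib T'} {y : 𝒳.Fib T}, 𝒳.Hom x y → 𝒴.Hom (obj x) (obj y)
  base_map : ∀ {T' T : C} {x : 𝒳.Fib T'} {y : 𝒳.Fib T} (f : 𝒳.Hom x y),
    𝒴.base (map f) = 𝒳.base f
  map_id : ∀ {T : C} (x : 𝒳.Fib T), map (𝒳.id x) = 𝒴.id (obj x)
  map_comp : ∀ {T'' T' T : C} {x : 𝒳.Fib T''} {y : 𝒳.Fib T'} {z : 𝒳.Fib T} (f : 𝒳.Hom x y)
    (g : 𝒳.Hom y z), map (𝒳.comp f g) = 𝒴.comp (map f) (map g)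

/-- `𝒳` and `𝒴` are equivalent over `C`: there are functors over `C` in both directions whose
composites are isomorphic to the identities through natural isomorphisms lying over identities.
For categories fibred in groupoids this is the notion of isomorphism of stacks. -/
def Equivalent (𝒳 : CatOver.{u, v, a, b} C) (𝒴 : CatOver.{u, v, a', b'} C) : Prop :=
  ∃ (F : Fun 𝒳 𝒴) (G : Fun 𝒴 𝒳)
    (η : ∀ {T : C} (x : 𝒳.Fib T), 𝒳.Hom x (G.obj (F.obj x)))
    (ε : ∀ {T : C} (y : 𝒴.Fib T), 𝒴.Hom (F.obj (G.obj y)) y),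
    (∀ {T : C} (x : 𝒳.Fib T), 𝒳.IsVertIso (η x)) ∧
    (∀ {T : C} (y : 𝒴.Fib T), 𝒴.IsVertIso (ε y)) ∧
    (∀ {T' T : C} {x' : 𝒳.Fib T'} {x : 𝒳.Fib T} (f : 𝒳.Hom x' x),
      𝒳.comp f (η x) = 𝒳.comp (η x') (G.map (F.map f))) ∧
    (∀ {T' T : C} {y' : 𝒴.Fib T'} {y : 𝒴.Fib T} (f : 𝒴.Hom y' y),
      𝒴.comp (F.map (G.map f)) (ε y) = 𝒴.comp (ε y') f)

end CatOver

/-! ## Actions of group sheaves, torsors, and the quotient stack of a sheaf -/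

section Torsors

variable {C : Type u} [Category.{v} C]

/-- A left action of a presheaf of groups `G` on a presheaf of sets `X`. -/
structure SpaceAction (G : Cᵒᵖ ⥤ GrpCat.{w}) (X : Cᵒᵖ ⥤ Type w) where
  smul : ∀ {U : C}, G.obj (op U) → X.obj (op U) → X.obj (op U)
  one_smul : ∀ {U : C} (x : X.obj (op U)), smul 1 x = x
  mul_smul : ∀ {U : C} (g h : G.obj (op U)) (x : X.obj (op U)),
    smul (g * h) x = smul g (smul h x)
  res_smul : ∀ {V U : C} (f : V ⟶ U) (g : G.obj (op U)) (x : X.obj (op U)),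
    rs X f (smul g x) = smul (rg G f g) (rs X f x)

/-- The action obtained by restriction along a homomorphism `ι : H ⟶ G`. -/
def SpaceAction.restrict {H G : Cᵒᵖ ⥤ GrpCat.{w}} {X : Cᵒᵖ ⥤ Type w} (act : SpaceAction G X)
    (ι : H ⟶ G) : SpaceAction H X where
  smul h x := act.smul (ga ι h) x
  one_smul x := by rw [map_one, act.one_smul]
  mul_smul g h x := by rw [map_mul, act.mul_smul]
  res_smul f g x := by rw [act.res_smul, ga_rg]

/-- A `G`-torsor over `T` for the topology `J`: a sheaf over `T` with an action of `G` over `T`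
that is simply transitive on the sections over any `U ⟶ T`, and that has sections `J`-locally on
`T`. (For subcanonical `J`, sheaves on `C` with a map to `T` are the same thing as sheaves on the
site of objects over `T`, so this is a torsor over `T` under the restriction of `G` to `T`.) -/
structure Torsor (J : GrothendieckTopology C) (G : Cᵒᵖ ⥤ GrpCat.{w}) (T : C) where
  sheaf : Cᵒᵖ ⥤ Type w
  isSheaf : Presieve.IsSheaf J sheaf
  str : ∀ {U : C}, sheaf.obj (op U) → (U ⟶ T)
  str_res : ∀ {V U : C} (f : V ⟶ U) (p : sheaf.obj (op U)), str (rs sheaf f p) = f ≫ str p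
  act : SpaceAction G sheaf
  str_smul : ∀ {U : C} (g : G.obj (op U)) (p : sheaf.obj (op U)), str (act.smul g p) = str p
  simply_transitive : ∀ {U : C} (p p' : sheaf.obj (op U)), str p = str p' →
    ∃! g : G.obj (op U), act.smul g p = p'
  locally_nonempty : ∃ R ∈ J T, ∀ ⦃U : C⦄ (f : U ⟶ T), R f →
    ∃ p : sheaf.obj (op U), str p = f

/-- A morphism of torsors lying over a morphism `base` of the bases. -/
structure TorsorHom {J : GrothendieckTopology C} {G : Cᵒᵖ ⥤ GrpCat.{w}} {T' T : C}
    (E' : Torsor J G T') (E : Torsor J G T) where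
  base : T' ⟶ T
  toFun : ∀ {U : C}, E'.sheaf.obj (op U) → E.sheaf.obj (op U)
  res : ∀ {V U : C} (f : V ⟶ U) (p : E'.sheaf.obj (op U)),
    rs E.sheaf f (toFun p) = toFun (rs E'.sheaf f p)
  str : ∀ {U : C} (p : E'.sheaf.obj (op U)), E.str (toFun p) = E'.str p ≫ base
  smul : ∀ {U : C} (g : G.obj (op U)) (p : E'.sheaf.obj (op U)),
    toFun (E'.act.smul g p) = E.act.smul g (toFun p)

/-- An object of the quotient stack `[X/G]` over `T`: a `G`-torsor `P` over `T` together with a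
`G`-equivariant morphism `toSpace : P ⟶ X`. -/
structure QuotObj (J : GrothendieckTopology C) {G : Cᵒᵖ ⥤ GrpCat.{w}} {X : Cᵒᵖ ⥤ Type w}
    (act : SpaceAction G X) (T : C) where
  torsor : Torsor J G T
  toSpace : ∀ {U : C}, torsor.sheaf.obj (op U) → X.obj (op U)
  toSpace_res : ∀ {V U : C} (f : V ⟶ U) (p : torsor.sheaf.obj (op U)),
    rs X f (toSpace p) = toSpace (rs torsor.sheaf f p)
  toSpace_smul : ∀ {U : C} (g : G.obj (op U)) (p : torsor.sheaf.obj (op U)),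
    toSpace (torsor.act.smul g p) = act.smul g (toSpace p)

/-- A morphism of `[X/G]`: a morphism of torsors compatible with the morphisms to `X`. -/
structure QuotHom {J : GrothendieckTopology C} {G : Cᵒᵖ ⥤ GrpCat.{w}} {X : Cᵒᵖ ⥤ Type w}
    {act : SpaceAction G X} {T' T : C} (E' : QuotObj J act T') (E : QuotObj J act T) extends
    TorsorHom E'.torsor E.torsor where
  toSpace : ∀ {U : C} (p : E'.torsor.sheaf.obj (op U)), E.toSpace (toFun p) = E'.toSpace p

variable {J : GrothendieckTopology C} {G : Cᵒᵖ ⥤ GrpCat.{w}} {X : Cᵒᵖ ⥤ Type w}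

theorem TorsorHom.ext' {T' T : C} {E' : Torsor J G T'} {E : Torsor J G T} {f g : TorsorHom E' E}
    (hb : f.base = g.base)
    (h : ∀ {U : C} (p : E'.sheaf.obj (op U)), f.toFun p = g.toFun p) : f = g := by
  obtain ⟨b, t, _, _, _⟩ := f
  obtain ⟨b', t', _, _, _⟩ := g
  obtain rfl : b = b' := hb
  have : @t = @t' := by funext U p; exact h p
  subst this
  rfl

variable {act : SpaceAction G X}

theorem QuotHom.ext' {T' T : C} {E' : QuotObj J act T'} {E : QuotObj J act T} {f g : QuotHom E' E}
    (hb : f.base = g.base)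
    (h : ∀ {U : C} (p : E'.torsor.sheaf.obj (op U)), f.toFun p = g.toFun p) : f = g := by
  obtain ⟨f, _⟩ := f
  obtain ⟨g, _⟩ := g
  obtain rfl : f = g := TorsorHom.ext' hb h
  rfl

/-- The identity of a torsor. -/
@[reducible]
def TorsorHom.id {T : C} (E : Torsor J G T) : TorsorHom E E where
  base := 𝟙 T
  toFun p := p
  res _ _ := rfl
  str _ := (Category.comp_id _).symm
  smul _ _ := rfl

/-- Composition of morphisms of torsors. -/
@[reducible]
def TorsorHom.comp {T'' T' T : C} {E'' : Torsor J G T''} {E' : Torsor J G T'} {E : Torsor J G T}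
    (f : TorsorHom E'' E') (g : TorsorHom E' E) : TorsorHom E'' E where
  base := f.base ≫ g.base
  toFun p := g.toFun (f.toFun p)
  res k p := by rw [g.res, f.res]
  str p := by rw [g.str, f.str, Category.assoc]
  smul k p := by rw [f.smul, g.smul]

/-- The quotient stack `[X/G]` as a category over `C`. -/
def quotientStack (J : GrothendieckTopology C) {G : Cᵒᵖ ⥤ GrpCat.{w}} {X : Cᵒᵖ ⥤ Type w}
    (act : SpaceAction G X) : CatOver.{u, v} C where
  Fib T := QuotObj J act T
  Hom E' E := QuotHom E' E
  base f := f.base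
  id E := { TorsorHom.id E.torsor with toSpace := fun _ => rfl }
  comp f g := { TorsorHom.comp f.toTorsorHom g.toTorsorHom with
    toSpace := fun p => (g.toSpace _).trans (f.toSpace p) }
  id_comp f := QuotHom.ext' (Category.id_comp _) fun _ => rfl
  comp_id f := QuotHom.ext' (Category.comp_id _) fun _ => rfl
  assoc f g h := QuotHom.ext' (Category.assoc _ _ _) fun _ => rfl
  base_id _ := rfl
  base_comp _ _ := rfl

theorem Torsor.eq_one {T : C} (E : Torsor J G T) {U : C} {g : G.obj (op U)}
    {p : E.sheaf.obj (op U)} (h : E.act.smul g p = p) : g = 1 :=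
  (E.simply_transitive p p rfl).unique h (E.act.one_smul p)

theorem TorsorHom.injective {T' T : C} {E' : Torsor J G T'} {E : Torsor J G T}
    (f : TorsorHom E' E) {U : C} {p p' : E'.sheaf.obj (op U)} (hs : E'.str p = E'.str p')
    (h : f.toFun p = f.toFun p') : p = p' := by
  obtain ⟨g, hg, -⟩ := E'.simply_transitive p p' hs
  have : g = 1 := E.eq_one (p := f.toFun p) (by rw [← f.smul, hg, h])
  rw [← hg, this, E'.act.one_smul]

/-- A morphism of torsors identifies the sections over `t : U ⟶ T'` with the sections over
the composite `U ⟶ T' ⟶ T`. -/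
theorem TorsorHom.exists_preimage {T' T : C} {E' : Torsor J G T'} {E : Torsor J G T}
    (hT : Presieve.IsSheaf J (yoneda.obj T'))
    (f : TorsorHom E' E) {U : C} (t : U ⟶ T') (p : E.sheaf.obj (op U))
    (hp : E.str p = t ≫ f.base) : ∃ p' : E'.sheaf.obj (op U), E'.str p' = t ∧ f.toFun p' = p := by
  obtain ⟨R, hR, hR'⟩ := E'.locally_nonempty
  have hS : R.pullback t ∈ J U := J.pullback_stable t hR
  obtain ⟨p', hp'⟩ := glueUnique E'.isSheaf hS
    (fun V k x => E'.str x = k ≫ t ∧ f.toFun x = rs E.sheaf k p) (by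
      intro V k hk
      obtain ⟨x, hx⟩ := hR' (k ≫ t) hk
      obtain ⟨g, hg, -⟩ := E.simply_transitive (f.toFun x) (rs E.sheaf k p) (by
        rw [f.str, hx, E.str_res, hp, Category.assoc])
      exact ⟨E'.act.smul g x, by rw [E'.str_smul, hx], by rw [f.smul, hg]⟩)
    (fun V k x x' hx hx' => f.injective (hx.1.trans hx'.1.symm) (hx.2.trans hx'.2.symm))
    (fun W V j k x hx => ⟨by rw [E'.str_res, hx.1, Category.assoc], by
      rw [← f.res, hx.2, rs_comp]⟩)
  refine ⟨p', ?_, ?_⟩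
  · refine sep hT hS fun V k hk => ?_
    change k ≫ _ = k ≫ _
    rw [← E'.str_res, (hp' k hk).1]
  · refine sep E.isSheaf hS fun V k hk => ?_
    rw [f.res, (hp' k hk).2]

/-- A morphism of `[X/G]` lying over an identity is invertible. -/
theorem QuotHom.isVertIso [J.Subcanonical] {T : C} {E' E : QuotObj J act T} (f : QuotHom E' E)
    (hb : f.base = 𝟙 T) : (quotientStack J act).IsVertIso f := by
  have key : ∀ {U : C} (p : E.torsor.sheaf.obj (op U)), ∃ p' : E'.torsor.sheaf.obj (op U),
      E'.torsor.str p' = E.torsor.str p ∧ f.toFun p' = p := fun p =>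
    f.toTorsorHom.exists_preimage
      (GrothendieckTopology.Subcanonical.isSheaf_of_isRepresentable _) _ p
      (by rw [hb, Category.comp_id])
  choose i hi hi' using @key
  have inj : ∀ {U : C} (p p' : E'.torsor.sheaf.obj (op U)), f.toFun p = f.toFun p' → p = p' :=
    fun p p' h => f.toTorsorHom.injective (by
      have := congrArg E.torsor.str h
      rwa [f.str, f.str, hb, Category.comp_id, Category.comp_id] at this) h
  have h₁ : ∀ {V U : C} (k : V ⟶ U) (p : E.torsor.sheaf.obj (op U)),
      rs E'.torsor.sheaf k (i p) = i (rs E.torsor.sheaf k p) := by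
    intro V U k p
    apply inj
    rw [hi', ← f.res, hi']
  have h₂ : ∀ {U : C} (p : E.torsor.sheaf.obj (op U)),
      E'.torsor.str (i p) = E.torsor.str p ≫ 𝟙 T := by
    intro U p
    rw [hi, Category.comp_id]
  have h₃ : ∀ {U : C} (g : G.obj (op U)) (p : E.torsor.sheaf.obj (op U)),
      i (E.torsor.act.smul g p) = E'.torsor.act.smul g (i p) := by
    intro U g p
    apply inj
    rw [hi', f.smul, hi']
  have h₄ : ∀ {U : C} (p : E.torsor.sheaf.obj (op U)), E'.toSpace (i p) = E.toSpace p := by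
    intro U p
    rw [← f.toSpace, hi']
  refine ⟨hb, ⟨⟨⟨𝟙 T, i, h₁, h₂, h₃⟩, h₄⟩, ?_, ?_⟩⟩
  · refine QuotHom.ext' ?_ fun p => inj _ _ (hi' _)
    change f.base ≫ 𝟙 T = 𝟙 T
    rw [hb, Category.comp_id]
  · refine QuotHom.ext' ?_ fun p => hi' p
    change 𝟙 T ≫ f.base = 𝟙 T
    rw [hb, Category.comp_id]

end Torsors

/-! ## Actions of group sheaves on stacks, and the quotient of a stack by an action -/

section StackActions

variable {C : Type u} [Category.{v} C]

/-- An action of a presheaf of groups `Q` on a category `𝒳` over `C`, in the weak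
(2-categorical) sense: a functor `Q × 𝒳 ⟶ 𝒳` over `C`, `(q, x) ↦ q · x`, with natural
isomorphisms `(q₂ q₁) · x ≅ q₂ · (q₁ · x)` and `x ≅ 1 · x` lying over identities and subject to
the usual coherence conditions.

A morphism `(q', x') ⟶ (q, x)` of `Q × 𝒳` is a morphism `f : x' ⟶ x` of `𝒳` such that `q'` is the
restriction of `q` along the image of `f` in `C`. In the axioms below, this condition appears as
hypotheses which are always provable (from `base_map`, `base_id`, and the fact that the structure
isomorphisms lie over identities); they are only there to type the morphism `map f _`. -/
structure StackAction (Q : Cᵒᵖ ⥤ GrpCat.{w}) (𝒳 : CatOver.{u, v, a, b} C) where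
  obj : ∀ {T : C}, Q.obj (op T) → 𝒳.Fib T → 𝒳.Fib T
  map : ∀ {T' T : C} {q' : Q.obj (op T')} {q : Q.obj (op T)} {x' : 𝒳.Fib T'} {x : 𝒳.Fib T}
    (f : 𝒳.Hom x' x), rg Q (𝒳.base f) q = q' → 𝒳.Hom (obj q' x') (obj q x)
  base_map : ∀ {T' T : C} {q' : Q.obj (op T')} {q : Q.obj (op T)} {x' : 𝒳.Fib T'}
    {x : 𝒳.Fib T} (f : 𝒳.Hom x' x) (h : rg Q (𝒳.base f) q = q'),
    𝒳.base (map f h) = 𝒳.base f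
  map_id : ∀ {T : C} {q : Q.obj (op T)} (x : 𝒳.Fib T) (h : rg Q (𝒳.base (𝒳.id x)) q = q),
    map (𝒳.id x) h = 𝒳.id (obj q x)
  map_comp : ∀ {T'' T' T : C} {q'' : Q.obj (op T'')} {q' : Q.obj (op T')} {q : Q.obj (op T)}
    {x'' : 𝒳.Fib T''} {x' : 𝒳.Fib T'} {x : 𝒳.Fib T} (f : 𝒳.Hom x'' x') (g : 𝒳.Hom x' x)
    (hf : rg Q (𝒳.base f) q' = q'') (hg : rg Q (𝒳.base g) q = q')
    (h : rg Q (𝒳.base (𝒳.comp f g)) q = q''),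
    map (𝒳.comp f g) h = 𝒳.comp (map f hf) (map g hg)
  assoc : ∀ {T : C} (q₂ q₁ : Q.obj (op T)) (x : 𝒳.Fib T),
    𝒳.Hom (obj (q₂ * q₁) x) (obj q₂ (obj q₁ x))
  assoc_iso : ∀ {T : C} (q₂ q₁ : Q.obj (op T)) (x : 𝒳.Fib T), 𝒳.IsVertIso (assoc q₂ q₁ x)
  assoc_natural : ∀ {T' T : C} {q₂' q₁' : Q.obj (op T')} {q₂ q₁ : Q.obj (op T)}
    {x' : 𝒳.Fib T'} {x : 𝒳.Fib T} (f : 𝒳.Hom x' x)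
    (h₁ : rg Q (𝒳.base f) q₁ = q₁')
    (h₂₁ : rg Q (𝒳.base f) (q₂ * q₁) = q₂' * q₁')
    (h₂' : rg Q (𝒳.base (map f h₁)) q₂ = q₂'),
    𝒳.comp (map f h₂₁) (assoc q₂ q₁ x) = 𝒳.comp (assoc q₂' q₁' x') (map (map f h₁) h₂')
  unit : ∀ {T : C} (x : 𝒳.Fib T), 𝒳.Hom x (obj 1 x)
  unit_iso : ∀ {T : C} (x : 𝒳.Fib T), 𝒳.IsVertIso (unit x)
  unit_natural : ∀ {T' T : C} {x' : 𝒳.Fib T'} {x : 𝒳.Fib T} (f : 𝒳.Hom x' x)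
    (h : rg Q (𝒳.base f) 1 = 1),
    𝒳.comp f (unit x) = 𝒳.comp (unit x') (map f h)
  /-- The two composites `((q₃ q₂) q₁) · x ⟶ q₃ · (q₂ · (q₁ · x))` agree. -/
  coherence_assoc : ∀ {T : C} (q₃ q₂ q₁ : Q.obj (op T)) (x : 𝒳.Fib T)
    (h : rg Q (𝒳.base (𝒳.id x)) (q₃ * (q₂ * q₁)) = q₃ * q₂ * q₁)
    (h' : rg Q (𝒳.base (assoc q₂ q₁ x)) q₃ = q₃),
    𝒳.comp (assoc (q₃ * q₂) q₁ x) (assoc q₃ q₂ (obj q₁ x)) =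
      𝒳.comp (map (𝒳.id x) h) (𝒳.comp (assoc q₃ (q₂ * q₁) x) (map (assoc q₂ q₁ x) h'))
  /-- The two isomorphisms `(1 q) · x ⟶ 1 · (q · x)` agree. -/
  coherence_one_mul : ∀ {T : C} (q : Q.obj (op T)) (x : 𝒳.Fib T)
    (h : rg Q (𝒳.base (𝒳.id x)) q = 1 * q),
    assoc 1 q x = 𝒳.comp (map (𝒳.id x) h) (unit (obj q x))
  /-- The two isomorphisms `(q 1) · x ⟶ q · (1 · x)` agree. -/
  coherence_mul_one : ∀ {T : C} (q : Q.obj (op T)) (x : 𝒳.Fib T)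
    (h : rg Q (𝒳.base (unit x)) q = q * 1),
    assoc q 1 x = map (unit x) h

variable {Q : Cᵒᵖ ⥤ GrpCat.{w}} {𝒳 : CatOver.{u, v, a, b} C}

/-- A `Q`-equivariant morphism from a presheaf `E` with `Q`-action to a category `𝒳` over `C` with
`Q`-action: a functor over `C` from (the category of sections of) `E` to `𝒳`, with natural
isomorphisms `F (q e) ≅ q · F e` compatible with the structure isomorphisms of the action. (The
hypotheses `h`, `h'`, `hq`, `hs` in the axioms are always provable.) -/
structure EquivariantMap {E : Cᵒᵖ ⥤ Type w} (e : SpaceAction Q E) (A : StackAction Q 𝒳) where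
  obj : ∀ {U : C}, E.obj (op U) → 𝒳.Fib U
  map : ∀ {V U : C} (f : V ⟶ U) {s' : E.obj (op V)} {s : E.obj (op U)}, rs E f s = s' →
    𝒳.Hom (obj s') (obj s)
  base_map : ∀ {V U : C} (f : V ⟶ U) {s' : E.obj (op V)} {s : E.obj (op U)}
    (h : rs E f s = s'), 𝒳.base (map f h) = f
  map_id : ∀ {U : C} (s : E.obj (op U)) (h : rs E (𝟙 U) s = s), map (𝟙 U) h = 𝒳.id (obj s)
  map_comp : ∀ {W V U : C} (g : W ⟶ V) (f : V ⟶ U) {s'' : E.obj (op W)} {s' : E.obj (op V)}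
    {s : E.obj (op U)} (hg : rs E g s' = s'') (hf : rs E f s = s') (h : rs E (g ≫ f) s = s''),
    map (g ≫ f) h = 𝒳.comp (map g hg) (map f hf)
  equi : ∀ {U : C} (q : Q.obj (op U)) (s : E.obj (op U)),
    𝒳.Hom (obj (e.smul q s)) (A.obj q (obj s))
  equi_iso : ∀ {U : C} (q : Q.obj (op U)) (s : E.obj (op U)), 𝒳.IsVertIso (equi q s)
  equi_natural : ∀ {V U : C} (f : V ⟶ U) {q' : Q.obj (op V)} {q : Q.obj (op U)}
    {s' : E.obj (op V)} {s : E.obj (op U)} (h : rs E f s = s')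
    (hq : rg Q (𝒳.base (map f h)) q = q') (hs : rs E f (e.smul q s) = e.smul q' s'),
    𝒳.comp (map f hs) (equi q s) = 𝒳.comp (equi q' s') (A.map (map f h) hq)
  equi_mul : ∀ {U : C} (q₂ q₁ : Q.obj (op U)) (s : E.obj (op U))
    (h : rs E (𝟙 U) (e.smul q₂ (e.smul q₁ s)) = e.smul (q₂ * q₁) s)
    (h' : rg Q (𝒳.base (equi q₁ s)) q₂ = q₂),
    𝒳.comp (equi (q₂ * q₁) s) (A.assoc q₂ q₁ (obj s)) =
      𝒳.comp (map (𝟙 U) h) (𝒳.comp (equi q₂ (e.smul q₁ s)) (A.map (equi q₁ s) h'))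
  equi_one : ∀ {U : C} (s : E.obj (op U)) (h : rs E (𝟙 U) s = e.smul 1 s),
    equi 1 s = 𝒳.comp (map (𝟙 U) h) (A.unit (obj s))

/-- An object over `T` of the quotient stack `[𝒳/Q]`: a `Q`-torsor over `T` with a `Q`-equivariant
morphism to `𝒳`. -/
structure StackQuotObj (J : GrothendieckTopology C) (A : StackAction Q 𝒳) (T : C) where
  torsor : Torsor J Q T
  toStack : EquivariantMap torsor.act A

/-- A morphism of `[𝒳/Q]`: a morphism `u : E' ⟶ E` of torsors together with an equivariant
2-isomorphism `τ` from `E' ⟶ 𝒳` to the composite `E' ⟶ E ⟶ 𝒳`. (The hypotheses `h`, `h'` in the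
axioms are always provable.) -/
structure StackQuotHom {J : GrothendieckTopology C} {A : StackAction Q 𝒳} {T' T : C}
    (E' : StackQuotObj J A T') (E : StackQuotObj J A T) where
  u : TorsorHom E'.torsor E.torsor
  τ : ∀ {U : C} (s : E'.torsor.sheaf.obj (op U)),
    𝒳.Hom (E'.toStack.obj s) (E.toStack.obj (u.toFun s))
  τ_iso : ∀ {U : C} (s : E'.torsor.sheaf.obj (op U)), 𝒳.IsVertIso (τ s)
  τ_natural : ∀ {V U : C} (f : V ⟶ U) {s' : E'.torsor.sheaf.obj (op V)}
    {s : E'.torsor.sheaf.obj (op U)} (h : rs E'.torsor.sheaf f s = s')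
    (h' : rs E.torsor.sheaf f (u.toFun s) = u.toFun s'),
    𝒳.comp (E'.toStack.map f h) (τ s) = 𝒳.comp (τ s') (E.toStack.map f h')
  τ_equivariant : ∀ {U : C} (q : Q.obj (op U)) (s : E'.torsor.sheaf.obj (op U))
    (h : rs E.torsor.sheaf (𝟙 U) (E.torsor.act.smul q (u.toFun s)) =
      u.toFun (E'.torsor.act.smul q s))
    (h' : rg Q (𝒳.base (τ s)) q = q),
    𝒳.comp (τ (E'.torsor.act.smul q s))
      (𝒳.comp (E.toStack.map (𝟙 U) h) (E.toStack.equi q (u.toFun s))) =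
      𝒳.comp (E'.toStack.equi q s) (A.map (τ s) h')

namespace CatOver.IsVertIso

variable {T : C}

theorem id (x : 𝒳.Fib T) : 𝒳.IsVertIso (𝒳.id x) :=
  ⟨𝒳.base_id x, 𝒳.id x, 𝒳.id_comp _, 𝒳.id_comp _⟩

theorem comp {x y z : 𝒳.Fib T} {f : 𝒳.Hom x y} {g : 𝒳.Hom y z} (hf : 𝒳.IsVertIso f)
    (hg : 𝒳.IsVertIso g) : 𝒳.IsVertIso (𝒳.comp f g) := by
  obtain ⟨hf, f', h₁, h₂⟩ := hf
  obtain ⟨hg, g', h₃, h₄⟩ := hg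
  refine ⟨by rw [𝒳.base_comp, hf, hg, Category.comp_id], 𝒳.comp g' f', ?_, ?_⟩
  · rw [𝒳.assoc, ← 𝒳.assoc g, h₃, 𝒳.id_comp, h₁]
  · rw [𝒳.assoc, ← 𝒳.assoc f', h₂, 𝒳.id_comp, h₄]

end CatOver.IsVertIso

variable {J : GrothendieckTopology C} {A : StackAction Q 𝒳}

theorem StackQuotHom.ext' {T' T : C} {E' : StackQuotObj J A T'} {E : StackQuotObj J A T}
    {f g : StackQuotHom E' E} (hb : f.u.base = g.u.base)
    (hu : ∀ {U : C} (s : E'.torsor.sheaf.obj (op U)), f.u.toFun s = g.u.toFun s)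
    (hτ : ∀ {U : C} (s : E'.torsor.sheaf.obj (op U)), HEq (f.τ s) (g.τ s)) : f = g := by
  obtain ⟨u, t, _, _, _⟩ := f
  obtain ⟨u', t', _, _, _⟩ := g
  obtain rfl : u = u' := TorsorHom.ext' hb hu
  have : @t = @t' := by funext U s; exact eq_of_heq (hτ s)
  subst this
  rfl

/-- The identity of an object of `[𝒳/Q]`. -/
def StackQuotHom.id {T : C} (E : StackQuotObj J A T) : StackQuotHom E E where
  u := TorsorHom.id E.torsor
  τ s := 𝒳.id _
  τ_iso s := .id _
  τ_natural f _ _ h _ := (𝒳.comp_id _).trans (𝒳.id_comp _).symm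
  τ_equivariant q s h h' := by
    have h₁ := E.toStack.map_id _ h
    have h₂ := A.map_id _ h'
    refine (𝒳.id_comp _).trans ?_
    refine (congrArg (fun t => 𝒳.comp t _) h₁).trans ?_
    refine (𝒳.id_comp _).trans ?_
    exact ((congrArg (fun t => 𝒳.comp _ t) h₂).trans (𝒳.comp_id _)).symm

/-- Composition of morphisms of `[𝒳/Q]`. -/
def StackQuotHom.comp {T'' T' T : C} {E'' : StackQuotObj J A T''} {E' : StackQuotObj J A T'}
    {E : StackQuotObj J A T} (f : StackQuotHom E'' E') (g : StackQuotHom E' E) :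
    StackQuotHom E'' E where
  u := TorsorHom.comp f.u g.u
  τ s := 𝒳.comp (f.τ s) (g.τ (f.u.toFun s))
  τ_iso s := (f.τ_iso s).comp (g.τ_iso _)
  τ_natural k s' s h h' := by
    have hf : rs E'.torsor.sheaf k (f.u.toFun s) = f.u.toFun s' := by rw [f.u.res, h]
    rw [← 𝒳.assoc, f.τ_natural k h hf, 𝒳.assoc, g.τ_natural k hf h', 𝒳.assoc]
  τ_equivariant := by
    intro U q s h h'
    have e₁ : rg Q (𝒳.base (f.τ s)) q = q := by rw [(f.τ_iso s).base_eq, rg_id]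
    have e₂ : rg Q (𝒳.base (g.τ (f.u.toFun s))) q = q := by rw [(g.τ_iso _).base_eq, rg_id]
    have hf : rs E'.torsor.sheaf (𝟙 U) (E'.torsor.act.smul q (f.u.toFun s)) =
      f.u.toFun (E''.torsor.act.smul q s) := by rw [rs_id, f.u.smul]
    have hg : rs E.torsor.sheaf (𝟙 U) (E.torsor.act.smul q (g.u.toFun (f.u.toFun s))) =
      g.u.toFun (E'.torsor.act.smul q (f.u.toFun s)) := by rw [rs_id, g.u.smul]
    have hgf : rs E.torsor.sheaf (𝟙 U) (g.u.toFun (E'.torsor.act.smul q (f.u.toFun s))) =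
      g.u.toFun (f.u.toFun (E''.torsor.act.smul q s)) := by rw [rs_id, f.u.smul]
    rw [A.map_comp _ _ e₁ e₂ h', ← 𝒳.assoc (E''.toStack.equi q s), ← f.τ_equivariant q s hf e₁,
      𝒳.assoc, 𝒳.assoc, 𝒳.assoc, ← g.τ_equivariant q _ hg e₂, ← 𝒳.assoc (E'.toStack.map _ _),
      g.τ_natural (𝟙 U) hf hgf, 𝒳.assoc, ← 𝒳.assoc (E.toStack.map _ _) (E.toStack.map _ _)]
    have hc : rs E.torsor.sheaf (𝟙 U ≫ 𝟙 U)
        (E.torsor.act.smul q (g.u.toFun (f.u.toFun s))) =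
        g.u.toFun (f.u.toFun (E''.torsor.act.smul q s)) := by
      rw [rs_comp, hg, hgf]
    have := E.toStack.map_comp (𝟙 U) (𝟙 U) hgf hg hc
    rw [← this]
    simp only [Category.comp_id]

/-- The quotient stack `[𝒳/Q]` of a category `𝒳` over `C` by an action of `Q`. -/
def stackQuotient (J : GrothendieckTopology C) (A : StackAction Q 𝒳) :
    CatOver.{u, v, max u (w + 1) v a b, max u w v b} C where
  Fib T := StackQuotObj J A T
  Hom E' E := StackQuotHom E' E
  base f := f.u.base
  id E := StackQuotHom.id E
  comp f g := StackQuotHom.comp f g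
  id_comp f := StackQuotHom.ext' (Category.id_comp _) (fun _ => rfl)
    fun _ => heq_of_eq (𝒳.id_comp _)
  comp_id f := StackQuotHom.ext' (Category.comp_id _) (fun _ => rfl)
    fun _ => heq_of_eq (𝒳.comp_id _)
  assoc f g h := StackQuotHom.ext' (Category.assoc _ _ _) (fun _ => rfl)
    fun _ => heq_of_eq (𝒳.assoc _ _ _)
  base_id _ := rfl
  base_comp _ _ := rfl

end StackActions

/-! ## The action of `G/H` on `[X/H]` -/

section Twist

variable {C : Type u} [Category.{v} C]

/-- `q : G ⟶ Q` exhibits `Q` as the quotient `G/H` of `G` by the subgroup sheaf `ι : H ⟶ G` for the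
topology `J`: `ι` is injective, `q` is `J`-locally surjective, and the kernel of `q` is `H`. -/
structure IsQuotient (J : GrothendieckTopology C) {H G Q : Cᵒᵖ ⥤ GrpCat.{w}} (ι : H ⟶ G)
    (q : G ⟶ Q) : Prop where
  isSheaf_sub : Presieve.IsSheaf J (H ⋙ forget GrpCat.{w})
  injective : ∀ {U : C} (h h' : H.obj (op U)), ga ι h = ga ι h' → h = h'
  ker : ∀ {U : C} (g : G.obj (op U)), ga q g = 1 ↔ ∃ h : H.obj (op U), ga ι h = g
  locally_surjective : ∀ {U : C} (c : Q.obj (op U)), ∃ S ∈ J U, ∀ ⦃V : C⦄ (k : V ⟶ U), S k →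
    ∃ g : G.obj (op V), ga q g = rg Q k c

/-- Let `E` be an `H`-torsor over `T` and `c` a section of `Q = G/H` over `T`. The elements of `G`
over `c` form a bitorsor `L c` under `H`, and `c` acts on `[X/H]` by sending `E` to the contracted
product `L c ×^H E`, which is the sheaf of `H`-equivariant maps `L c⁻¹ ⟶ E` over `T`. This is the
set of its sections over `U`: the equivariant maps `fn` over the structure morphism `str`. -/
structure TwistSec {J : GrothendieckTopology C} {H G Q : Cᵒᵖ ⥤ GrpCat.{w}} (ι : H ⟶ G)
    (q : G ⟶ Q) {T : C} (E : Torsor J H T) (c : Q.obj (op T)) (U : C) where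
  str : U ⟶ T
  fn : ∀ {V : C} (k : V ⟶ U) (g : G.obj (op V)), ga q g = (rg Q (k ≫ str) c)⁻¹ →
    E.sheaf.obj (op V)
  str_fn : ∀ {V : C} (k : V ⟶ U) (g : G.obj (op V)) (hg : ga q g = (rg Q (k ≫ str) c)⁻¹),
    E.str (fn k g hg) = k ≫ str
  fn_res : ∀ {W V : C} (j : W ⟶ V) (k : V ⟶ U) (g : G.obj (op V))
    (hg : ga q g = (rg Q (k ≫ str) c)⁻¹)
    (hg' : ga q (rg G j g) = (rg Q ((j ≫ k) ≫ str) c)⁻¹),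
    rs E.sheaf j (fn k g hg) = fn (j ≫ k) (rg G j g) hg'
  fn_smul : ∀ {V : C} (k : V ⟶ U) (h : H.obj (op V)) (g : G.obj (op V))
    (hg : ga q g = (rg Q (k ≫ str) c)⁻¹)
    (hg' : ga q (ga ι h * g) = (rg Q (k ≫ str) c)⁻¹),
    fn k (ga ι h * g) hg' = E.act.smul h (fn k g hg)

variable {J : GrothendieckTopology C} {H G Q : Cᵒᵖ ⥤ GrpCat.{w}} {ι : H ⟶ G} {q : G ⟶ Q}

namespace TwistSec

variable {T : C} {E : Torsor J H T} {c : Q.obj (op T)}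

theorem ext' {U : C} {s s' : TwistSec ι q E c U} (hs : s.str = s'.str)
    (h : ∀ {V : C} (k : V ⟶ U) (g : G.obj (op V)) (hg : ga q g = (rg Q (k ≫ s.str) c)⁻¹)
      (hg' : ga q g = (rg Q (k ≫ s'.str) c)⁻¹), s.fn k g hg = s'.fn k g hg') : s = s' := by
  obtain ⟨t, f, _, _, _⟩ := s
  obtain ⟨t', f', _, _, _⟩ := s'
  obtain rfl : t = t' := hs
  have : @f = @f' := by
    funext V k g hg
    exact h k g hg hg
  subst this
  rfl

theorem fn_congr {U : C} (s : TwistSec ι q E c U) {V : C} {k k' : V ⟶ U} {g g' : G.obj (op V)}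
    (hk : k = k') (hg : g = g') (h : ga q g = (rg Q (k ≫ s.str) c)⁻¹)
    (h' : ga q g' = (rg Q (k' ≫ s.str) c)⁻¹) : s.fn k g h = s.fn k' g' h' := by
  subst hk hg
  rfl

theorem cond_res {U : C} {t : U ⟶ T} {W V : C} (j : W ⟶ V) (k : V ⟶ U) {g : G.obj (op V)}
    (hg : ga q g = (rg Q (k ≫ t) c)⁻¹) : ga q (rg G j g) = (rg Q ((j ≫ k) ≫ t) c)⁻¹ := by
  rw [ga_rg, hg, map_inv, ← rg_comp, Category.assoc]

theorem cond_mul_left (hQ : IsQuotient J ι q) {V : C} {d : Q.obj (op V)} (h : H.obj (op V))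
    {g : G.obj (op V)} (hg : ga q g = d) : ga q (ga ι h * g) = d := by
  rw [map_mul, (hQ.ker _).2 ⟨h, rfl⟩, one_mul, hg]

theorem cond_mul_right (hQ : IsQuotient J ι q) {V : C} {d : Q.obj (op V)} (h : H.obj (op V))
    {g : G.obj (op V)} (hg : ga q g = d) : ga q (g * ga ι h) = d := by
  rw [map_mul, (hQ.ker _).2 ⟨h, rfl⟩, mul_one, hg]

theorem exists_eq_mul (hQ : IsQuotient J ι q) {V : C} {g g' : G.obj (op V)}
    (h : ga q g = ga q g') : ∃ x : H.obj (op V), g' = ga ι x * g := by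
  obtain ⟨x, hx⟩ := (hQ.ker (g' * g⁻¹)).1 (by rw [map_mul, map_inv, h, mul_inv_cancel])
  exact ⟨x, by rw [hx, inv_mul_cancel_right]⟩

/-- Locally there are elements of `G` over a given section of `Q`. -/
theorem cover (hQ : IsQuotient J ι q) {U : C} (t : U ⟶ T) (c : Q.obj (op T)) :
    ∃ S ∈ J U, ∀ ⦃V : C⦄ (k : V ⟶ U), S k →
      ∃ g : G.obj (op V), ga q g = (rg Q (k ≫ t) c)⁻¹ := by
  obtain ⟨S, hS, h⟩ := hQ.locally_surjective (rg Q t c)⁻¹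
  refine ⟨S, hS, fun V k hk => ?_⟩
  obtain ⟨g, hg⟩ := h k hk
  exact ⟨g, by rw [hg, map_inv, rg_comp]⟩

/-- Restriction of sections. -/
@[reducible]
def restrict {V U : C} (f : V ⟶ U) (s : TwistSec ι q E c U) : TwistSec ι q E c V where
  str := f ≫ s.str
  fn k g hg := s.fn (k ≫ f) g (by rw [hg, Category.assoc])
  str_fn k g hg := by rw [s.str_fn, Category.assoc]
  fn_res j k g hg hg' := by
    rw [s.fn_res j (k ≫ f) g _ (by rw [hg', Category.assoc, Category.assoc, Category.assoc])]
    exact s.fn_congr (Category.assoc _ _ _).symm rfl _ _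
  fn_smul k h g hg hg' := s.fn_smul _ _ _ _ _

end TwistSec

variable {T : C}

/-- The underlying presheaf of the twist of `E` by `c`. -/
def twistPresheaf (ι : H ⟶ G) (q : G ⟶ Q) (E : Torsor J H T) (c : Q.obj (op T)) :
    Cᵒᵖ ⥤ Type (max u v w) where
  obj U := TwistSec ι q E c U.unop
  map f := ↾fun s => s.restrict f.unop
  map_id U := by
    ext s
    exact TwistSec.ext' (Category.id_comp _) fun k g hg hg' =>
      s.fn_congr (Category.comp_id _) rfl _ _
  map_comp f g := by
    ext s
    exact TwistSec.ext' (Category.assoc _ _ _) fun k g hg hg' =>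
      s.fn_congr (Category.assoc _ _ _).symm rfl _ _

end Twist

section TwistTorsor

variable {C : Type u} [Category.{v} C] {J : GrothendieckTopology C}
  {H G Q : Cᵒᵖ ⥤ GrpCat.{max u v}} {ι : H ⟶ G} {q : G ⟶ Q} {T : C}

/-- The underlying presheaf of the twist of `E` by `c` is a sheaf. -/
theorem isSheaf_twistPresheaf [J.Subcanonical] (E : Torsor J H T) (c : Q.obj (op T)) :
    Presieve.IsSheaf J (twistPresheaf ι q E c) := by
  have hT : Presieve.IsSheaf J (yoneda.obj T) :=
    GrothendieckTopology.Subcanonical.isSheaf_of_isRepresentable _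
  intro U S hS x hx
  have hx' : ∀ {W V : C} (j : W ⟶ V) (k : V ⟶ U) (hk : S k),
      (x k hk).restrict j = x (j ≫ k) (S.downward_closed hk j) := fun j k hk =>
    ((Presieve.compatible_iff_sieveCompatible _).1 hx k j hk).symm
  have hstr : ∀ {W V : C} (j : W ⟶ V) (k : V ⟶ U) (hk : S k) (hjk : S (j ≫ k)),
      (x (j ≫ k) hjk).str = j ≫ (x k hk).str := fun j k hk hjk => by rw [← hx' j k hk]
  have hfn : ∀ {Z W V : C} (j : W ⟶ V) (k : V ⟶ U) (hk : S k) (hjk : S (j ≫ k)) (i : Z ⟶ W)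
      (g : G.obj (op Z)) (hg : ga q g = (rg Q (i ≫ (x (j ≫ k) hjk).str) c)⁻¹)
      (hg' : ga q g = (rg Q ((i ≫ j) ≫ (x k hk).str) c)⁻¹),
      (x (j ≫ k) hjk).fn i g hg = (x k hk).fn (i ≫ j) g hg' := by
    intro Z W V j k hk hjk i g hg hg'
    have := hx' j k hk
    generalize x (j ≫ k) hjk = y at *
    subst this
    rfl
  obtain ⟨t, ht⟩ := glue hT hS (fun V k hk => (x k hk).str)
    (fun W V j k hk => (hstr j k hk _).symm)
  replace ht : ∀ {V : C} (k : V ⟶ U) (hk : S k), k ≫ t = (x k hk).str := fun k hk => ht k hk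
  -- glue the values of the equivariant maps
  have hg₀ : ∀ {V : C} (k : V ⟶ U) (g : G.obj (op V)) (_ : ga q g = (rg Q (k ≫ t) c)⁻¹)
      {W : C} (j : W ⟶ V) (hj : S (j ≫ k)),
      ga q (rg G j g) = (rg Q (𝟙 W ≫ (x (j ≫ k) hj).str) c)⁻¹ := by
    intro V k g hg W j hj
    rw [Category.id_comp, ← ht _ hj]
    exact TwistSec.cond_res j k hg
  have key : ∀ {V : C} (k : V ⟶ U) (g : G.obj (op V)) (hg : ga q g = (rg Q (k ≫ t) c)⁻¹),
      ∃ p : E.sheaf.obj (op V), ∀ {W : C} (j : W ⟶ V) (hj : S (j ≫ k)),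
        rs E.sheaf j p = (x (j ≫ k) hj).fn (𝟙 W) (rg G j g) (hg₀ k g hg j hj) := by
    intro V k g hg
    obtain ⟨p, hp⟩ := glue E.isSheaf (J.pullback_stable k hS)
      (fun W j hj => (x (j ≫ k) hj).fn (𝟙 W) (rg G j g) (hg₀ k g hg j hj)) (by
        intro W' W i j hj
        have e : (i ≫ j) ≫ k = i ≫ (j ≫ k) := Category.assoc _ _ _
        have hij : S (i ≫ (j ≫ k)) := S.downward_closed hj i
        have c₁ : ga q (rg G i (rg G j g)) =
            (rg Q ((i ≫ 𝟙 W) ≫ (x (j ≫ k) hj).str) c)⁻¹ :=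
          TwistSec.cond_res i (𝟙 W) (hg₀ k g hg j hj)
        rw [(x (j ≫ k) hj).fn_res i (𝟙 W) _ _ c₁]
        have c₂ : ga q (rg G i (rg G j g)) =
            (rg Q (𝟙 W' ≫ (x (i ≫ (j ≫ k)) hij).str) c)⁻¹ := by
          rw [c₁, hstr i (j ≫ k) hj hij, Category.comp_id, Category.id_comp]
        have c₃ : ga q (rg G i (rg G j g)) =
            (rg Q ((𝟙 W' ≫ i) ≫ (x (j ≫ k) hj).str) c)⁻¹ := by
          rw [c₁, Category.comp_id, Category.id_comp]
        have h₁ := hfn i (j ≫ k) hj hij (𝟙 W') _ c₂ c₃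
        rw [(x (j ≫ k) hj).fn_congr (show i ≫ 𝟙 W = 𝟙 W' ≫ i by simp) rfl c₁ c₃, ← h₁]
        have gen : ∀ (l l' : W' ⟶ U) (_ : l = l') (hl : S l) (hl' : S l')
            (a a' : G.obj (op W')) (_ : a = a')
            (ha : ga q a = (rg Q (𝟙 W' ≫ (x l hl).str) c)⁻¹)
            (ha' : ga q a' = (rg Q (𝟙 W' ≫ (x l' hl').str) c)⁻¹),
            (x l hl).fn (𝟙 W') a ha = (x l' hl').fn (𝟙 W') a' ha' := by
          intro l l' h hl hl' a a' h' ha ha'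
          subst h h'
          rfl
        exact gen _ _ e.symm _ _ _ _ (rg_comp _ _ _ _).symm _ _)
    exact ⟨p, fun j hj => hp j hj⟩
  choose f hf using @key
  have gen : ∀ {W : C} (l l' : W ⟶ U) (_ : l = l') (hl : S l) (hl' : S l')
      (a a' : G.obj (op W)) (_ : a = a')
      (ha : ga q a = (rg Q (𝟙 W ≫ (x l hl).str) c)⁻¹)
      (ha' : ga q a' = (rg Q (𝟙 W ≫ (x l' hl').str) c)⁻¹),
      (x l hl).fn (𝟙 W) a ha = (x l' hl').fn (𝟙 W) a' ha' := by
    intro W l l' h hl hl' a a' h' ha ha'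
    subst h h'
    rfl
  refine ⟨⟨t, fun k g hg => f k g hg, ?_, ?_, ?_⟩, ?_, ?_⟩
  · intro V k g hg
    refine sep hT (J.pullback_stable k hS) fun W j hj => ?_
    change j ≫ E.str _ = j ≫ k ≫ t
    rw [← E.str_res, hf k g hg j hj, (x _ hj).str_fn, Category.id_comp, ← ht _ hj,
      Category.assoc]
  · intro W V j k g hg hg'
    refine sep E.isSheaf (J.pullback_stable (j ≫ k) hS) fun Z i hi => ?_
    have hi' : S ((i ≫ j) ≫ k) := by
      rw [Category.assoc]
      exact hi
    rw [← rs_comp, hf k g hg (i ≫ j) hi', hf (j ≫ k) _ hg' i hi]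
    exact gen _ _ (Category.assoc _ _ _) _ _ _ _ (rg_comp _ _ _ _) _ _
  · intro V k h g hg hg'
    refine sep E.isSheaf (J.pullback_stable k hS) fun W j hj => ?_
    have c₁ : ga q (ga ι (rg H j h) * rg G j g) = (rg Q (𝟙 W ≫ (x (j ≫ k) hj).str) c)⁻¹ := by
      rw [ga_rg, ← map_mul]
      exact hg₀ k _ hg' j hj
    rw [hf k _ hg' j hj, E.act.res_smul, hf k g hg j hj,
      ← (x (j ≫ k) hj).fn_smul (𝟙 W) (rg H j h) (rg G j g) _ c₁]
    exact (x (j ≫ k) hj).fn_congr rfl (by rw [map_mul, ga_rg]) _ _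
  · intro V k hk
    refine TwistSec.ext' (ht k hk) fun {W} j g hg hg' => ?_
    change f (j ≫ k) g _ = _
    have hg'' : ga q g = (rg Q ((j ≫ k) ≫ t) c)⁻¹ := by
      rw [hg', ← ht k hk, Category.assoc]
    refine sep E.isSheaf (J.pullback_stable (j ≫ k) hS) fun Z i hi => ?_
    have hi' : S ((i ≫ j) ≫ k) := by
      rw [Category.assoc]
      exact hi
    have c₁ : ga q (rg G i g) = (rg Q (𝟙 Z ≫ (x ((i ≫ j) ≫ k) hi').str) c)⁻¹ := by
      have := hg₀ (j ≫ k) g hg'' i hi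
      rw [← ht _ hi] at this
      rw [this, ← ht _ hi']
      simp only [Category.assoc]
    have c₂ : ga q (rg G i g) = (rg Q ((𝟙 Z ≫ i ≫ j) ≫ (x k hk).str) c)⁻¹ := by
      rw [Category.id_comp]
      exact TwistSec.cond_res i j hg'
    have c₃ : ga q (rg G i g) = (rg Q ((i ≫ j) ≫ (x k hk).str) c)⁻¹ :=
      TwistSec.cond_res i j hg'
    rw [hf (j ≫ k) g hg'' i hi, (x k hk).fn_res i j g hg' c₃,
      gen _ _ (Category.assoc i j k).symm hi hi' _ _ rfl _ c₁, hfn (i ≫ j) k hk hi' _ _ c₁ c₂]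
    exact (x k hk).fn_congr (Category.id_comp _) rfl _ _
  · intro s' hs'
    have hs : ∀ {V : C} (k : V ⟶ U) (hk : S k), s'.restrict k = x k hk := fun k hk => hs' k hk
    have hst : s'.str = t := by
      refine sep hT hS fun V k hk => ?_
      change k ≫ s'.str = k ≫ t
      rw [ht k hk, ← hs k hk]
    refine TwistSec.ext' hst fun {V} k g hg hg' => ?_
    change _ = f k g hg'
    refine sep E.isSheaf (J.pullback_stable k hS) fun W j hj => ?_
    have c₁ : ga q (rg G j g) = (rg Q ((j ≫ k) ≫ s'.str) c)⁻¹ := TwistSec.cond_res j k hg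
    have c₂ : ga q (rg G j g) = (rg Q (𝟙 W ≫ (s'.restrict (j ≫ k)).str) c)⁻¹ := by
      rw [Category.id_comp]
      exact c₁
    rw [hf k g hg' j hj, s'.fn_res j k g hg c₁]
    have e : ∀ (y : TwistSec ι q E c W) (_ : s'.restrict (j ≫ k) = y)
        (h : ga q (rg G j g) = (rg Q (𝟙 W ≫ y.str) c)⁻¹),
        (s'.restrict (j ≫ k)).fn (𝟙 W) (rg G j g) c₂ = y.fn (𝟙 W) (rg G j g) h := by
      intro y hy h
      subst hy
      rfl
    rw [← e _ (hs _ hj)]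
    exact s'.fn_congr (Category.id_comp _).symm rfl _ _

/-- The action of `H` on the twist: `(h f)(g) = f (g h)`. -/
def twistAction (hQ : IsQuotient J ι q) (E : Torsor J H T) (c : Q.obj (op T)) :
    SpaceAction H (twistPresheaf ι q E c) where
  smul {U} h (s : TwistSec ι q E c U) := ({
    str := s.str
    fn := fun k g hg => s.fn k (g * ga ι (rg H k h)) (TwistSec.cond_mul_right hQ _ hg)
    str_fn := fun k g hg => s.str_fn _ _ _
    fn_res := fun j k g hg hg' => by
      rw [s.fn_res j k _ _ (TwistSec.cond_res j k (TwistSec.cond_mul_right hQ _ hg))]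
      exact s.fn_congr rfl (by rw [map_mul, ← ga_rg, ← rg_comp]) _ _
    fn_smul := fun k x g hg hg' => by
      rw [← s.fn_smul k x _ _
        (TwistSec.cond_mul_left hQ _ (TwistSec.cond_mul_right hQ _ hg))]
      exact s.fn_congr rfl (mul_assoc _ _ _) _ _ } : TwistSec ι q E c U)
  one_smul s := TwistSec.ext' rfl fun k g hg hg' =>
    TwistSec.fn_congr s rfl (by rw [map_one, map_one, mul_one]) _ _
  mul_smul h h' s := TwistSec.ext' rfl fun k g hg hg' =>
    TwistSec.fn_congr s rfl (by rw [map_mul, map_mul, mul_assoc]) _ _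
  res_smul f h s := TwistSec.ext' rfl fun k g hg hg' =>
    TwistSec.fn_congr s rfl (by rw [rg_comp]; rfl) _ _

/-- The twist of an `H`-torsor `E` over `T` by a section `c` of `G/H` over `T`. -/
def Torsor.twist [J.Subcanonical] (hQ : IsQuotient J ι q) (E : Torsor J H T)
    (c : Q.obj (op T)) : Torsor J H T where
  sheaf := twistPresheaf ι q E c
  isSheaf := isSheaf_twistPresheaf E c
  str s := TwistSec.str s
  str_res _ _ := rfl
  act := twistAction hQ E c
  str_smul _ _ := rfl
  simply_transitive {U} s s' hss := by
    change TwistSec ι q E c U at s s'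
    obtain ⟨S, hS, hS'⟩ := TwistSec.cover hQ s.str c
    have huniq : ∀ {V : C} (k : V ⟶ U) (h h' : H.obj (op V)) (g : G.obj (op V))
        (hg : ga q g = (rg Q (k ≫ s.str) c)⁻¹),
        s.fn k (g * ga ι h) (TwistSec.cond_mul_right hQ _ hg) =
          s.fn k (g * ga ι h') (TwistSec.cond_mul_right hQ _ hg) → h = h' := by
      intro V k h h' g hg e
      obtain ⟨x, hx⟩ := TwistSec.exists_eq_mul hQ (g := g * ga ι h) (g' := g * ga ι h')
        ((TwistSec.cond_mul_right hQ h hg).trans (TwistSec.cond_mul_right hQ h' hg).symm)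
      have c₁ := TwistSec.cond_mul_left hQ x (TwistSec.cond_mul_right hQ h hg)
      rw [s.fn_congr rfl hx _ c₁, s.fn_smul k x _ (TwistSec.cond_mul_right hQ h hg) c₁] at e
      have := E.eq_one e.symm
      rw [this, map_one, one_mul] at hx
      exact hQ.injective _ _ (mul_left_cancel hx).symm
    -- the condition on a local section of `H`
    let Φ : ∀ ⦃V : C⦄, (V ⟶ U) → H.obj (op V) → Prop := fun V k h =>
      S k ∧ ∀ ⦃W : C⦄ (j : W ⟶ V) (g : G.obj (op W))
        (hg : ga q g = (rg Q ((j ≫ k) ≫ s.str) c)⁻¹)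
        (hg' : ga q g = (rg Q ((j ≫ k) ≫ s'.str) c)⁻¹),
        s.fn (j ≫ k) (g * ga ι (rg H j h)) (TwistSec.cond_mul_right hQ _ hg) =
          s'.fn (j ≫ k) g hg'
    have hss' : s.str = s'.str := hss
    obtain ⟨h, hh⟩ := glueUnique hQ.isSheaf_sub hS Φ (by
      intro V k hk
      obtain ⟨g₀, hg₀⟩ := hS' k hk
      have hg₀' : ga q g₀ = (rg Q (k ≫ s'.str) c)⁻¹ := by rw [← hss', hg₀]
      obtain ⟨x, hx, -⟩ := E.simply_transitive (s.fn k g₀ hg₀) (s'.fn k g₀ hg₀') (by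
        rw [s.str_fn, s'.str_fn, hss'])
      obtain ⟨h, hh⟩ := (hQ.ker (g₀⁻¹ * ga ι x * g₀)).1 (by
        rw [map_mul, map_mul, (hQ.ker (ga ι x)).2 ⟨x, rfl⟩, mul_one, map_inv, inv_mul_cancel])
      refine ⟨h, hk, fun W j g hg hg' => ?_⟩
      obtain ⟨y, hy⟩ := TwistSec.exists_eq_mul hQ (g := rg G j g₀) (g' := g)
        ((TwistSec.cond_res j k hg₀).trans hg.symm)
      have c₁ : ga q (ga ι y * rg G j g₀) = (rg Q ((j ≫ k) ≫ s'.str) c)⁻¹ := by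
        rw [← hy, hg']
      have c₂ := TwistSec.cond_res j k hg₀'
      have c₃ := TwistSec.cond_res j k hg₀
      have c₄ := TwistSec.cond_mul_left hQ (rg H j x) c₃
      have c₅ := TwistSec.cond_mul_left hQ y c₄
      have c₆ : ga q (ga ι x * g₀) = (rg Q (k ≫ s.str) c)⁻¹ := TwistSec.cond_mul_left hQ x hg₀
      rw [s'.fn_congr rfl hy hg' c₁, s'.fn_smul _ y _ c₂ c₁, ← s'.fn_res j k g₀ hg₀' c₂, ← hx,
        ← s.fn_smul k x g₀ hg₀ c₆, s.fn_res j k _ c₆ (TwistSec.cond_res j k c₆),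
        s.fn_congr rfl (show rg G j (ga ι x * g₀) = ga ι (rg H j x) * rg G j g₀ by
          rw [map_mul, ga_rg]) _ c₄, ← s.fn_smul _ y _ c₄ c₅]
      refine s.fn_congr rfl ?_ _ _
      rw [ga_rg, hh, hy]
      simp only [map_mul, map_inv, ga_rg]
      group)
      (by
        rintro V k h h' ⟨hk, h₁⟩ ⟨-, h₂⟩
        obtain ⟨g₀, hg₀⟩ := hS' k hk
        have c₁ : ga q g₀ = (rg Q ((𝟙 V ≫ k) ≫ s.str) c)⁻¹ := by rw [Category.id_comp, hg₀]
        have c₂ : ga q g₀ = (rg Q ((𝟙 V ≫ k) ≫ s'.str) c)⁻¹ := by rw [← hss', c₁]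
        have := huniq _ _ _ _ c₁ ((h₁ (𝟙 V) g₀ c₁ c₂).trans (h₂ (𝟙 V) g₀ c₁ c₂).symm)
        rwa [rg_id, rg_id] at this)
      (by
        rintro W V j k h ⟨hk, h₁⟩
        refine ⟨S.downward_closed hk j, fun Z i g hg hg' => ?_⟩
        have c₁ : ga q g = (rg Q (((i ≫ j) ≫ k) ≫ s.str) c)⁻¹ := by
          rw [hg]
          simp only [Category.assoc]
        have c₂ : ga q g = (rg Q (((i ≫ j) ≫ k) ≫ s'.str) c)⁻¹ := by
          rw [hg']
          simp only [Category.assoc]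
        rw [s'.fn_congr (Category.assoc _ _ _).symm rfl hg' c₂, ← h₁ (i ≫ j) g c₁ c₂]
        refine s.fn_congr (Category.assoc _ _ _).symm ?_ _ _
        rw [rg_comp]
        rfl)
    refine ⟨h, ?_, ?_⟩
    · refine TwistSec.ext' hss fun {V} k g hg hg' => ?_
      change s.fn k (g * ga ι (rg H k h)) _ = _
      refine sep E.isSheaf (J.pullback_stable k hS) fun W j hj => ?_
      have c₁ := TwistSec.cond_res j k (TwistSec.cond_mul_right hQ (rg H k h) hg)
      have c₂ := TwistSec.cond_res j k hg
      have c₃ := TwistSec.cond_res j k hg'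
      have c₄ : ga q (rg G j g) = (rg Q ((𝟙 W ≫ j ≫ k) ≫ s.str) c)⁻¹ := by
        rw [Category.id_comp]
        exact c₂
      have c₅ : ga q (rg G j g) = (rg Q ((𝟙 W ≫ j ≫ k) ≫ s'.str) c)⁻¹ := by
        rw [Category.id_comp, c₃]
      rw [s.fn_res j k _ _ c₁, s'.fn_res j k _ _ c₃,
        s'.fn_congr (Category.id_comp _).symm rfl c₃ c₅, ← (hh (j ≫ k) hj).2 (𝟙 W) _ c₄ c₅]
      refine s.fn_congr (Category.id_comp _).symm ?_ _ _
      rw [rg_id, map_mul]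
      congr 1
      rw [← ga_rg, ← rg_comp]
      rfl
    · intro h' hh'
      refine sep hQ.isSheaf_sub hS fun V k hk => ?_
      obtain ⟨g₀, hg₀⟩ := hS' k hk
      have hg₀' : ga q g₀ = (rg Q (k ≫ s'.str) c)⁻¹ := by rw [← hss', hg₀]
      have c₁ : ga q g₀ = (rg Q ((𝟙 V ≫ k) ≫ s.str) c)⁻¹ := by rw [Category.id_comp, hg₀]
      have c₂ : ga q g₀ = (rg Q ((𝟙 V ≫ k) ≫ s'.str) c)⁻¹ := by rw [← hss', c₁]
      refine huniq k _ _ g₀ hg₀ ?_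
      have e₁ : s.fn k (g₀ * ga ι (rg H k h')) (TwistSec.cond_mul_right hQ _ hg₀) =
          s'.fn k g₀ hg₀' := by
        subst hh'
        rfl
      refine e₁.trans ?_
      have e₂ := (hh k hk).2 (𝟙 V) g₀ c₁ c₂
      rw [s'.fn_congr (Category.id_comp _).symm rfl hg₀' c₂, ← e₂]
      refine s.fn_congr (Category.id_comp _) ?_ _ _
      rw [rg_id]
  locally_nonempty := by
    obtain ⟨R, hR, hR'⟩ := E.locally_nonempty
    obtain ⟨S, hS, hS'⟩ := TwistSec.cover hQ (𝟙 T) c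
    refine ⟨R ⊓ S, J.intersection_covering hR hS, fun U b hb => ?_⟩
    obtain ⟨p, hp⟩ := hR' b hb.1
    obtain ⟨g₀, hg₀⟩ := hS' b hb.2
    rw [Category.comp_id] at hg₀
    have ex : ∀ {V : C} (k : V ⟶ U) (g : G.obj (op V)), ga q g = (rg Q (k ≫ b) c)⁻¹ →
        ∃ x : H.obj (op V), g = ga ι x * rg G k g₀ := fun k g hg =>
      TwistSec.exists_eq_mul hQ (by rw [hg, ga_rg, hg₀, map_inv, rg_comp])
    choose x hx using @ex
    have xuniq : ∀ {V : C} {g : G.obj (op V)} {y y' : H.obj (op V)},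
        ga ι y * g = ga ι y' * g → y = y' := fun h =>
      hQ.injective _ _ (mul_right_cancel h)
    refine ⟨({
      str := b
      fn := fun k g hg => E.act.smul (x k g hg) (rs E.sheaf k p)
      str_fn := fun k g hg => by rw [E.str_smul, E.str_res, hp]
      fn_res := fun j k g hg hg' => by
        rw [E.act.res_smul, ← rs_comp]
        congr 1
        refine xuniq (g := rg G (j ≫ k) g₀) ?_
        rw [← hx, ga_rg, rg_comp, ← map_mul, ← hx]
      fn_smul := fun k h g hg hg' => by
        rw [← E.act.mul_smul]
        congr 1
        refine xuniq (g := rg G k g₀) ?_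
        rw [← hx, map_mul, mul_assoc, ← hx] } : TwistSec ι q E c U), rfl⟩

variable {X : Cᵒᵖ ⥤ Type (max u v)} {act : SpaceAction G X}

theorem exists_twistSpace (hQ : IsQuotient J ι q) (hX : Presieve.IsSheaf J X)
    (E : QuotObj J (act.restrict ι) T) (c : Q.obj (op T)) {U : C}
    (s : TwistSec ι q E.torsor c U) :
    ∃ x : X.obj (op U), ∀ {V : C} (k : V ⟶ U) (g : G.obj (op V))
      (hg : ga q g = (rg Q (k ≫ s.str) c)⁻¹),
      rs X k x = act.smul g⁻¹ (E.toSpace (s.fn k g hg)) := by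
  have ind : ∀ {V : C} (k : V ⟶ U) (g g' : G.obj (op V))
      (hg : ga q g = (rg Q (k ≫ s.str) c)⁻¹) (hg' : ga q g' = (rg Q (k ≫ s.str) c)⁻¹),
      act.smul g⁻¹ (E.toSpace (s.fn k g hg)) = act.smul g'⁻¹ (E.toSpace (s.fn k g' hg')) := by
    intro V k g g' hg hg'
    obtain ⟨y, rfl⟩ := TwistSec.exists_eq_mul hQ (hg.trans hg'.symm)
    rw [s.fn_smul k y g hg hg', E.toSpace_smul]
    change _ = act.smul _ (act.smul (ga ι y) _)
    rw [← act.mul_smul, mul_inv_rev, inv_mul_cancel_right]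
  have indRes : ∀ {W V : C} (j : W ⟶ V) (k : V ⟶ U) (g : G.obj (op V)) (g' : G.obj (op W))
      (hg : ga q g = (rg Q (k ≫ s.str) c)⁻¹)
      (hg' : ga q g' = (rg Q ((j ≫ k) ≫ s.str) c)⁻¹),
      rs X j (act.smul g⁻¹ (E.toSpace (s.fn k g hg))) =
        act.smul g'⁻¹ (E.toSpace (s.fn (j ≫ k) g' hg')) := by
    intro W V j k g g' hg hg'
    rw [act.res_smul, E.toSpace_res, s.fn_res j k g hg (TwistSec.cond_res j k hg), map_inv]
    exact ind _ _ _ _ _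
  obtain ⟨S, hS, hS'⟩ := TwistSec.cover hQ s.str c
  choose g₀ hg₀ using hS'
  obtain ⟨x, hx⟩ := glue hX hS
    (fun V k hk => act.smul (g₀ k hk)⁻¹ (E.toSpace (s.fn k (g₀ k hk) (hg₀ k hk))))
    (fun W V j k hk => indRes _ _ _ _ _ _)
  refine ⟨x, fun {V} k g hg => ?_⟩
  refine sep hX (J.pullback_stable k hS) fun W j hj => ?_
  rw [← rs_comp, hx (j ≫ k) hj]
  exact (indRes _ _ _ _ _ _).symm

/-- The morphism from the twist of `E` by `c` to `X`: an equivariant map `f` is sent to the section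
of `X` that locally equals `g⁻¹ • π (f g)`. -/
def twistSpace (hQ : IsQuotient J ι q) (hX : Presieve.IsSheaf J X)
    (E : QuotObj J (act.restrict ι) T) (c : Q.obj (op T)) {U : C}
    (s : TwistSec ι q E.torsor c U) : X.obj (op U) :=
  (exists_twistSpace hQ hX E c s).choose

theorem twistSpace_spec (hQ : IsQuotient J ι q) (hX : Presieve.IsSheaf J X)
    (E : QuotObj J (act.restrict ι) T) (c : Q.obj (op T)) {U : C}
    (s : TwistSec ι q E.torsor c U) {V : C} (k : V ⟶ U) (g : G.obj (op V))
    (hg : ga q g = (rg Q (k ≫ s.str) c)⁻¹) :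
    rs X k (twistSpace hQ hX E c s) = act.smul g⁻¹ (E.toSpace (s.fn k g hg)) :=
  (exists_twistSpace hQ hX E c s).choose_spec k g hg

theorem twistSpace_eq (hQ : IsQuotient J ι q) (hX : Presieve.IsSheaf J X)
    (E : QuotObj J (act.restrict ι) T) (c : Q.obj (op T)) {U : C}
    (s : TwistSec ι q E.torsor c U) (y : X.obj (op U))
    (h : ∀ {V : C} (k : V ⟶ U) (g : G.obj (op V)) (hg : ga q g = (rg Q (k ≫ s.str) c)⁻¹),
      rs X k y = act.smul g⁻¹ (E.toSpace (s.fn k g hg))) :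
    twistSpace hQ hX E c s = y := by
  obtain ⟨S, hS, hS'⟩ := TwistSec.cover hQ s.str c
  refine sep hX hS fun V k hk => ?_
  obtain ⟨g, hg⟩ := hS' k hk
  rw [twistSpace_spec hQ hX E c s k g hg, h k g hg]

variable [J.Subcanonical]

/-- The object `c · E` of `[X/H]`, for an object `E` of `[X/H]` over `T` and a section `c` of
`Q = G/H` over `T`. If `c` is the image of `g : G(T)`, evaluation at `g⁻¹` identifies `c · E` with
the torsor `E` on which `h` acts as `g⁻¹ h g`, and with the morphism `p ↦ g • π p` to `X`. -/
def QuotObj.twist (hQ : IsQuotient J ι q) (hX : Presieve.IsSheaf J X)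
    (E : QuotObj J (act.restrict ι) T) (c : Q.obj (op T)) : QuotObj J (act.restrict ι) T where
  torsor := E.torsor.twist hQ c
  toSpace s := twistSpace hQ hX E c s
  toSpace_res f s := by
    refine (twistSpace_eq hQ hX E c _ _ fun k g hg => ?_).symm
    rw [← rs_comp, twistSpace_spec hQ hX E c s (k ≫ f) g (by
      rw [hg]
      change (rg Q (k ≫ f ≫ TwistSec.str s) c)⁻¹ = _
      rw [Category.assoc])]
    rfl
  toSpace_smul h s := by
    refine twistSpace_eq hQ hX E c _ _ fun k g hg => ?_
    change rs X k (act.smul (ga ι h) _) = act.smul g⁻¹ (E.toSpace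
      (TwistSec.fn s k (g * ga ι (rg H k h)) (TwistSec.cond_mul_right hQ _ hg)))
    rw [act.res_smul, twistSpace_spec hQ hX E c s k (g * ga ι (rg H k h))
      (TwistSec.cond_mul_right hQ _ hg), ← act.mul_smul, ← ga_rg, mul_inv_rev,
      mul_inv_cancel_left]

/-- Functoriality of the twist. -/
def QuotHom.twist (hQ : IsQuotient J ι q) (hX : Presieve.IsSheaf J X) {T' T : C}
    {E' : QuotObj J (act.restrict ι) T'} {E : QuotObj J (act.restrict ι) T} (f : QuotHom E' E)
    {c' : Q.obj (op T')} {c : Q.obj (op T)} (hc : rg Q f.base c = c') :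
    QuotHom (E'.twist hQ hX c') (E.twist hQ hX c) where
  base := f.base
  toFun {U} (s : TwistSec ι q E'.torsor c' U) := ({
    str := s.str ≫ f.base
    fn := fun k g hg => f.toFun (s.fn k g (by subst hc; rw [hg, ← rg_comp, Category.assoc]))
    str_fn := fun k g hg => by rw [f.str, s.str_fn, Category.assoc]
    fn_res := fun j k g hg hg' => by
      rw [f.res, s.fn_res]
    fn_smul := fun k h g hg hg' => by
      rw [← f.smul, ← s.fn_smul] } : TwistSec ι q E.torsor c U)
  res k s := TwistSec.ext' (Category.assoc _ _ _).symm fun _ _ _ _ => rfl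
  str _ := rfl
  smul h s := TwistSec.ext' rfl fun _ _ _ _ => rfl
  toSpace s := by
    subst hc
    refine twistSpace_eq hQ hX E c _ _ fun k g hg => ?_
    refine (twistSpace_spec hQ hX E' _ s k g (by
      rw [hg, ← rg_comp]
      change (rg Q (k ≫ TwistSec.str s ≫ f.base) c)⁻¹ = _
      rw [Category.assoc])).trans ?_
    change _ = act.smul g⁻¹ (E.toSpace (f.toFun _))
    rw [f.toSpace]

theorem TwistSec.cond_inner {c₂ c₁ : Q.obj (op T)} {U V W : C} {t : U ⟶ T} {k₂ : V ⟶ U}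
    {g₂ : G.obj (op V)} (hg₂ : ga q g₂ = (rg Q (k₂ ≫ t) c₂)⁻¹) {k₁ : W ⟶ V} {g₁ : G.obj (op W)}
    (hg₁ : ga q g₁ = (rg Q (k₁ ≫ k₂ ≫ t) c₁)⁻¹) :
    ga q (g₁ * rg G k₁ g₂) = (rg Q ((k₁ ≫ k₂) ≫ t) (c₂ * c₁))⁻¹ := by
  rw [map_mul, hg₁, ga_rg, hg₂, map_inv, map_mul, mul_inv_rev, ← rg_comp, Category.assoc]

/-- The equivariant map `g₁ ↦ f (g₁ g₂)`. -/
@[reducible]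
def TwistSec.inner {E : Torsor J H T} {c₂ c₁ : Q.obj (op T)} {U V : C}
    (s : TwistSec ι q E (c₂ * c₁) U) (k₂ : V ⟶ U) (g₂ : G.obj (op V))
    (hg₂ : ga q g₂ = (rg Q (k₂ ≫ s.str) c₂)⁻¹) : TwistSec ι q E c₁ V where
  str := k₂ ≫ s.str
  fn k₁ g₁ hg₁ := s.fn (k₁ ≫ k₂) (g₁ * rg G k₁ g₂) (TwistSec.cond_inner hg₂ hg₁)
  str_fn k₁ g₁ hg₁ := by rw [s.str_fn, Category.assoc]
  fn_res j k g hg hg' := by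
    rw [s.fn_res j (k ≫ k₂) _ _ (TwistSec.cond_res j _ (TwistSec.cond_inner hg₂ hg))]
    exact s.fn_congr (Category.assoc _ _ _).symm (by rw [map_mul, rg_comp]) _ _
  fn_smul k h g hg hg' := by
    rw [← s.fn_smul (k ≫ k₂) h _ _ (by rw [← mul_assoc]; exact TwistSec.cond_inner hg₂ hg')]
    exact s.fn_congr rfl (mul_assoc _ _ _) _ _

/-- The map `f ↦ (g₂ ↦ (g₁ ↦ f (g₁ g₂)))`. -/
@[reducible]
def TwistSec.curry (hQ : IsQuotient J ι q) {E : Torsor J H T} {c₂ c₁ : Q.obj (op T)} {U : C}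
    (s : TwistSec ι q E (c₂ * c₁) U) : TwistSec ι q (E.twist hQ c₁) c₂ U where
  str := s.str
  fn k₂ g₂ hg₂ := s.inner k₂ g₂ hg₂
  str_fn _ _ _ := rfl
  fn_res j k g hg hg' := TwistSec.ext' (Category.assoc _ _ _).symm
    fun k₁ g₁ h₁ h₁' => s.fn_congr (Category.assoc _ _ _) (by rw [rg_comp]; rfl) _ _
  fn_smul k h g hg hg' := TwistSec.ext' rfl
    fun k₁ g₁ h₁ h₁' => s.fn_congr rfl (by rw [map_mul, ← ga_rg, mul_assoc]) _ _

/-- The canonical morphism `(c₂ c₁) · E ⟶ c₂ · (c₁ · E)`, `f ↦ (g₂ ↦ (g₁ ↦ f (g₁ g₂)))`. -/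
def QuotObj.twistAssoc (hQ : IsQuotient J ι q) (hX : Presieve.IsSheaf J X)
    (E : QuotObj J (act.restrict ι) T) (c₂ c₁ : Q.obj (op T)) :
    QuotHom (E.twist hQ hX (c₂ * c₁)) ((E.twist hQ hX c₁).twist hQ hX c₂) where
  base := 𝟙 T
  toFun {U} (s : TwistSec ι q E.torsor (c₂ * c₁) U) := s.curry hQ
  res f s := TwistSec.ext' rfl fun k₂ g₂ hg₂ hg₂' =>
    TwistSec.ext' (Category.assoc _ _ _) fun k₁ g₁ hg₁ hg₁' =>
      TwistSec.fn_congr s (Category.assoc _ _ _).symm rfl _ _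
  str _ := (Category.comp_id _).symm
  smul {U} h s := by
    change TwistSec ι q E.torsor (c₂ * c₁) U at s
    refine TwistSec.ext' rfl fun k₂ g₂ hg₂ hg₂' => TwistSec.ext' rfl fun k₁ g₁ hg₁ hg₁' => ?_
    refine s.fn_congr (k := k₁ ≫ k₂) (k' := k₁ ≫ k₂)
      (g := (g₁ * rg G k₁ g₂) * ga ι (rg H (k₁ ≫ k₂) h))
      (g' := g₁ * rg G k₁ (g₂ * ga ι (rg H k₂ h))) rfl ?_ _ _
    rw [map_mul, ← ga_rg, ← rg_comp, mul_assoc]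
  toSpace {U} s := by
    change TwistSec ι q E.torsor (c₂ * c₁) U at s
    change twistSpace hQ hX (E.twist hQ hX c₁) c₂ (s.curry hQ) =
      twistSpace hQ hX E (c₂ * c₁) s
    refine twistSpace_eq hQ hX _ c₂ _ _ fun {V} k₂ g₂ hg₂ => ?_
    change _ = act.smul g₂⁻¹ (twistSpace hQ hX E c₁ (s.inner k₂ g₂ hg₂))
    have e : twistSpace hQ hX E c₁ (s.inner k₂ g₂ hg₂) =
        act.smul g₂ (rs X k₂ (twistSpace hQ hX E (c₂ * c₁) s)) := by
      refine twistSpace_eq hQ hX E c₁ _ _ fun {W} k₁ g₁ hg₁ => ?_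
      rw [act.res_smul, ← rs_comp, twistSpace_spec hQ hX E (c₂ * c₁) s (k₁ ≫ k₂) _
        (TwistSec.cond_inner hg₂ hg₁), ← act.mul_smul, mul_inv_rev, mul_inv_cancel_left]
    rw [e, ← act.mul_smul, inv_mul_cancel, act.one_smul]

theorem TwistSec.exists_of_one (hQ : IsQuotient J ι q) {V : C} (t : V ⟶ T) (g : G.obj (op V))
    (hg : ga q g = (rg Q t 1)⁻¹) : ∃ h : H.obj (op V), ga ι h = g :=
  (hQ.ker g).1 (by rw [hg, map_one, inv_one])

/-- The equivariant map `h ↦ h • p`. -/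
def TwistSec.ofSection (hQ : IsQuotient J ι q) (E : Torsor J H T) {U : C}
    (p : E.sheaf.obj (op U)) : TwistSec ι q E (1 : Q.obj (op T)) U where
  str := E.str p
  fn k g hg := E.act.smul (exists_of_one hQ _ g hg).choose (rs E.sheaf k p)
  str_fn k g hg := by rw [E.str_smul, E.str_res]
  fn_res j k g hg hg' := by
    rw [E.act.res_smul, ← rs_comp]
    congr 1
    refine hQ.injective _ _ ?_
    rw [ga_rg, (exists_of_one hQ _ g hg).choose_spec, (exists_of_one hQ _ _ hg').choose_spec]
  fn_smul k h g hg hg' := by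
    rw [← E.act.mul_smul]
    congr 1
    refine hQ.injective _ _ ?_
    rw [map_mul, (exists_of_one hQ _ g hg).choose_spec,
      (exists_of_one hQ _ _ hg').choose_spec]

theorem TwistSec.ofSection_fn (hQ : IsQuotient J ι q) (E : Torsor J H T) {U V : C}
    (p : E.sheaf.obj (op U)) (k : V ⟶ U) (g : G.obj (op V))
    (hg : ga q g = (rg Q (k ≫ E.str p) 1)⁻¹) (h : H.obj (op V)) (hh : ga ι h = g) :
    (ofSection hQ E p).fn k g hg = E.act.smul h (rs E.sheaf k p) := by
  change E.act.smul _ _ = _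
  congr 1
  refine hQ.injective _ _ ?_
  rw [hh, (exists_of_one hQ _ g hg).choose_spec]

/-- The canonical morphism `E ⟶ 1 · E`, `p ↦ (h ↦ h • p)`. -/
def QuotObj.twistUnit (hQ : IsQuotient J ι q) (hX : Presieve.IsSheaf J X)
    (E : QuotObj J (act.restrict ι) T) : QuotHom E (E.twist hQ hX (1 : Q.obj (op T))) where
  base := 𝟙 T
  toFun p := TwistSec.ofSection hQ E.torsor p
  res f p := TwistSec.ext' (E.torsor.str_res f p).symm fun k g hg hg' => by
    obtain ⟨h, hh⟩ := TwistSec.exists_of_one hQ _ g hg'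
    refine (TwistSec.ofSection_fn hQ E.torsor p (k ≫ f) g
      (by rw [← hh, (hQ.ker _).2 ⟨h, rfl⟩, map_one, inv_one]) h hh).trans ?_
    rw [TwistSec.ofSection_fn hQ E.torsor _ k g hg' h hh, rs_comp]
  str _ := (Category.comp_id _).symm
  smul x p := TwistSec.ext' (E.torsor.str_smul x p) fun k g hg hg' => by
    obtain ⟨h, hh⟩ := TwistSec.exists_of_one hQ _ g hg
    rw [TwistSec.ofSection_fn hQ E.torsor _ k g hg h hh]
    refine Eq.trans ?_ (TwistSec.ofSection_fn hQ E.torsor p k (g * ga ι (rg H k x))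
      (TwistSec.cond_mul_right hQ _ hg') (h * rg H k x) (by rw [map_mul, hh])).symm
    rw [E.torsor.act.res_smul, ← E.torsor.act.mul_smul]
  toSpace p := by
    refine twistSpace_eq hQ hX E 1 _ _ fun {V} k g hg => ?_
    obtain ⟨h, hh⟩ := TwistSec.exists_of_one hQ _ g hg
    rw [TwistSec.ofSection_fn hQ E.torsor p k g hg h hh, E.toSpace_smul]
    change _ = act.smul g⁻¹ (act.smul (ga ι h) _)
    rw [hh, ← act.mul_smul, inv_mul_cancel, act.one_smul, E.toSpace_res]

/-- The action of `Q = G/H` on the quotient stack `[X/H]` induced by the action of `G` on `X`. -/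
def twistStackAction (hQ : IsQuotient J ι q) (hX : Presieve.IsSheaf J X)
    (act : SpaceAction G X) : StackAction Q (quotientStack J (act.restrict ι)) where
  obj c E := E.twist hQ hX c
  map f hc := f.twist hQ hX hc
  base_map _ _ := rfl
  map_id E hc := QuotHom.ext' rfl fun s =>
    TwistSec.ext' (Category.comp_id _) fun _ _ _ _ => rfl
  map_comp f g hf hg hfg := QuotHom.ext' rfl fun s =>
    TwistSec.ext' (Category.assoc _ _ _).symm fun _ _ _ _ => rfl
  assoc c₂ c₁ E := E.twistAssoc hQ hX c₂ c₁
  assoc_iso c₂ c₁ E := QuotHom.isVertIso _ rfl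
  assoc_natural f h₁ h₂₁ h₂ := QuotHom.ext'
    ((Category.comp_id _).trans (Category.id_comp _).symm) fun s =>
      TwistSec.ext' rfl fun _ _ _ _ => TwistSec.ext' (Category.assoc _ _ _).symm
        fun _ _ _ _ => rfl
  unit E := E.twistUnit hQ hX
  unit_iso E := QuotHom.isVertIso _ rfl
  unit_natural := by
    intro T' T E' E f hf
    refine QuotHom.ext' ((Category.comp_id _).trans (Category.id_comp _).symm) fun {U} p => ?_
    refine TwistSec.ext' (f.str p) fun k g hg hg' => ?_
    obtain ⟨h, hh⟩ := TwistSec.exists_of_one hQ _ g hg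
    refine (TwistSec.ofSection_fn hQ E.torsor _ k g hg h hh).trans ?_
    have hg'' : ga q g = (rg Q (k ≫ E'.torsor.str p) 1)⁻¹ := by
      rw [← hh, (hQ.ker _).2 ⟨h, rfl⟩, map_one, inv_one]
    refine Eq.trans ?_ (congrArg (fun t => f.toFun t)
      (TwistSec.ofSection_fn hQ E'.torsor p k g hg'' h hh)).symm
    rw [f.smul, f.res]
  coherence_assoc c₃ c₂ c₁ E h h' := by
    refine QuotHom.ext' ?_ fun {U} s => ?_
    · change 𝟙 _ ≫ 𝟙 _ = 𝟙 _ ≫ 𝟙 _ ≫ 𝟙 _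
      simp
    change TwistSec ι q E.torsor (c₃ * c₂ * c₁) U at s
    refine TwistSec.ext' ?_ fun k₃ g₃ h₃ h₃' => ?_
    · change TwistSec.str s = (TwistSec.str s ≫ 𝟙 _) ≫ 𝟙 _
      simp
    refine TwistSec.ext' ?_ fun k₂ g₂ h₂ h₂' => ?_
    · change k₃ ≫ TwistSec.str s = k₃ ≫ TwistSec.str s ≫ 𝟙 _
      simp
    refine TwistSec.ext' ?_ fun k₁ g₁ h₁ h₁' => ?_
    · change (k₂ ≫ k₃) ≫ TwistSec.str s = k₂ ≫ k₃ ≫ TwistSec.str s ≫ 𝟙 _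
      simp
    refine TwistSec.fn_congr s (k := k₁ ≫ k₂ ≫ k₃) (k' := (k₁ ≫ k₂) ≫ k₃)
      (g := g₁ * rg G k₁ (g₂ * rg G k₂ g₃)) (g' := (g₁ * rg G k₁ g₂) * rg G (k₁ ≫ k₂) g₃)
      (Category.assoc _ _ _).symm ?_ _ _
    rw [map_mul, rg_comp, mul_assoc]
  coherence_one_mul c E h := by
    refine QuotHom.ext' ?_ fun {U} s => ?_
    · change 𝟙 _ = 𝟙 _ ≫ 𝟙 _
      simp
    change TwistSec ι q E.torsor (1 * c) U at s
    refine TwistSec.ext' ?_ fun k₂ g₂ h₂ h₂' => ?_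
    · change TwistSec.str s = TwistSec.str s ≫ 𝟙 _
      simp
    obtain ⟨x, hx⟩ := TwistSec.exists_of_one hQ _ g₂ h₂
    refine Eq.trans ?_ (TwistSec.ofSection_fn hQ (E.torsor.twist hQ c) _ k₂ g₂ h₂' x hx).symm
    refine TwistSec.ext' ?_ fun k₁ g₁ h₁ h₁' => ?_
    · change k₂ ≫ TwistSec.str s = k₂ ≫ TwistSec.str s ≫ 𝟙 _
      simp
    refine TwistSec.fn_congr s (k := k₁ ≫ k₂) (k' := k₁ ≫ k₂)
      (g := g₁ * rg G k₁ g₂) (g' := g₁ * ga ι (rg H k₁ x)) rfl ?_ _ _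
    rw [ga_rg, hx]
  coherence_mul_one c E h := by
    refine QuotHom.ext' rfl fun {U} s => ?_
    change TwistSec ι q E.torsor (c * 1) U at s
    refine TwistSec.ext' (Category.comp_id _).symm fun k₂ g₂ h₂ h₂' => ?_
    have hg₂ : ga q g₂ = (rg Q (k₂ ≫ s.str) (c * 1))⁻¹ :=
      Eq.trans h₂ (congrArg (fun d => (rg Q (k₂ ≫ s.str) d)⁻¹) (mul_one c).symm)
    refine TwistSec.ext' (s.str_fn k₂ g₂ hg₂).symm fun k₁ g₁ h₁ h₁' => ?_
    obtain ⟨x, hx⟩ := TwistSec.exists_of_one hQ _ g₁ h₁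
    refine Eq.trans ?_ (TwistSec.ofSection_fn hQ E.torsor (s.fn k₂ g₂ hg₂) k₁ g₁ h₁' x hx).symm
    have c₁ := TwistSec.cond_res k₁ k₂ hg₂
    have c₂ := TwistSec.cond_mul_left hQ x c₁
    rw [s.fn_res k₁ k₂ g₂ hg₂ c₁, ← s.fn_smul _ x _ c₁ c₂]
    exact TwistSec.fn_congr s (k := k₁ ≫ k₂) (k' := k₁ ≫ k₂) (g := g₁ * rg G k₁ g₂) rfl
      (by rw [hx]) _ _

end TwistTorsor

/-! ## The quotient sheaf `G/H` -/

section QuotientSheaf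

open Limits

variable {C : Type u} [Category.{v} C]

/-- The presheaf of groups `U ↦ G(U)/H(U)`. -/
def quotientPresheaf {H G : Cᵒᵖ ⥤ GrpCat.{w}} (ι : H ⟶ G)
    (hN : ∀ U : C, (ga ι (U := U)).range.Normal) : Cᵒᵖ ⥤ GrpCat.{w} where
  obj U := haveI := hN U.unop; GrpCat.of (G.obj U ⧸ (ga ι (U := U.unop)).range)
  map {U V} f := haveI := hN U.unop; haveI := hN V.unop
    GrpCat.ofHom (QuotientGroup.map (ga ι (U := U.unop)).range (ga ι (U := V.unop)).range
      (G.map f).hom (by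
        rintro _ ⟨h, rfl⟩
        exact ⟨rg H f.unop h, ga_rg ι f.unop h⟩))
  map_id U := by
    ext x
    simp
  map_comp f g := by
    ext x
    simp

/-- The projection `G(U) ⟶ G(U)/H(U)`. -/
def toQuotientPresheaf {H G : Cᵒᵖ ⥤ GrpCat.{w}} (ι : H ⟶ G)
    (hN : ∀ U : C, (ga ι (U := U)).range.Normal) : G ⟶ quotientPresheaf ι hN where
  app U := haveI := hN U.unop; GrpCat.ofHom (QuotientGroup.mk' (ga ι (U := U.unop)).range)
  naturality U V f := by
    ext x
    rfl

instance hasColimitsOfShape_grpCat (K : Type w) [SmallCategory K] [IsFiltered K] :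
    HasColimitsOfShape K GrpCat.{w} where
  has_colimit _ := ⟨_, GrpCat.FilteredColimits.colimitCoconeIsColimit.{w, w} _⟩

variable (J : GrothendieckTopology C)

/-- The quotient sheaf of groups `G/H`: the sheafification of `U ↦ G(U)/H(U)`. -/
def quotientSheaf {H G : Cᵒᵖ ⥤ GrpCat.{max u v}} (ι : H ⟶ G)
    (hN : ∀ U : C, (ga ι (U := U)).range.Normal) : Cᵒᵖ ⥤ GrpCat.{max u v} :=
  sheafify J (quotientPresheaf ι hN)

/-- The projection `G ⟶ G/H`. -/
def toQuotientSheaf {H G : Cᵒᵖ ⥤ GrpCat.{max u v}} (ι : H ⟶ G)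
    (hN : ∀ U : C, (ga ι (U := U)).range.Normal) : G ⟶ quotientSheaf J ι hN :=
  toQuotientPresheaf ι hN ≫ toSheafify J (quotientPresheaf ι hN)

theorem isQuotient_quotientSheaf {H G : Cᵒᵖ ⥤ GrpCat.{max u v}} (ι : H ⟶ G)
    (hN : ∀ U : C, (ga ι (U := U)).range.Normal)
    (hH : Presieve.IsSheaf J (H ⋙ forget GrpCat.{max u v}))
    (hG : Presieve.IsSheaf J (G ⋙ forget GrpCat.{max u v}))
    (inj : ∀ {U : C} (h h' : H.obj (op U)), ga ι h = ga ι h' → h = h') :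
    IsQuotient J ι (toQuotientSheaf J ι hN) where
  isSheaf_sub := hH
  injective := inj
  ker {U} g := by
    have mk_eq : ∀ {V : C} (x : G.obj (op V)),
        ga (toQuotientPresheaf ι hN) x = 1 ↔ ∃ h, ga ι h = x := fun {V} x =>
      have := hN V
      (QuotientGroup.eq_one_iff (N := (ga ι (U := V)).range) x)
    have comp_eq : ga (toQuotientSheaf J ι hN) g =
        ga (toSheafify J (quotientPresheaf ι hN)) (ga (toQuotientPresheaf ι hN) g) := rfl
    constructor
    · intro h
      have hS := Presheaf.equalizerSieve_mem J (toSheafify J (quotientPresheaf ι hN))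
        (X := op U) (ga (toQuotientPresheaf ι hN) g) 1 (by
          rw [map_one]
          exact h)
      have hloc : ∀ ⦃V : C⦄ (k : V ⟶ U),
          Presheaf.equalizerSieve (F := quotientPresheaf ι hN) (X := op U)
            (ga (toQuotientPresheaf ι hN) g) 1 k → ∃ y, ga ι y = rg G k g := by
        intro V k hk
        refine (mk_eq _).1 ?_
        rw [ga_rg]
        refine Eq.trans hk ?_
        exact map_one (rg (quotientPresheaf ι hN) k)
      obtain ⟨x, hx⟩ := glueUnique hH hS (fun V k y => ga ι y = rg G k g)
        hloc (fun V k y y' h₁ h₂ => inj _ _ (h₁.trans h₂.symm))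
        (fun W V j k y h₁ => by
          rw [rg_comp, ← h₁]
          exact ga_rg ι j y)
      refine ⟨x, sep hG hS fun V k hk => ?_⟩
      exact (ga_rg ι k x).symm.trans (hx k hk)
    · rintro h
      rw [comp_eq, (mk_eq g).2 h]
      exact map_one (ga (toSheafify J (quotientPresheaf ι hN)))
  locally_surjective {U} c := by
    have hS := Presheaf.imageSieve_mem J (toSheafify J (quotientPresheaf ι hN)) (U := op U) c
    refine ⟨_, hS, fun V k hk => ?_⟩
    obtain ⟨t, ht⟩ := hk
    have := hN V
    obtain ⟨g, rfl⟩ := QuotientGroup.mk_surjective (s := (ga ι (U := V)).range) t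
    exact ⟨g, ht⟩

end QuotientSheaf

/-! ## Group schemes acting on schemes -/

section Schemes

open AlgebraicGeometry MonObj

variable {S : Scheme.{u}}

/-- The big étale site of `S`. -/
abbrev etaleSite (S : Scheme.{u}) : GrothendieckTopology (Over S) :=
  Scheme.etaleTopology.over S

instance subcanonical_etaleTopology : Scheme.etaleTopology.{u}.Subcanonical :=
  .of_le (Scheme.etaleTopology_le_proetaleTopology)

/-- The functor of points of an `S`-scheme. -/
def points (X : Over S) : (Over S)ᵒᵖ ⥤ Type (u + 1) :=
  yoneda.obj X ⋙ uliftFunctor.{u + 1, u}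

/-- The functor of points of a group scheme over `S`. -/
def groupPoints (G : Over S) [GrpObj G] : (Over S)ᵒᵖ ⥤ GrpCat.{u + 1} :=
  yonedaGrpObj G ⋙ GrpCat.uliftFunctor.{u + 1, u}

/-- The homomorphism on points induced by a homomorphism of group schemes. -/
def groupPointsMap {H G : Over S} [GrpObj H] [GrpObj G] (i : H ⟶ G) [IsMonHom i] :
    groupPoints H ⟶ groupPoints G where
  app U := GrpCat.uliftFunctor.{u + 1, u}.map (GrpCat.ofHom (IsMonHom.monoidHom i U.unop))
  naturality U V f := by
    ext ⟨x⟩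
    exact congrArg ULift.up (Category.assoc f.unop (x : unop U ⟶ H) i)

/-- The action on points induced by an action of a group scheme `G` on a scheme `X`. -/
def schemeAction (G X : Over S) [GrpObj G] [ModObj G X] :
    SpaceAction (groupPoints G) (points X) where
  smul {U} g x := ⟨(show U ⟶ G from g.down) • (show U ⟶ X from x.down)⟩
  one_smul x := congrArg ULift.up (one_smul _ (_ : _ ⟶ X))
  mul_smul g h x := congrArg ULift.up (mul_smul (_ : _ ⟶ G) (_ : _ ⟶ G) (_ : _ ⟶ X))
  res_smul f g x := congrArg ULift.up (ModObj.comp_smul f g.down x.down)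

theorem isSheaf_points (X : Over S) : Presieve.IsSheaf (etaleSite S) (points X) :=
  (Presieve.isSheaf_comp_uliftFunctor_iff _).2
    (GrothendieckTopology.Subcanonical.isSheaf_of_isRepresentable (yoneda.obj X))

theorem isSheaf_groupPoints (G : Over S) [GrpObj G] :
    Presieve.IsSheaf (etaleSite S) (groupPoints G ⋙ forget GrpCat.{u + 1}) :=
  isSheaf_points G

variable {H G : Over S} [GrpObj H] [GrpObj G] (i : H ⟶ G) [IsMonHom.Normal i]

theorem normal_range (U : Over S) : (ga (groupPointsMap i) (U := U)).range.Normal where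
  conj_mem := by
    rintro _ ⟨h, rfl⟩ g
    obtain ⟨h', hh'⟩ := (IsMonHom.normal_iff_normal_monoidHom.1 ‹_› U).conj_mem
      (IsMonHom.monoidHom i U h.down) ⟨h.down, rfl⟩ g.down
    exact ⟨⟨h'⟩, congrArg ULift.up hh'⟩

theorem groupPointsMap_injective {U : Over S} (h h' : (groupPoints H).obj (op U))
    (e : ga (groupPointsMap i) h = ga (groupPointsMap i) h') : h = h' := by
  have : h.down ≫ i = h'.down ≫ i := congrArg ULift.down e
  exact congrArg ULift.up ((cancel_mono i).1 this)

/-- The quotient `G/H` of a group scheme by a normal subgroup scheme, as a sheaf of groups on the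
big étale site. (If `H` is smooth and `G/H` is a group scheme, this is its functor of points.) -/
def quotientGroup : (Over S)ᵒᵖ ⥤ GrpCat.{u + 1} :=
  quotientSheaf (etaleSite S) (groupPointsMap i) (normal_range i)

/-- The action of `G/H` on `[X/H]` induced by the action of `G` on `X`. -/
def quotientGroupAction (X : Over S) [ModObj G X] :
    StackAction (quotientGroup i)
      (quotientStack (etaleSite S) ((schemeAction G X).restrict (groupPointsMap i))) :=
  twistStackAction
    (isQuotient_quotientSheaf (etaleSite S) (groupPointsMap i) (normal_range i)
      (isSheaf_groupPoints H) (isSheaf_groupPoints G) (groupPointsMap_injective i))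
    (isSheaf_points X) (schemeAction G X)

end Schemes

end QuotStack

end

/-! A `G`-torsor `E` over `T` factors as `E ⟶ E/H ⟶ T`, where `E/H` is a torsor under `Q = G/H` and
the fibres of `E ⟶ E/H` are `H`-torsors; a `G`-equivariant map `E ⟶ X` restricts to `H`-equivariant
maps on these fibres. Conversely, an object `D` of `[[X/H]/Q]` is a `Q`-torsor `P` with a compatible
family of `H`-torsors `D(s)` mapping to `X`, one for each section `s` of `P`, and the total space of
this family is a `G`-torsor mapping to `X`. The total space functor `totFun` is shown to be fully
faithful and essentially surjective on fibres; `equivalent_of_fullyFaithful` concludes.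

The `G`-action on the total space is hidden in the isomorphisms `D(c s) ≅ c · D(s)`. If `g` lifts
`c`, evaluation at `g⁻¹` identifies the twist `c · D(s)`, a sheaf of `H`-equivariant maps on the
lifts of `c⁻¹`, with `D(s)`; the composite `D(c s) ≅ D(s)` is `ev`. Then `g` sends `(s, p)` to
`(q(g) s, z)`, where `ev` takes `z` to `p`. The coherence conditions are exactly what an action
needs: associativity becomes `ev_mul`, and the unit condition becomes `ev_one`, by which `H` acts
through the given torsor structures (`smul_ι_pt`). Simple transitivity combines that of `Q` on `P`
with that of `H` on the `D(s)` (`TotSec.exists_smul_eq`).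

A `G`-map of total spaces commutes with `H`, so it descends to the `Q`-torsors (`baseHom`) and
induces maps of the `D(s)` (`fibQuotHom`). Their compatibility with the equivariance isomorphisms is
`G`-equivariance read through `ev` (`toTwist_secHom`).

For essential surjectivity, `E/H` is realised as the contracted product of `Q` and `E`: a section
`s` is recorded by the function `φ` on `E` with `s = [φ e, e]`, and the fibre over `s` is the locus
`φ = 1`. Forgetting `s` maps the total space of this family to `E`; as a morphism of torsors over an
identity it is an isomorphism.

In a pair `(s, p)` the type of `p` depends on `s`. Comparisons therefore take place in one fixed
torsor `D(s)`: a section of `D(s)` over any `V ⟶ U` defines a point `pt s p` of the total space, and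
`pt_fibMap` and `pt_injective` replace transport along equalities. -/

noncomputable section

namespace QuotStack

/-! ## Fully faithful and essentially surjective functors over a base category -/

namespace CatOver

variable {C : Type u} [Category.{v} C]

/-- A fully faithful functor over `C` that is essentially surjective on each fibre is an
equivalence over `C`. -/
theorem equivalent_of_fullyFaithful {𝒳 : CatOver.{u, v, a, b} C} {𝒴 : CatOver.{u, v, a', b'} C}
    (F : Fun 𝒴 𝒳)
    (faithful : ∀ {T' T : C} {y' : 𝒴.Fib T'} {y : 𝒴.Fib T} (f g : 𝒴.Hom y' y),
      F.map f = F.map g → f = g)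
    (full : ∀ {T' T : C} {y' : 𝒴.Fib T'} {y : 𝒴.Fib T} (f : 𝒳.Hom (F.obj y') (F.obj y)),
      ∃ g, F.map g = f)
    (essSurj : ∀ {T : C} (x : 𝒳.Fib T), ∃ (y : 𝒴.Fib T) (f : 𝒳.Hom (F.obj y) x),
      𝒳.IsVertIso f) : 𝒳.Equivalent 𝒴 := by
  choose K κ hκ using @essSurj
  choose κ' h₁ h₂ using fun {T : C} (x : 𝒳.Fib T) => (hκ x).exists_inv
  choose L hL using @full
  have hκ' : ∀ {T : C} (x : 𝒳.Fib T), 𝒳.base (κ' x) = 𝟙 T := by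
    intro T x
    have := congrArg 𝒳.base (h₁ x)
    rwa [𝒳.base_comp, (hκ x).base_eq, Category.id_comp, 𝒳.base_id] at this
  have hκ'' : ∀ {T : C} (x : 𝒳.Fib T), 𝒳.IsVertIso (κ' x) := fun x =>
    ⟨hκ' x, κ x, h₂ x, h₁ x⟩
  -- On morphisms the quasi-inverse conjugates by the chosen isomorphisms `κ` and lifts the result
  -- along `F`. The functor laws are then tested after applying `F`, by faithfulness.
  let M : ∀ {T' T : C} {x' : 𝒳.Fib T'} {x : 𝒳.Fib T}, 𝒳.Hom x' x → 𝒴.Hom (K x') (K x) :=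
    fun {T' T x' x} f => L (𝒳.comp (κ x') (𝒳.comp f (κ' x)))
  have hM : ∀ {T' T : C} {x' : 𝒳.Fib T'} {x : 𝒳.Fib T} (f : 𝒳.Hom x' x),
      F.map (M f) = 𝒳.comp (κ x') (𝒳.comp f (κ' x)) := fun f => hL _
  let N : Fun 𝒳 𝒴 := {
    obj := fun x => K x
    map := fun f => M f
    base_map := fun {T' T x' x} f => by
      rw [← F.base_map, hM, 𝒳.base_comp, 𝒳.base_comp, (hκ x').base_eq, hκ', Category.id_comp,
        Category.comp_id]
    map_id := fun x => faithful _ _ (by rw [hM, 𝒳.id_comp, h₁, F.map_id])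
    map_comp := fun {T'' T' T x'' x' x} f g => faithful _ _ (by
      rw [hM, F.map_comp, hM, hM, 𝒳.assoc, 𝒳.assoc, 𝒳.assoc, ← 𝒳.assoc (κ' x'), h₂, 𝒳.id_comp]) }
  refine ⟨N, F, fun x => κ' x, fun y => L (κ (F.obj y)), hκ'', fun y => ⟨?_, ?_⟩, ?_, ?_⟩
  · rw [← F.base_map, hL, (hκ _).base_eq]
  · refine ⟨L (κ' (F.obj y)), faithful _ _ ?_, faithful _ _ ?_⟩
    · rw [F.map_comp, hL, hL, h₁, F.map_id]
    · rw [F.map_comp, hL, hL, h₂, F.map_id]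
  · intro T' T x' x f
    change _ = 𝒳.comp _ (F.map (M f))
    rw [hM, ← 𝒳.assoc, h₂, 𝒳.id_comp]
  · intro T' T y' y f
    refine faithful _ _ ?_
    change F.map (𝒴.comp (M (F.map f)) _) = _
    rw [F.map_comp, F.map_comp, hM, hL, hL, 𝒳.assoc, 𝒳.assoc, h₂, 𝒳.comp_id]

end CatOver

/-! ### Evaluation of a twisted torsor at a lift of the twisting section -/

section Evaluation

variable {C : Type u} [Category.{v} C] {J : GrothendieckTopology C}
  {H G Q : Cᵒᵖ ⥤ GrpCat.{max u v}} {ι : H ⟶ G} {q : G ⟶ Q}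

namespace TwistSec

variable {T : C} {E : Torsor J H T} {c : Q.obj (op T)} {U : C}

theorem cond_inv {t : U ⟶ T} {g : G.obj (op U)} (hg : ga q g = rg Q t c) :
    ga q g⁻¹ = (rg Q (𝟙 U ≫ t) c)⁻¹ := by
  rw [map_inv, hg, Category.id_comp]

/-- If `c` is the image of `g`, evaluation at `g⁻¹` identifies the twist of `E` by `c` with `E`. -/
def eval (w : TwistSec ι q E c U) (g : G.obj (op U)) (hg : ga q g = rg Q w.str c) :
    E.sheaf.obj (op U) :=
  w.fn (𝟙 U) g⁻¹ (cond_inv hg)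

theorem eval_congr {w w' : TwistSec ι q E c U} (hw : w = w') {g g' : G.obj (op U)} (h : g = g')
    (hg : ga q g = rg Q w.str c) (hg' : ga q g' = rg Q w'.str c) :
    w.eval g hg = w'.eval g' hg' := by
  subst hw h
  rfl

theorem str_eval (w : TwistSec ι q E c U) (g : G.obj (op U)) (hg : ga q g = rg Q w.str c) :
    E.str (w.eval g hg) = w.str :=
  (w.str_fn _ _ _).trans (Category.id_comp _)

theorem eval_restrict (w : TwistSec ι q E c U) {V : C} (f : V ⟶ U) (g : G.obj (op U))
    (hg : ga q g = rg Q w.str c) (hg' : ga q (rg G f g) = rg Q (w.restrict f).str c) :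
    (w.restrict f).eval (rg G f g) hg' = rs E.sheaf f (w.eval g hg) := by
  have h := cond_res f (𝟙 U) (cond_inv hg)
  refine Eq.trans ?_ (w.fn_res f (𝟙 U) g⁻¹ (cond_inv hg) h).symm
  exact w.fn_congr (by simp) (map_inv _ _).symm _ _

/-- Over any `V ⟶ U` the lifts of `c⁻¹` form a single `H`-orbit, namely that of the restriction of
`g⁻¹`. An `H`-equivariant map on them is thus determined by its value at `g⁻¹`. -/
theorem eval_injective (hQ : IsQuotient J ι q) {w w' : TwistSec ι q E c U}
    (hs : w.str = w'.str) (g : G.obj (op U)) (hg : ga q g = rg Q w.str c)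
    (hg' : ga q g = rg Q w'.str c) (h : w.eval g hg = w'.eval g hg') : w = w' := by
  refine ext' hs fun {V} k g₁ h₁ h₁' => ?_
  have hk := cond_res k (𝟙 U) (cond_inv hg)
  have hk' := cond_res k (𝟙 U) (cond_inv hg')
  have e : w.fn (k ≫ 𝟙 U) (rg G k g⁻¹) hk = w'.fn (k ≫ 𝟙 U) (rg G k g⁻¹) hk' := by
    rw [← w.fn_res k (𝟙 U) g⁻¹ (cond_inv hg) hk, ← w'.fn_res k (𝟙 U) g⁻¹ (cond_inv hg') hk']
    exact congrArg _ h
  obtain ⟨y, rfl⟩ := exists_eq_mul hQ (g := rg G k g⁻¹) (g' := g₁) (by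
    rw [hk, h₁, Category.comp_id])
  rw [w.fn_congr (Category.comp_id k).symm rfl h₁ (cond_mul_left hQ y hk),
    w'.fn_congr (Category.comp_id k).symm rfl h₁' (cond_mul_left hQ y hk'),
    w.fn_smul _ y _ hk, w'.fn_smul _ y _ hk', e]

/-- Every lift of `c⁻¹` is uniquely `x g⁻¹` with `x` in `H`, by injectivity of `ι`, so `x g⁻¹ ↦ x •
p` is a well-defined equivariant map with value `p` at `g⁻¹`. -/
theorem exists_eval_eq (hQ : IsQuotient J ι q) (p : E.sheaf.obj (op U)) (g : G.obj (op U))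
    (hg : ga q g = rg Q (E.str p) c) :
    ∃ (w : TwistSec ι q E c U) (hw : w.str = E.str p), w.eval g (by rw [hw, hg]) = p := by
  have ex : ∀ {V : C} (k : V ⟶ U) (g' : G.obj (op V)), ga q g' = (rg Q (k ≫ E.str p) c)⁻¹ →
      ∃ x : H.obj (op V), g' = ga ι x * rg G k g⁻¹ := fun k g' hg' =>
    exists_eq_mul hQ (by rw [hg', ga_rg, map_inv, hg, map_inv, rg_comp])
  choose x hx using @ex
  have xuniq : ∀ {V : C} {a : G.obj (op V)} {y y' : H.obj (op V)},
      ga ι y * a = ga ι y' * a → y = y' := fun h => hQ.injective _ _ (mul_right_cancel h)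
  refine ⟨{
    str := E.str p
    fn := fun k g' hg' => E.act.smul (x k g' hg') (rs E.sheaf k p)
    str_fn := fun k g' hg' => by rw [E.str_smul, E.str_res]
    fn_res := fun j k g' hg₁ hg₂ => by
      rw [E.act.res_smul, ← rs_comp]
      congr 1
      refine xuniq (a := rg G (j ≫ k) g⁻¹) ?_
      rw [← hx, ga_rg, rg_comp, ← map_mul, ← hx]
    fn_smul := fun k h g' hg₁ hg₂ => by
      rw [← E.act.mul_smul]
      congr 1
      refine xuniq (a := rg G k g⁻¹) ?_
      rw [← hx, map_mul, mul_assoc, ← hx] }, rfl, ?_⟩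
  change E.act.smul (x _ _ _) (rs E.sheaf (𝟙 U) p) = p
  rw [rs_id, show x (𝟙 U) g⁻¹ (cond_inv hg) = 1 from
    xuniq (a := rg G (𝟙 U) g⁻¹) (by rw [← hx, map_one, one_mul, rg_id]), E.act.one_smul]

end TwistSec

variable {T : C} {X : Cᵒᵖ ⥤ Type (max u v)} {act : SpaceAction G X}

/-- With a lift of `c` available over all of `U`, the local description that defines `twistSpace`
can be read off over the identity, at the element `g⁻¹`. -/
theorem twistSpace_eq_smul_eval (hQ : IsQuotient J ι q) (hX : Presieve.IsSheaf J X)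
    (E : QuotObj J (act.restrict ι) T) (c : Q.obj (op T)) {U : C}
    (w : TwistSec ι q E.torsor c U) (g : G.obj (op U)) (hg : ga q g = rg Q w.str c) :
    twistSpace hQ hX E c w = act.smul g (E.toSpace (w.eval g hg)) := by
  rw [← rs_id X (twistSpace hQ hX E c w),
    twistSpace_spec hQ hX E c w (𝟙 U) g⁻¹ (TwistSec.cond_inv hg), inv_inv]
  rfl

end Evaluation

/-! ## The fibres of an equivariant morphism to `[X/H]` -/

section Fibres

variable {C : Type u} [Category.{v} C] {J : GrothendieckTopology C} [J.Subcanonical]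
  {H G Q : Cᵒᵖ ⥤ GrpCat.{max u v}} {ι : H ⟶ G} {q : G ⟶ Q}
  {X : Cᵒᵖ ⥤ Type (max u v)} {act : SpaceAction G X}
  {hQ : IsQuotient J ι q} {hX : Presieve.IsSheaf J X}
  {T : C} (D : StackQuotObj J (twistStackAction hQ hX act) T)

namespace StackQuotObj

/-- The `H`-torsor over `U` attached to a section over `U` of the `Q`-torsor. -/
def fib {U : C} (s : D.torsor.sheaf.obj (op U)) : QuotObj J (act.restrict ι) U :=
  D.toStack.obj s

/-- The transition morphisms of the family of `H`-torsors `D.fib`. -/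
def fibMap {V U : C} (f : V ⟶ U) {s' : D.torsor.sheaf.obj (op V)} {s : D.torsor.sheaf.obj (op U)}
    (h : rs D.torsor.sheaf f s = s') : QuotHom (D.fib s') (D.fib s) :=
  D.toStack.map f h

/-- The equivariance isomorphisms of the family of `H`-torsors `D.fib`. -/
def fibEqui {U : C} (c : Q.obj (op U)) (s : D.torsor.sheaf.obj (op U)) :
    QuotHom (D.fib (D.torsor.act.smul c s)) ((D.fib s).twist hQ hX c) :=
  D.toStack.equi c s

/-- Sections over `V` of the `H`-torsor attached to `s`. -/
abbrev Sec {U : C} (s : D.torsor.sheaf.obj (op U)) (V : C) : Type (max u v) :=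
  (D.fib s).torsor.sheaf.obj (op V)

/-- The structure morphism of a section of the `H`-torsor attached to `s`. -/
abbrev sstr {U : C} {s : D.torsor.sheaf.obj (op U)} {V : C} (p : D.Sec s V) : V ⟶ U :=
  (D.fib s).torsor.str p

variable {D} {U V W : C}

theorem base_fibMap (f : V ⟶ U) {s' : D.torsor.sheaf.obj (op V)}
    {s : D.torsor.sheaf.obj (op U)} (h : rs D.torsor.sheaf f s = s') :
    (D.fibMap f h).base = f :=
  D.toStack.base_map f h

theorem str_fibMap (f : V ⟶ U) {s' : D.torsor.sheaf.obj (op V)}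
    {s : D.torsor.sheaf.obj (op U)} (h : rs D.torsor.sheaf f s = s') (p : D.Sec s' W) :
    D.sstr ((D.fibMap f h).toFun p) = D.sstr p ≫ f :=
  ((D.fibMap f h).str p).trans (by rw [base_fibMap])

theorem fibMap_id {s : D.torsor.sheaf.obj (op U)} (h : rs D.torsor.sheaf (𝟙 U) s = s)
    (p : D.Sec s W) : (D.fibMap (𝟙 U) h).toFun p = p :=
  congrArg (fun f : QuotHom (D.fib s) (D.fib s) => f.toFun p) (D.toStack.map_id s h)

theorem fibMap_comp {V' : C} (g : V' ⟶ V) (f : V ⟶ U) {s'' : D.torsor.sheaf.obj (op V')}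
    {s' : D.torsor.sheaf.obj (op V)} {s : D.torsor.sheaf.obj (op U)}
    (hg : rs D.torsor.sheaf g s' = s'') (hf : rs D.torsor.sheaf f s = s')
    (h : rs D.torsor.sheaf (g ≫ f) s = s'') (p : D.Sec s'' W) :
    (D.fibMap f hf).toFun ((D.fibMap g hg).toFun p) = (D.fibMap (g ≫ f) h).toFun p :=
  (congrArg (fun f : QuotHom (D.fib s'') (D.fib s) => f.toFun p)
    (D.toStack.map_comp g f hg hf h)).symm

theorem fibMap_injective (f : V ⟶ U) {s' : D.torsor.sheaf.obj (op V)}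
    {s : D.torsor.sheaf.obj (op U)} (h : rs D.torsor.sheaf f s = s') {p p' : D.Sec s' W}
    (hp : D.sstr p = D.sstr p') (e : (D.fibMap f h).toFun p = (D.fibMap f h).toFun p') : p = p' :=
  (D.fibMap f h).toTorsorHom.injective hp e

theorem exists_fibMap_eq (f : V ⟶ U) {s' : D.torsor.sheaf.obj (op V)}
    {s : D.torsor.sheaf.obj (op U)} (h : rs D.torsor.sheaf f s = s') (k : W ⟶ V) (p : D.Sec s W)
    (hp : D.sstr p = k ≫ f) : ∃ p' : D.Sec s' W, D.sstr p' = k ∧ (D.fibMap f h).toFun p' = p :=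
  (D.fibMap f h).toTorsorHom.exists_preimage
    (GrothendieckTopology.Subcanonical.isSheaf_of_isRepresentable _) k p (by
      rw [base_fibMap]
      exact hp)

theorem base_fibEqui (c : Q.obj (op U)) (s : D.torsor.sheaf.obj (op U)) :
    (D.fibEqui c s).base = 𝟙 U :=
  (D.toStack.equi_iso c s).base_eq

/-- The section of the twist of the torsor attached to `s` given by a section of the torsor attached
to `c • s`. -/
def toTwist (c : Q.obj (op U)) (s : D.torsor.sheaf.obj (op U))
    (z : D.Sec (D.torsor.act.smul c s) V) : TwistSec ι q (D.fib s).torsor c V :=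
  (D.fibEqui c s).toFun z

theorem str_toTwist (c : Q.obj (op U)) (s : D.torsor.sheaf.obj (op U))
    (z : D.Sec (D.torsor.act.smul c s) V) : (toTwist c s z).str = D.sstr z :=
  ((D.fibEqui c s).str z).trans (by rw [base_fibEqui, Category.comp_id])

/-- If `c` is the image of `g`, the torsor attached to `c • s` is identified with the one attached
to `s`. -/
def ev (c : Q.obj (op U)) (s : D.torsor.sheaf.obj (op U)) (z : D.Sec (D.torsor.act.smul c s) V)
    (g : G.obj (op V)) (hg : ga q g = rg Q (D.sstr z) c) : D.Sec s V :=
  (toTwist c s z).eval g (by rw [hg, str_toTwist])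

theorem str_ev (c : Q.obj (op U)) (s : D.torsor.sheaf.obj (op U))
    (z : D.Sec (D.torsor.act.smul c s) V) (g : G.obj (op V)) (hg : ga q g = rg Q (D.sstr z) c) :
    D.sstr (ev c s z g hg) = D.sstr z :=
  (TwistSec.str_eval _ _ _).trans (str_toTwist c s z)

theorem ev_injective {c : Q.obj (op U)} {s : D.torsor.sheaf.obj (op U)}
    {z z' : D.Sec (D.torsor.act.smul c s) V} (hz : D.sstr z = D.sstr z') (g : G.obj (op V))
    (hg : ga q g = rg Q (D.sstr z) c) (hg' : ga q g = rg Q (D.sstr z') c)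
    (h : ev c s z g hg = ev c s z' g hg') : z = z' := by
  refine (D.fibEqui c s).toTorsorHom.injective hz ?_
  exact TwistSec.eval_injective hQ (w := toTwist c s z) (w' := toTwist c s z')
    (by rw [str_toTwist, str_toTwist, hz]) g _ _ h

/-- `ev` is composed of two bijections: the equivariance morphism, bijective on sections with a
given structure morphism because it is a morphism of torsors, and evaluation at `g⁻¹`. -/
theorem exists_ev_eq (c : Q.obj (op U)) (s : D.torsor.sheaf.obj (op U)) (p : D.Sec s V)
    (g : G.obj (op V)) (hg : ga q g = rg Q (D.sstr p) c) :
    ∃ (z : D.Sec (D.torsor.act.smul c s) V) (hz : D.sstr z = D.sstr p),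
      ev c s z g (by rw [hz, hg]) = p := by
  obtain ⟨w, hw, hwp⟩ := TwistSec.exists_eval_eq hQ p g hg
  obtain ⟨z, hz, hzw⟩ := (D.fibEqui c s).toTorsorHom.exists_preimage
    (GrothendieckTopology.Subcanonical.isSheaf_of_isRepresentable _) (D.sstr p) w (by
      rw [base_fibEqui, Category.comp_id]
      exact hw)
  exact ⟨z, hz, (TwistSec.eval_congr hzw rfl _ _).trans hwp⟩

/-- This is the axiom `equi_natural`, read on sections and evaluated at `g⁻¹`. -/
theorem ev_fibMap (f : V ⟶ U) {c' : Q.obj (op V)} {c : Q.obj (op U)}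
    {s' : D.torsor.sheaf.obj (op V)} {s : D.torsor.sheaf.obj (op U)}
    (h : rs D.torsor.sheaf f s = s') (hc : rg Q f c = c')
    (hs : rs D.torsor.sheaf f (D.torsor.act.smul c s) = D.torsor.act.smul c' s')
    (z : D.Sec (D.torsor.act.smul c' s') W) (g : G.obj (op W)) (hg : ga q g = rg Q (D.sstr z) c')
    (hg' : ga q g = rg Q (D.sstr ((D.fibMap f hs).toFun z)) c) :
    ev c s ((D.fibMap f hs).toFun z) g hg' = (D.fibMap f h).toFun (ev c' s' z g hg) := by
  have hc' : rg Q (D.fibMap f h).base c = c' := by rw [base_fibMap, hc]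
  have e : toTwist c s ((D.fibMap f hs).toFun z) =
      ((D.fibMap f h).twist hQ hX hc').toFun (toTwist c' s' z) :=
    congrArg (fun k : QuotHom (D.fib (D.torsor.act.smul c' s')) ((D.fib s).twist hQ hX c) =>
      k.toFun z) (D.toStack.equi_natural f h hc' hs)
  have hg₁ : ga q g = rg Q (TwistSec.str (ι := ι) (q := q) (E := (D.fib s).torsor) (c := c)
      (((D.fibMap f h).twist hQ hX hc').toFun (toTwist c' s' z))) c := by
    change _ = rg Q ((toTwist c' s' z).str ≫ (D.fibMap f h).base) c
    rw [rg_comp, hc', hg, str_toTwist]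
  exact TwistSec.eval_congr e rfl _ hg₁

theorem toTwist_rs (f : W ⟶ V) (c : Q.obj (op U)) (s : D.torsor.sheaf.obj (op U))
    (z : D.Sec (D.torsor.act.smul c s) V) :
    toTwist c s (rs (D.fib _).torsor.sheaf f z) = (toTwist c s z).restrict f :=
  ((D.fibEqui c s).res f z).symm

theorem ev_congr {c : Q.obj (op U)} {s : D.torsor.sheaf.obj (op U)}
    {z z' : D.Sec (D.torsor.act.smul c s) V} (h : z = z') {g : G.obj (op V)}
    (hg : ga q g = rg Q (D.sstr z) c) (hg' : ga q g = rg Q (D.sstr z') c) :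
    ev c s z g hg = ev c s z' g hg' := by
  subst h
  rfl

/-- Expresses every value of the equivariant map `toTwist c s z` through `ev`, so that an equality
of such maps can be reduced to statements about `ev`. The inverse appears because `ev` at a lift of
`c` evaluates at the inverse of that lift. -/
theorem fn_toTwist (f : W ⟶ V) (c : Q.obj (op U)) (s : D.torsor.sheaf.obj (op U))
    (z : D.Sec (D.torsor.act.smul c s) V) (g : G.obj (op W))
    (hg : ga q g = (rg Q (f ≫ (toTwist c s z).str) c)⁻¹)
    (hg' : ga q g⁻¹ = rg Q (D.sstr (rs (D.fib _).torsor.sheaf f z)) c) :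
    (toTwist c s z).fn f g hg = ev c s (rs (D.fib _).torsor.sheaf f z) g⁻¹ hg' := by
  have hr : ga q g⁻¹ = rg Q ((toTwist c s z).restrict f).str c := by
    rw [map_inv, hg, inv_inv]
  refine Eq.trans ?_ (TwistSec.eval_congr (toTwist_rs f c s z) rfl _ hr).symm
  exact TwistSec.fn_congr _ (Category.id_comp f).symm (inv_inv g).symm _ _

theorem ev_rs (f : W ⟶ V) (c : Q.obj (op U)) (s : D.torsor.sheaf.obj (op U))
    (z : D.Sec (D.torsor.act.smul c s) V) (g : G.obj (op V)) (hg : ga q g = rg Q (D.sstr z) c)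
    (hg' : ga q (rg G f g) = rg Q (D.sstr (rs (D.fib _).torsor.sheaf f z)) c) :
    ev c s (rs (D.fib _).torsor.sheaf f z) (rg G f g) hg' =
      rs (D.fib s).torsor.sheaf f (ev c s z g hg) := by
  have e := toTwist_rs f c s z
  have hr : ga q (rg G f g) = rg Q ((toTwist c s z).restrict f).str c := by
    rw [← e, hg', str_toTwist]
  exact (TwistSec.eval_congr e rfl _ hr).trans (TwistSec.eval_restrict _ f g _ hr)

/-- By `equi_mul`, the two equivariance isomorphisms in succession are the one for `c₂ * c₁`
followed by currying. Evaluating the curried map at `g₂⁻¹` and then at `g₁⁻¹` gives the value at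
`g₁⁻¹ * g₂⁻¹ = (g₂ * g₁)⁻¹`. -/
theorem ev_mul (c₂ c₁ : Q.obj (op U)) (s : D.torsor.sheaf.obj (op U))
    (h : rs D.torsor.sheaf (𝟙 U) (D.torsor.act.smul c₂ (D.torsor.act.smul c₁ s)) =
      D.torsor.act.smul (c₂ * c₁) s)
    (z : D.Sec (D.torsor.act.smul (c₂ * c₁) s) V) (g₂ g₁ : G.obj (op V))
    (hg₂ : ga q g₂ = rg Q (D.sstr ((D.fibMap (𝟙 U) h).toFun z)) c₂)
    (hg₁ : ga q g₁ = rg Q (D.sstr (ev c₂ _ ((D.fibMap (𝟙 U) h).toFun z) g₂ hg₂)) c₁)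
    (hg : ga q (g₂ * g₁) = rg Q (D.sstr z) (c₂ * c₁)) :
    ev c₁ s (ev c₂ _ ((D.fibMap (𝟙 U) h).toFun z) g₂ hg₂) g₁ hg₁ =
      ev (c₂ * c₁) s z (g₂ * g₁) hg := by
  have h' : rg Q (D.fibEqui c₁ s).base c₂ = c₂ := by rw [base_fibEqui, rg_id]
  have e : (toTwist (c₂ * c₁) s z).curry hQ =
      ((D.fibEqui c₁ s).twist hQ hX h').toFun
        (toTwist c₂ (D.torsor.act.smul c₁ s) ((D.fibMap (𝟙 U) h).toFun z)) :=
    congrArg (fun k : QuotHom (D.fib (D.torsor.act.smul (c₂ * c₁) s))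
      (((D.fib s).twist hQ hX c₁).twist hQ hX c₂) => k.toFun z) (D.toStack.equi_mul c₂ c₁ s h h')
  have c₂' : ga q g₂ = rg Q ((toTwist (c₂ * c₁) s z).curry hQ).str c₂ := by
    rw [hg₂, str_fibMap, Category.comp_id, ← str_toTwist]
  have e₂ : ((toTwist (c₂ * c₁) s z).curry hQ).eval g₂ c₂' =
      toTwist c₁ s (ev c₂ _ ((D.fibMap (𝟙 U) h).toFun z) g₂ hg₂) :=
    TwistSec.eval_congr e rfl c₂' (by rw [c₂', e])
  have c₁' : ga q g₁ = rg Q (((toTwist (c₂ * c₁) s z).inner (𝟙 V) g₂⁻¹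
      (TwistSec.cond_inv c₂')).str) c₁ := by
    change _ = rg Q (𝟙 V ≫ (toTwist (c₂ * c₁) s z).str) c₁
    rw [hg₁, str_ev, str_fibMap, str_toTwist, Category.id_comp, Category.comp_id]
  refine (TwistSec.eval_congr e₂.symm rfl _ c₁').trans ?_
  refine TwistSec.fn_congr (toTwist (c₂ * c₁) s z) (k := 𝟙 V ≫ 𝟙 V) (Category.id_comp _) ?_ _ _
  rw [rg_id, mul_inv_rev]

/-- By `equi_one`, the equivariance isomorphism for `1` sends `z` to the map `h ↦ h • z`, up to the
transition from `1 • s` to `s`; it is evaluated here at the inverse of `x`. -/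
theorem ev_one (s : D.torsor.sheaf.obj (op U))
    (h : rs D.torsor.sheaf (𝟙 U) s = D.torsor.act.smul 1 s)
    (z : D.Sec (D.torsor.act.smul 1 s) V) (x : H.obj (op V))
    (hx : ga q (ga ι x) = rg Q (D.sstr z) 1) :
    ev 1 s z (ga ι x) hx = (D.fib s).torsor.act.smul x⁻¹ ((D.fibMap (𝟙 U) h).toFun z) := by
  have e : toTwist 1 s z = TwistSec.ofSection hQ (D.fib s).torsor ((D.fibMap (𝟙 U) h).toFun z) :=
    congrArg (fun k : QuotHom (D.fib (D.torsor.act.smul 1 s)) ((D.fib s).twist hQ hX 1) =>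
      k.toFun z) (D.toStack.equi_one s h)
  have hx' : ga q (ga ι x) = rg Q (TwistSec.ofSection hQ (D.fib s).torsor
      ((D.fibMap (𝟙 U) h).toFun z)).str 1 := by
    rw [(hQ.ker _).2 ⟨x, rfl⟩, map_one]
  refine (TwistSec.eval_congr e rfl _ hx').trans ?_
  refine (TwistSec.ofSection_fn hQ (D.fib s).torsor _ (𝟙 V) (ga ι x)⁻¹ _ x⁻¹
    (map_inv _ _)).trans ?_
  rw [rs_id]

/-- The equivariance isomorphism respects the maps to `X`, and the map from the twist to `X` is `f ↦
g • π (f g⁻¹)`. This makes the map from the total space to `X` equivariant under all of `G`. -/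
theorem smul_toSpace_ev (c : Q.obj (op U)) (s : D.torsor.sheaf.obj (op U))
    (z : D.Sec (D.torsor.act.smul c s) V) (g : G.obj (op V)) (hg : ga q g = rg Q (D.sstr z) c) :
    act.smul g ((D.fib s).toSpace (ev c s z g hg)) =
      (D.fib (D.torsor.act.smul c s)).toSpace z := by
  rw [← (D.fibEqui c s).toSpace]
  exact (twistSpace_eq_smul_eval hQ hX (D.fib s) c _ g _).symm

end StackQuotObj

end Fibres

/-! ## The `G`-torsor attached to an object of `[[X/H]/(G/H)]` -/

section TotalSpace

variable {C : Type u} [Category.{v} C] {J : GrothendieckTopology C} [J.Subcanonical]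
  {H G Q : Cᵒᵖ ⥤ GrpCat.{max u v}} {ι : H ⟶ G} {q : G ⟶ Q}
  {X : Cᵒᵖ ⥤ Type (max u v)} {act : SpaceAction G X}
  {hQ : IsQuotient J ι q} {hX : Presieve.IsSheaf J X}
  {T : C} (D : StackQuotObj J (twistStackAction hQ hX act) T)

namespace StackQuotObj

/-- A section over `U` of the total space of the family of `H`-torsors over the `Q`-torsor
underlying `D`. -/
structure TotSec (U : C) where
  s : D.torsor.sheaf.obj (op U)
  p : D.Sec s U
  str_p : D.sstr p = 𝟙 U

variable {D} {U V W : C}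

/-- The transition morphism along `D.sstr p` is a morphism of torsors, hence bijective on sections
with prescribed structure morphism; so `p` comes from a section over the identity of `V`. -/
theorem exists_pt {s : D.torsor.sheaf.obj (op U)} (p : D.Sec s V) :
    ∃ (x : D.TotSec V) (h : rs D.torsor.sheaf (D.sstr p) s = x.s),
      (D.fibMap (D.sstr p) h).toFun x.p = p := by
  obtain ⟨p', hp', e⟩ := exists_fibMap_eq (D.sstr p) rfl (𝟙 V) p (Category.id_comp _).symm
  exact ⟨⟨_, p', hp'⟩, rfl, e⟩

/-- The section of the total space over `V` given by a section over `V` of the `H`-torsor attached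
to `s`. -/
def pt (s : D.torsor.sheaf.obj (op U)) (p : D.Sec s V) : D.TotSec V :=
  (exists_pt p).choose

theorem rs_sstr (s : D.torsor.sheaf.obj (op U)) (p : D.Sec s V) :
    rs D.torsor.sheaf (D.sstr p) s = (pt s p).s :=
  (exists_pt p).choose_spec.choose

theorem fibMap_pt (s : D.torsor.sheaf.obj (op U)) (p : D.Sec s V) :
    (D.fibMap (D.sstr p) (rs_sstr s p)).toFun (pt s p).p = p :=
  (exists_pt p).choose_spec.choose_spec

/-- The second components live in torsors depending on the first components. Both are pushed into
the one torsor attached to `s`, and transition morphisms are injective. -/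
theorem TotSec.ext_fibMap {s : D.torsor.sheaf.obj (op U)} {k : V ⟶ U} {x y : D.TotSec V}
    (hx : rs D.torsor.sheaf k s = x.s) (hy : rs D.torsor.sheaf k s = y.s)
    (h : (D.fibMap k hx).toFun x.p = (D.fibMap k hy).toFun y.p) : x = y := by
  obtain ⟨s₁, p₁, h₁⟩ := x
  obtain ⟨s₂, p₂, h₂⟩ := y
  obtain rfl : s₁ = s₂ := hx.symm.trans hy
  obtain rfl : p₁ = p₂ := fibMap_injective _ hx (h₁.trans h₂.symm) h
  rfl

theorem TotSec.fibMap_congr {s : D.torsor.sheaf.obj (op U)} {k k' : V ⟶ U} {x y : D.TotSec V}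
    (hx : rs D.torsor.sheaf k s = x.s) (hy : rs D.torsor.sheaf k' s = y.s) (hk : k = k')
    (h : x = y) : (D.fibMap k hx).toFun x.p = (D.fibMap k' hy).toFun y.p := by
  subst hk h
  rfl

/-- Characterises `pt s p`. The morphism `k` is forced to be `D.sstr p`, but keeping it arbitrary
spares rewriting inside the dependent types. -/
theorem eq_pt {s : D.torsor.sheaf.obj (op U)} {p : D.Sec s V} (k : V ⟶ U) (x : D.TotSec V)
    (h : rs D.torsor.sheaf k s = x.s) (hp : (D.fibMap k h).toFun x.p = p) : x = pt s p := by
  obtain rfl : D.sstr p = k := by rw [← hp, str_fibMap, x.str_p, Category.id_comp]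
  exact TotSec.ext_fibMap h (rs_sstr s p) (hp.trans (fibMap_pt s p).symm)

theorem pt_self (x : D.TotSec U) : pt x.s x.p = x :=
  (eq_pt (𝟙 U) x (rs_id _ _) (fibMap_id _ _)).symm

/-- Holds by functoriality of the transitions. It permits changing the reference section `s` freely,
and so serves in place of transport along equalities in the `Q`-torsor. -/
theorem pt_fibMap (f : V ⟶ U) {s' : D.torsor.sheaf.obj (op V)} {s : D.torsor.sheaf.obj (op U)}
    (h : rs D.torsor.sheaf f s = s') (p : D.Sec s' W) :
    pt s ((D.fibMap f h).toFun p) = pt s' p := by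
  have h' : rs D.torsor.sheaf (D.sstr p ≫ f) s = (pt s' p).s := by
    rw [rs_comp, h, rs_sstr]
  refine (eq_pt (D.sstr p ≫ f) _ h' ?_).symm
  rw [← fibMap_comp _ _ (rs_sstr s' p) h h', fibMap_pt]

/-- Together with `exists_pt_eq` this gives, for fixed `s` and `k : V ⟶ U`, a bijection between the
sections over `k` of the torsor attached to `s` and the points of the total space whose first
component is the restriction of `s` along `k`. -/
theorem pt_injective {s : D.torsor.sheaf.obj (op U)} {p p' : D.Sec s V}
    (hs : D.sstr p = D.sstr p') (h : pt s p = pt s p') : p = p' := by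
  rw [← fibMap_pt s p, ← fibMap_pt s p']
  exact TotSec.fibMap_congr _ _ hs h

theorem exists_pt_eq (s : D.torsor.sheaf.obj (op U)) (k : V ⟶ U) (x : D.TotSec V)
    (h : rs D.torsor.sheaf k s = x.s) : ∃ p : D.Sec s V, D.sstr p = k ∧ pt s p = x :=
  ⟨(D.fibMap k h).toFun x.p, by rw [str_fibMap, x.str_p, Category.id_comp],
    (pt_fibMap k h x.p).trans (pt_self x)⟩

theorem sstr_rs {s : D.torsor.sheaf.obj (op U)} (f : W ⟶ V) (p : D.Sec s V) :
    D.sstr (rs (D.fib s).torsor.sheaf f p) = f ≫ D.sstr p :=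
  (D.fib s).torsor.str_res f p

namespace TotSec

/-- Restriction of sections of the total space. -/
def res (f : V ⟶ U) (x : D.TotSec U) : D.TotSec V :=
  pt x.s (rs (D.fib x.s).torsor.sheaf f x.p)

/-- The defining formula for `res` uses the canonical representative `x.p`; compatibility of
transitions with restriction extends it to every representative. -/
theorem res_pt (f : W ⟶ V) (s : D.torsor.sheaf.obj (op U)) (p : D.Sec s V) :
    (pt s p).res f = pt s (rs (D.fib s).torsor.sheaf f p) := by
  have h := pt_fibMap _ (rs_sstr s p) (rs (D.fib (pt s p).s).torsor.sheaf f (pt s p).p)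
  rw [← (D.fibMap _ _).res, fibMap_pt] at h
  exact h.symm

theorem s_res (f : V ⟶ U) (x : D.TotSec U) : (x.res f).s = rs D.torsor.sheaf f x.s := by
  rw [res, ← rs_sstr, sstr_rs, x.str_p, Category.comp_id]

theorem res_id (x : D.TotSec U) : x.res (𝟙 U) = x := by
  rw [res, rs_id, pt_self]

theorem res_comp (g : W ⟶ V) (f : V ⟶ U) (x : D.TotSec U) : x.res (g ≫ f) = (x.res f).res g := by
  rw [res, rs_comp, ← res_pt]
  rfl

end TotSec

variable (D) in
/-- The total space of the family of `H`-torsors over the `Q`-torsor underlying `D`. -/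
def totPresheaf : Cᵒᵖ ⥤ Type (max u v) where
  obj U := D.TotSec U.unop
  map f := ↾fun x => x.res f.unop
  map_id U := by
    ext x
    exact x.res_id
  map_comp f g := by
    ext x
    exact x.res_comp _ _

/-- The first components glue to a section `s` of the `Q`-torsor. Relative to this one `s`, the
local points become sections of a single `H`-torsor, where they glue again. -/
theorem isSheaf_totPresheaf : Presieve.IsSheaf J D.totPresheaf := by
  intro U S hS x hx
  have hx' : ∀ {W V : C} (j : W ⟶ V) (k : V ⟶ U) (hk : S k),
      TotSec.res j (x k hk) = x (j ≫ k) (S.downward_closed hk j) := fun j k hk =>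
    ((Presieve.compatible_iff_sieveCompatible _).1 hx k j hk).symm
  obtain ⟨s, hs⟩ := glue D.torsor.isSheaf hS (fun V k hk => TotSec.s (x k hk))
    (fun W V j k hk => (TotSec.s_res j _).symm.trans (congrArg TotSec.s (hx' j k hk)))
  choose p hp hpx using fun {V : C} (k : V ⟶ U) (hk : S k) =>
    exists_pt_eq s k (x k hk) (hs k hk)
  obtain ⟨p₀, hp₀⟩ := glue (D.fib s).torsor.isSheaf hS (fun V k hk => p k hk)
    (fun W V j k hk => by
      refine pt_injective (by rw [sstr_rs, hp, hp]) ?_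
      rw [← TotSec.res_pt, hpx, hpx, hx'])
  have hstr : D.sstr p₀ = 𝟙 U := by
    refine sep (J := J) (P := yoneda.obj U)
      (GrothendieckTopology.Subcanonical.isSheaf_of_isRepresentable _) hS fun V k hk => ?_
    change k ≫ _ = k ≫ _
    rw [← sstr_rs, hp₀ k hk, hp, Category.comp_id]
  refine ⟨(⟨s, p₀, hstr⟩ : D.TotSec U), fun V k hk => ?_, fun y hy => ?_⟩
  · change pt s (rs _ k p₀) = _
    rw [hp₀ k hk, hpx]
  · change D.TotSec U at y
    have hy' : ∀ {V : C} (k : V ⟶ U) (hk : S k), y.res k = x k hk := fun k hk => hy k hk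
    obtain ⟨s', p', h'⟩ := y
    obtain rfl : s' = s := sep D.torsor.isSheaf hS fun V k hk => by
      rw [hs k hk, ← hy' k hk, TotSec.s_res]
    obtain rfl : p' = p₀ := sep (D.fib s').torsor.isSheaf hS fun V k hk => by
      rw [hp₀ k hk]
      refine pt_injective (by rw [sstr_rs, h', hp, Category.comp_id]) ?_
      rw [hpx]
      exact hy' k hk
    rfl

/-- Fixes the direction of the action: `ev` leads from the torsor of `c • s` back to that of `s`, so
`g` acts by its inverse. -/
theorem exists_smul (g : G.obj (op U)) (x : D.TotSec U) :
    ∃ (z : D.Sec (D.torsor.act.smul (ga q g) x.s) U) (hz : D.sstr z = 𝟙 U),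
      ev (ga q g) x.s z g (by rw [hz, rg_id]) = x.p := by
  obtain ⟨z, hz, h⟩ := exists_ev_eq (ga q g) x.s x.p g (by rw [x.str_p, rg_id])
  exact ⟨z, hz.trans x.str_p, h⟩

/-- The action of `G` on the total space. -/
def TotSec.smul (g : G.obj (op U)) (x : D.TotSec U) : D.TotSec U :=
  ⟨D.torsor.act.smul (ga q g) x.s, (exists_smul g x).choose,
    (exists_smul g x).choose_spec.choose⟩

/-- The action of `G` on the total space is determined by the equivariance isomorphisms. -/
theorem smul_pt {c : Q.obj (op U)} {s : D.torsor.sheaf.obj (op U)}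
    {z : D.Sec (D.torsor.act.smul c s) V} {g : G.obj (op V)} (hg : ga q g = rg Q (D.sstr z) c)
    {p : D.Sec s V} (hp : ev c s z g hg = p) : (pt s p).smul g = pt (D.torsor.act.smul c s) z := by
  obtain ⟨hz', h'⟩ := (exists_smul g (pt s p)).choose_spec
  have hstr : D.sstr p = D.sstr z := by rw [← hp, str_ev]
  have hs := rs_sstr s p
  have hc : rg Q (D.sstr p) c = ga q g := by rw [hg, hstr]
  have hcs : rs D.torsor.sheaf (D.sstr p) (D.torsor.act.smul c s) =
      D.torsor.act.smul (ga q g) (pt s p).s := by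
    rw [D.torsor.act.res_smul, hc, hs]
  have hstr' : D.sstr ((D.fibMap (D.sstr p) hcs).toFun (exists_smul g (pt s p)).choose) =
      D.sstr z := by
    rw [str_fibMap, hz', Category.id_comp, hstr]
  refine eq_pt (D.sstr p) _ hcs ?_
  have hg' : ga q g = rg Q (D.sstr ((D.fibMap (D.sstr p) hcs).toFun
      (exists_smul g (pt s p)).choose)) c := by rw [hstr', hg]
  -- Both sections lie in the torsor attached to `c • s` and are compared through `ev`; naturality
  -- moves `ev` past the transition, where `exists_smul` applies.
  refine ev_injective hstr' g hg' hg ?_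
  refine (ev_fibMap (D.sstr p) hs hc hcs (exists_smul g (pt s p)).choose g
    (by rw [hz', rg_id]) hg').trans ?_
  rw [h', fibMap_pt, hp]

theorem exists_smul_pt (c : Q.obj (op U)) (s : D.torsor.sheaf.obj (op U)) (p : D.Sec s V)
    (g : G.obj (op V)) (hg : ga q g = rg Q (D.sstr p) c) :
    ∃ (z : D.Sec (D.torsor.act.smul c s) V) (hz : D.sstr z = D.sstr p),
      ev c s z g (by rw [hz, hg]) = p ∧ (pt s p).smul g = pt (D.torsor.act.smul c s) z := by
  obtain ⟨z, hz, h⟩ := exists_ev_eq c s p g hg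
  exact ⟨z, hz, h, smul_pt _ h⟩

/-- Since `ι h` lies over `1`, `ev` at `ι h` is the action of `h⁻¹` after the transition from `1 •
s` to `s`. So `H` acts on the total space through the given `H`-torsors. -/
theorem smul_ι_pt (h : H.obj (op V)) (s : D.torsor.sheaf.obj (op U)) (p : D.Sec s V) :
    (pt s p).smul (ga ι h) = pt s ((D.fib s).torsor.act.smul h p) := by
  have h₁ : ga q (ga ι h) = 1 := (hQ.ker _).2 ⟨h, rfl⟩
  obtain ⟨z, hz, hev, e⟩ := exists_smul_pt 1 s p (ga ι h) (by rw [h₁, map_one])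
  have hs : rs D.torsor.sheaf (𝟙 U) s = D.torsor.act.smul 1 s := by
    rw [rs_id, D.torsor.act.one_smul]
  rw [e, ← pt_fibMap (𝟙 U) hs]
  congr 1
  rw [← hev, ev_one s hs, ← (D.fib s).torsor.act.mul_smul, mul_inv_cancel,
    (D.fib s).torsor.act.one_smul]

variable (D) in
/-- The action of `G` on the total space. -/
def totAction : SpaceAction G D.totPresheaf where
  smul g x := TotSec.smul g x
  one_smul {U} x := by
    change D.TotSec U at x
    have h := smul_ι_pt 1 x.s x.p
    rw [map_one, pt_self, (D.fib x.s).torsor.act.one_smul, pt_self] at h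
    exact h
  mul_smul {U} g₂ g₁ x := by
    change D.TotSec U at x
    change x.smul (g₂ * g₁) = (x.smul g₁).smul g₂
    have h := x.str_p
    rw [← pt_self x]
    obtain ⟨z, hz, hev, e⟩ := exists_smul_pt (ga q g₂ * ga q g₁) x.s x.p (g₂ * g₁)
      (by rw [h, rg_id, map_mul])
    have hs : rs D.torsor.sheaf (𝟙 U)
        (D.torsor.act.smul (ga q g₂) (D.torsor.act.smul (ga q g₁) x.s)) =
          D.torsor.act.smul (ga q g₂ * ga q g₁) x.s := by
      rw [rs_id, D.torsor.act.mul_smul]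
    have hz' : D.sstr ((D.fibMap (𝟙 U) hs).toFun z) = 𝟙 U := by
      rw [str_fibMap, hz, h, Category.comp_id]
    have c₂ : ga q g₂ = rg Q (D.sstr ((D.fibMap (𝟙 U) hs).toFun z)) (ga q g₂) := by
      rw [hz', rg_id]
    have c₁ : ga q g₁ = rg Q (D.sstr (ev _ _ _ g₂ c₂)) (ga q g₁) := by
      rw [str_ev, hz', rg_id]
    -- Undoing `g₂` and then `g₁` on `z` is the same as undoing `g₂ * g₁`.
    have := ev_mul (ga q g₂) (ga q g₁) x.s hs z g₂ g₁ c₂ c₁ (by rw [hz, h, rg_id, map_mul])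
    rw [e, smul_pt c₁ (this.trans hev), smul_pt c₂ rfl, pt_fibMap]
  res_smul {V U} f g x := by
    change D.TotSec U at x
    change (x.smul g).res f = (x.res f).smul (rg G f g)
    have h := x.str_p
    rw [← pt_self x]
    obtain ⟨z, hz, hev, e⟩ := exists_smul_pt (ga q g) x.s x.p g (by rw [h, rg_id])
    rw [e, TotSec.res_pt, TotSec.res_pt]
    have hg : ga q (rg G f g) = rg Q (D.sstr (rs (D.fib _).torsor.sheaf f z)) (ga q g) := by
      rw [sstr_rs, hz, h, Category.comp_id, ga_rg]
    refine (smul_pt hg ?_).symm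
    rw [ev_rs f (ga q g) x.s z g (by rw [hz, h, rg_id]) hg, hev]

theorem sstr_smul (s : D.torsor.sheaf.obj (op U)) (h : H.obj (op V)) (p : D.Sec s V) :
    D.sstr ((D.fib s).torsor.act.smul h p) = D.sstr p :=
  (D.fib s).torsor.str_smul h p

/-- Freeness: an element fixing `(s, p)` has image in `Q` fixing `s`, so it comes from `H`, which
acts freely on the torsor of `s`. Transitivity: the section `c` of `Q` carrying one first component
to the other lifts locally to `G`; after applying a lift both points lie in the same `H`-torsor, and
an element of `H` corrects the difference. Freeness makes these local solutions glue. -/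
theorem TotSec.exists_smul_eq (hG : Presieve.IsSheaf J (G ⋙ forget GrpCat.{max u v}))
    (x x' : D.TotSec U) (h : D.torsor.str x.s = D.torsor.str x'.s) :
    ∃! g : G.obj (op U), x.smul g = x' := by
  have hone : ∀ {V : C} (y : D.TotSec V) (g : G.obj (op V)), y.smul g = y → g = 1 := by
    intro V y g hg
    have hq : ga q g = 1 := D.torsor.eq_one (p := y.s) (congrArg TotSec.s hg)
    obtain ⟨a, rfl⟩ := (hQ.ker g).1 hq
    rw [← pt_self y, smul_ι_pt] at hg
    rw [(D.fib y.s).torsor.eq_one (pt_injective (sstr_smul _ _ _) hg), map_one]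
  have huniq : ∀ {V : C} (y : D.TotSec V) (g g' : G.obj (op V)), y.smul g = y.smul g' →
      g = g' := by
    intro V y g g' hg
    refine inv_mul_eq_one.1 (hone y _ ?_) |>.symm
    rw [show y.smul (g'⁻¹ * g) = (y.smul g).smul g'⁻¹ from D.totAction.mul_smul g'⁻¹ g y, hg,
      show (y.smul g').smul g'⁻¹ = y.smul (g'⁻¹ * g') from (D.totAction.mul_smul g'⁻¹ g' y).symm,
      inv_mul_cancel]
    exact D.totAction.one_smul y
  obtain ⟨c, hc, -⟩ := D.torsor.simply_transitive x.s x'.s h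
  obtain ⟨S, hS, hS'⟩ := hQ.locally_surjective c
  obtain ⟨g, hg⟩ := glueUnique hG hS
    (fun V k (g : G.obj (op V)) => (x.res k).smul g = x'.res k) (by
      intro V k hk
      obtain ⟨g, hg⟩ := hS' k hk
      have hs : ((x.res k).smul g).s = (x'.res k).s := by
        change D.torsor.act.smul (ga q g) (x.res k).s = _
        rw [TotSec.s_res, TotSec.s_res, hg, ← hc, D.torsor.act.res_smul]
      obtain ⟨p, hp, hp'⟩ := exists_pt_eq (x'.res k).s (𝟙 V) ((x.res k).smul g)
        (by rw [rs_id, hs])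
      obtain ⟨a, ha, -⟩ := (D.fib (x'.res k).s).torsor.simply_transitive p (x'.res k).p
        (hp.trans (x'.res k).str_p.symm)
      refine ⟨ga ι a * g, ?_⟩
      refine (D.totAction.mul_smul (ga ι a) g (x.res k)).trans ?_
      change ((x.res k).smul g).smul (ga ι a) = _
      rw [← hp', smul_ι_pt, ha, pt_self])
    (fun V k g g' h₁ h₂ => huniq _ _ _ (h₁.trans h₂.symm))
    (fun W V j k g hg => by
      rw [TotSec.res_comp, TotSec.res_comp, ← hg]
      exact (D.totAction.res_smul j g (x.res k)).symm)
  refine ⟨g, ?_, fun g' hg' => huniq x _ _ ?_⟩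
  · refine sep (J := J) (P := D.totPresheaf) isSheaf_totPresheaf hS fun V k hk => ?_
    exact (D.totAction.res_smul k g x).trans (hg k hk)
  · rw [hg']
    refine sep (J := J) (P := D.totPresheaf) isSheaf_totPresheaf hS fun V k hk => ?_
    exact ((D.totAction.res_smul k g x).trans (hg k hk)).symm

theorem str_pt (s : D.torsor.sheaf.obj (op U)) (p : D.Sec s V) :
    D.torsor.str (pt s p).s = D.sstr p ≫ D.torsor.str s := by
  rw [← rs_sstr, D.torsor.str_res]

variable (D) in
/-- The total space, as a `G`-torsor. -/
def totTorsor (hG : Presieve.IsSheaf J (G ⋙ forget GrpCat.{max u v})) : Torsor J G T where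
  sheaf := D.totPresheaf
  isSheaf := isSheaf_totPresheaf
  str x := D.torsor.str (TotSec.s x)
  str_res f x := (congrArg D.torsor.str (TotSec.s_res f x)).trans (D.torsor.str_res f _)
  act := D.totAction
  str_smul g x := D.torsor.str_smul _ _
  simply_transitive x x' h := TotSec.exists_smul_eq hG x x' h
  locally_nonempty := by
    obtain ⟨R, hR, hR'⟩ := D.torsor.locally_nonempty
    choose s hs using hR'
    choose S hS hS' using fun {U : C} (f : U ⟶ T) (hf : R f) =>
      (D.fib (s f hf)).torsor.locally_nonempty
    -- A cover trivialising the `Q`-torsor is refined by covers trivialising the `H`-torsors of the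
    -- chosen local sections.
    refine ⟨Sieve.bind R fun U f hf => S f hf, J.bind_covering hR fun U f hf => hS f hf, ?_⟩
    rintro V _ ⟨U, k, f, hf, hk, rfl⟩
    obtain ⟨p, hp⟩ := hS' f hf k hk
    exact ⟨pt (s f hf) p, by rw [str_pt, hs, ← hp]⟩

theorem toSpace_pt (s : D.torsor.sheaf.obj (op U)) (p : D.Sec s V) :
    (D.fib (pt s p).s).toSpace (pt s p).p = (D.fib s).toSpace p := by
  rw [← (D.fibMap _ (rs_sstr s p)).toSpace, fibMap_pt]

variable (D) in
/-- The total space, as an object of `[X/G]`. -/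
def totObj (hG : Presieve.IsSheaf J (G ⋙ forget GrpCat.{max u v})) : QuotObj J act T where
  torsor := D.totTorsor hG
  toSpace x := (D.fib (TotSec.s x)).toSpace (TotSec.p x)
  toSpace_res f x := ((D.fib (TotSec.s x)).toSpace_res f _).trans (toSpace_pt _ _).symm
  toSpace_smul {U} g x := by
    change D.TotSec U at x
    obtain ⟨z, hz, hev, e⟩ := exists_smul_pt (ga q g) x.s x.p g (by rw [x.str_p, rg_id])
    rw [pt_self] at e
    change (D.fib (x.smul g).s).toSpace (x.smul g).p = act.smul g ((D.fib x.s).toSpace x.p)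
    rw [e, toSpace_pt, ← hev, smul_toSpace_ev]

end StackQuotObj

end TotalSpace

/-! ## The functor from `[[X/H]/(G/H)]` to `[X/G]` -/

section TotalFunctor

variable {C : Type u} [Category.{v} C] {J : GrothendieckTopology C} [J.Subcanonical]
  {H G Q : Cᵒᵖ ⥤ GrpCat.{max u v}} {ι : H ⟶ G} {q : G ⟶ Q}
  {X : Cᵒᵖ ⥤ Type (max u v)} {act : SpaceAction G X}
  {hQ : IsQuotient J ι q} {hX : Presieve.IsSheaf J X}
  {T' T : C} {D' : StackQuotObj J (twistStackAction hQ hX act) T'}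
  {D : StackQuotObj J (twistStackAction hQ hX act) T}

open StackQuotObj

namespace StackQuotHom

section

variable (Φ : StackQuotHom D' D) {U V W : C}

/-- The morphisms of `H`-torsors underlying a morphism of `[[X/H]/(G/H)]`. -/
def fibHom (s : D'.torsor.sheaf.obj (op U)) : QuotHom (D'.fib s) (D.fib (Φ.u.toFun s)) :=
  Φ.τ s

theorem base_fibHom (s : D'.torsor.sheaf.obj (op U)) : (Φ.fibHom s).base = 𝟙 U :=
  (Φ.τ_iso s).base_eq

theorem str_fibHom (s : D'.torsor.sheaf.obj (op U)) (p : D'.Sec s V) :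
    D.sstr ((Φ.fibHom s).toFun p) = D'.sstr p :=
  ((Φ.fibHom s).str p).trans (by rw [base_fibHom, Category.comp_id])

theorem fibHom_fibMap (f : V ⟶ U) {s' : D'.torsor.sheaf.obj (op V)}
    {s : D'.torsor.sheaf.obj (op U)} (h : rs D'.torsor.sheaf f s = s')
    (h' : rs D.torsor.sheaf f (Φ.u.toFun s) = Φ.u.toFun s') (p : D'.Sec s' W) :
    (Φ.fibHom s).toFun ((D'.fibMap f h).toFun p) =
      (D.fibMap f h').toFun ((Φ.fibHom s').toFun p) :=
  congrArg (fun k : QuotHom (D'.fib s') (D.fib (Φ.u.toFun s)) => k.toFun p) (Φ.τ_natural f h h')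

/-- The axiom `τ_equivariant` evaluated at `g⁻¹`; it is what makes the induced map of total spaces
`G`-equivariant. -/
theorem ev_fibHom (c : Q.obj (op U)) (s : D'.torsor.sheaf.obj (op U))
    (h : rs D.torsor.sheaf (𝟙 U) (D.torsor.act.smul c (Φ.u.toFun s)) =
      Φ.u.toFun (D'.torsor.act.smul c s))
    (z : D'.Sec (D'.torsor.act.smul c s) V) (g : G.obj (op V)) (hg : ga q g = rg Q (D'.sstr z) c)
    (hg' : ga q g = rg Q (D.sstr ((D.fibMap (𝟙 U) h).toFun ((Φ.fibHom _).toFun z))) c) :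
    ev c (Φ.u.toFun s) ((D.fibMap (𝟙 U) h).toFun ((Φ.fibHom _).toFun z)) g hg' =
      (Φ.fibHom s).toFun (ev c s z g hg) := by
  have hc : rg Q (Φ.fibHom s).base c = c := by rw [base_fibHom, rg_id]
  have e : toTwist c (Φ.u.toFun s) ((D.fibMap (𝟙 U) h).toFun ((Φ.fibHom _).toFun z)) =
      ((Φ.fibHom s).twist hQ hX hc).toFun (toTwist c s z) :=
    congrArg (fun k : QuotHom (D'.fib (D'.torsor.act.smul c s))
      ((D.fib (Φ.u.toFun s)).twist hQ hX c) => k.toFun z) (Φ.τ_equivariant c s h hc)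
  have hg₁ : ga q g = rg Q (TwistSec.str (ι := ι) (q := q) (E := (D.fib (Φ.u.toFun s)).torsor)
      (c := c) (((Φ.fibHom s).twist hQ hX hc).toFun (toTwist c s z))) c := by
    change _ = rg Q ((toTwist c s z).str ≫ (Φ.fibHom s).base) c
    rw [rg_comp, hc, hg, str_toTwist]
  exact TwistSec.eval_congr e rfl _ hg₁

/-- The induced map on sections of the total spaces. -/
def totMap (x : D'.TotSec U) : D.TotSec U :=
  pt (Φ.u.toFun x.s) ((Φ.fibHom x.s).toFun x.p)

/-- Naturality of `τ` along transitions allows the induced map to be computed on any representative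
`pt s p`. Restriction, equivariance and composition all rest on this. -/
theorem totMap_pt (s : D'.torsor.sheaf.obj (op U)) (p : D'.Sec s V) :
    Φ.totMap (pt s p) = pt (Φ.u.toFun s) ((Φ.fibHom s).toFun p) := by
  have h : rs D.torsor.sheaf (D'.sstr p) (Φ.u.toFun s) = Φ.u.toFun (pt s p).s := by
    rw [Φ.u.res, rs_sstr]
  rw [totMap, ← pt_fibMap _ h, ← Φ.fibHom_fibMap _ (rs_sstr s p) h, fibMap_pt]

variable (hG : Presieve.IsSheaf J (G ⋙ forget GrpCat.{max u v}))

/-- The induced morphism of `[X/G]` between the total spaces. -/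
def totHom : QuotHom (D'.totObj hG) (D.totObj hG) where
  base := Φ.u.base
  toFun {U} (x : D'.TotSec U) := Φ.totMap x
  res {V U} f x := by
    change D'.TotSec U at x
    change (Φ.totMap x).res f = Φ.totMap (x.res f)
    rw [totMap, TotSec.res_pt, TotSec.res, totMap_pt, (Φ.fibHom _).res]
  str {U} x := by
    change D'.TotSec U at x
    change D.torsor.str (Φ.totMap x).s = D'.torsor.str x.s ≫ Φ.u.base
    rw [totMap, str_pt, str_fibHom, x.str_p, Category.id_comp, Φ.u.str]
  smul {U} g x := by
    change D'.TotSec U at x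
    change Φ.totMap (x.smul g) = (Φ.totMap x).smul g
    obtain ⟨z, hz, hev, e⟩ := exists_smul_pt (ga q g) x.s x.p g (by rw [x.str_p, rg_id])
    rw [pt_self] at e
    have h : rs D.torsor.sheaf (𝟙 U) (D.torsor.act.smul (ga q g) (Φ.u.toFun x.s)) =
        Φ.u.toFun (D'.torsor.act.smul (ga q g) x.s) := by
      rw [rs_id, Φ.u.smul]
    have hg : ga q g = rg Q (D.sstr ((D.fibMap (𝟙 U) h).toFun ((Φ.fibHom _).toFun z)))
        (ga q g) := by
      rw [str_fibMap, str_fibHom, hz, x.str_p, Category.comp_id, rg_id]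
    have := Φ.ev_fibHom (ga q g) x.s h z g (by rw [hz, x.str_p, rg_id]) hg
    rw [hev] at this
    rw [e, totMap_pt, totMap, smul_pt hg this, pt_fibMap]
  toSpace {U} x := (toSpace_pt _ _).trans ((Φ.fibHom (TotSec.s x)).toSpace _)

/-- A section `s` of the `Q`-torsor need not lift to the total space, but it does so locally,
because the `H`-torsor of `s` has local sections. The first components of the images of these lifts
determine `u` locally, and then `pt_injective` recovers `τ`. -/
theorem totHom_injective {Φ Ψ : StackQuotHom D' D} (h : Φ.totHom hG = Ψ.totHom hG) : Φ = Ψ := by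
  have hb : Φ.u.base = Ψ.u.base :=
    congrArg (fun k : QuotHom (D'.totObj hG) (D.totObj hG) => k.base) h
  have hpt : ∀ {U V : C} (s : D'.torsor.sheaf.obj (op U)) (p : D'.Sec s V),
      pt (Φ.u.toFun s) ((Φ.fibHom s).toFun p) = pt (Ψ.u.toFun s) ((Ψ.fibHom s).toFun p) := by
    intro U V s p
    rw [← totMap_pt, ← totMap_pt]
    exact congrArg (fun k : QuotHom (D'.totObj hG) (D.totObj hG) => k.toFun (pt s p)) h
  have hu : ∀ {U : C} (s : D'.torsor.sheaf.obj (op U)), Φ.u.toFun s = Ψ.u.toFun s := by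
    intro U s
    obtain ⟨R, hR, hR'⟩ := (D'.fib s).torsor.locally_nonempty
    refine sep D.torsor.isSheaf hR fun V k hk => ?_
    obtain ⟨p, rfl⟩ := hR' k hk
    have := congrArg TotSec.s (hpt s p)
    rwa [← rs_sstr, ← rs_sstr, str_fibHom, str_fibHom] at this
  have hτ : ∀ {U : C} (s : D'.torsor.sheaf.obj (op U)), (Φ.fibHom s).base = (Ψ.fibHom s).base :=
    fun s => by rw [base_fibHom, base_fibHom]
  have hstr : ∀ {U V : C} (s : D'.torsor.sheaf.obj (op U)) (p : D'.Sec s V),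
      D.sstr ((Φ.fibHom s).toFun p) = D.sstr ((Ψ.fibHom s).toFun p) := fun s p => by
    rw [str_fibHom, str_fibHom]
  obtain ⟨u₁, τ₁, _, _, _⟩ := Φ
  obtain ⟨u₂, τ₂, _, _, _⟩ := Ψ
  obtain rfl : u₁ = u₂ := TorsorHom.ext' hb hu
  obtain rfl : @τ₁ = @τ₂ := by
    funext U s
    exact QuotHom.ext' (hτ s) fun p => pt_injective (hstr s p) (hpt s p)
  rfl

end

end StackQuotHom

/-! ### Fullness -/

namespace StackQuotObj

variable {hG : Presieve.IsSheaf J (G ⋙ forget GrpCat.{max u v})}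
  (φ : QuotHom (D'.totObj hG) (D.totObj hG)) {U V W : C}

/-- The map on sections of total spaces underlying a morphism of `[X/G]`. -/
def secMap (x : D'.TotSec U) : D.TotSec U :=
  φ.toFun x

theorem secMap_res (f : V ⟶ U) (x : D'.TotSec U) : secMap φ (x.res f) = (secMap φ x).res f :=
  (φ.res f x).symm

theorem secMap_smul (g : G.obj (op U)) (x : D'.TotSec U) :
    secMap φ (x.smul g) = (secMap φ x).smul g :=
  φ.smul g x

theorem str_secMap (x : D'.TotSec U) :
    D.torsor.str (secMap φ x).s = D'.torsor.str x.s ≫ φ.base :=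
  φ.str x

/-- Two such sections differ by an element of `H`, which `φ` respects and which acts trivially on
the `Q`-torsor. Hence `φ` descends modulo `H`. -/
theorem s_secMap_congr {s : D'.torsor.sheaf.obj (op U)} {p p' : D'.Sec s V}
    (h : D'.sstr p = D'.sstr p') : (secMap φ (pt s p)).s = (secMap φ (pt s p')).s := by
  obtain ⟨a, rfl, -⟩ := (D'.fib s).torsor.simply_transitive p p' h
  rw [← smul_ι_pt, secMap_smul]
  change _ = D.torsor.act.smul (ga q (ga ι a)) _
  rw [(hQ.ker _).2 ⟨a, rfl⟩, D.torsor.act.one_smul]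

/-- On a cover the `H`-torsor of `s` has sections `p`, and the first component of `φ (pt s p)`
prescribes the value there. It does not depend on `p`, so the values glue. -/
theorem exists_baseMap (s : D'.torsor.sheaf.obj (op U)) :
    ∃ t : D.torsor.sheaf.obj (op U), ∀ {V : C} (p : D'.Sec s V),
      rs D.torsor.sheaf (D'.sstr p) t = (secMap φ (pt s p)).s := by
  obtain ⟨R, hR, hR'⟩ := (D'.fib s).torsor.locally_nonempty
  obtain ⟨t, ht⟩ := glueUnique D.torsor.isSheaf hR
    (fun V k y => ∃ p : D'.Sec s V, D'.sstr p = k ∧ (secMap φ (pt s p)).s = y)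
    (fun V k hk => by
      obtain ⟨p, hp⟩ := hR' k hk
      exact ⟨_, p, hp, rfl⟩)
    (by
      rintro V k _ _ ⟨p, hp, rfl⟩ ⟨p', hp', rfl⟩
      exact s_secMap_congr φ (hp.trans hp'.symm))
    (by
      rintro W V j k _ ⟨p, hp, rfl⟩
      refine ⟨rs (D'.fib s).torsor.sheaf j p, by rw [sstr_rs, hp], ?_⟩
      rw [← TotSec.res_pt, secMap_res, TotSec.s_res])
  -- The glued section is known only along the chosen cover; for an arbitrary `p` the comparison is
  -- made on the pullback of that cover.
  refine ⟨t, fun {V} p => sep D.torsor.isSheaf (J.pullback_stable (D'.sstr p) hR) fun W j hj => ?_⟩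
  obtain ⟨p', hp', e⟩ := ht (j ≫ D'.sstr p) hj
  rw [← rs_comp, ← e, ← TotSec.s_res, ← secMap_res, TotSec.res_pt]
  exact s_secMap_congr φ (by rw [hp', sstr_rs])

/-- The map of `Q`-torsors induced by a morphism of total spaces. -/
def baseMap (s : D'.torsor.sheaf.obj (op U)) : D.torsor.sheaf.obj (op U) :=
  (exists_baseMap φ s).choose

theorem rs_baseMap (s : D'.torsor.sheaf.obj (op U)) (p : D'.Sec s V) :
    rs D.torsor.sheaf (D'.sstr p) (baseMap φ s) = (secMap φ (pt s p)).s :=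
  (exists_baseMap φ s).choose_spec p

/-- The structure morphisms of sections of the `H`-torsor of `s` include a covering sieve of `U`. -/
theorem eq_of_rs_sstr (s : D'.torsor.sheaf.obj (op U)) {P : Cᵒᵖ ⥤ Type w}
    (hP : Presieve.IsSheaf J P) {t t' : P.obj (op U)}
    (h : ∀ {V : C} (p : D'.Sec s V), rs P (D'.sstr p) t = rs P (D'.sstr p) t') : t = t' := by
  obtain ⟨R, hR, hR'⟩ := (D'.fib s).torsor.locally_nonempty
  refine sep hP hR fun V k hk => ?_
  obtain ⟨p, rfl⟩ := hR' k hk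
  exact h p

/-- The morphism of `Q`-torsors induced by a morphism of total spaces. -/
def baseHom : TorsorHom D'.torsor D.torsor where
  base := φ.base
  toFun s := baseMap φ s
  res f s := by
    refine eq_of_rs_sstr (rs D'.torsor.sheaf f s) D.torsor.isSheaf fun p => ?_
    rw [rs_baseMap, ← rs_comp, ← pt_fibMap f rfl p, ← rs_baseMap, str_fibMap]
  str {U} s := by
    refine eq_of_rs_sstr s (P := yoneda.obj T)
      (GrothendieckTopology.Subcanonical.isSheaf_of_isRepresentable _) fun p => ?_
    change D'.sstr p ≫ _ = D'.sstr p ≫ _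
    rw [← D.torsor.str_res, rs_baseMap, str_secMap, str_pt, Category.assoc]
  smul {U} c s := by
    refine eq_of_rs_sstr (D'.torsor.act.smul c s) D.torsor.isSheaf fun {V} z => ?_
    -- `φ` is equivariant under `G` only, so `c` is first lifted locally to `G`.
    obtain ⟨S, hS, hS'⟩ := hQ.locally_surjective (rg Q (D'.sstr z) c)
    refine sep D.torsor.isSheaf hS fun W k hk => ?_
    obtain ⟨g, hg⟩ := hS' k hk
    have hg' : ga q g = rg Q (D'.sstr (rs (D'.fib _).torsor.sheaf k z)) c := by
      rw [hg, sstr_rs, rg_comp]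
    rw [← rs_comp, ← rs_comp, ← sstr_rs, rs_baseMap, ← smul_pt hg' rfl, secMap_smul,
      D.torsor.act.res_smul, ← hg', ← str_ev _ _ _ g hg', rs_baseMap]
    rfl

theorem exists_secHom (s : D'.torsor.sheaf.obj (op U)) (p : D'.Sec s V) :
    ∃ p' : D.Sec (baseMap φ s) V, D.sstr p' = D'.sstr p ∧
      pt (baseMap φ s) p' = secMap φ (pt s p) :=
  exists_pt_eq _ _ _ (rs_baseMap φ s p)

/-- The maps of `H`-torsors induced by a morphism of total spaces. -/
def secHom (s : D'.torsor.sheaf.obj (op U)) (p : D'.Sec s V) : D.Sec (baseMap φ s) V :=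
  (exists_secHom φ s p).choose

theorem str_secHom (s : D'.torsor.sheaf.obj (op U)) (p : D'.Sec s V) :
    D.sstr (secHom φ s p) = D'.sstr p :=
  (exists_secHom φ s p).choose_spec.1

theorem pt_secHom (s : D'.torsor.sheaf.obj (op U)) (p : D'.Sec s V) :
    pt (baseMap φ s) (secHom φ s p) = secMap φ (pt s p) :=
  (exists_secHom φ s p).choose_spec.2

/-- The morphisms of `[X/H]` induced by a morphism of total spaces. -/
def fibQuotHom (s : D'.torsor.sheaf.obj (op U)) : QuotHom (D'.fib s) (D.fib (baseMap φ s)) where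
  base := 𝟙 U
  toFun p := secHom φ s p
  res f p := pt_injective (by rw [sstr_rs, str_secHom, str_secHom, sstr_rs]) (by
    rw [← TotSec.res_pt, pt_secHom, pt_secHom, ← secMap_res, TotSec.res_pt])
  str p := (str_secHom φ s p).trans (Category.comp_id _).symm
  smul h p := pt_injective (by rw [sstr_smul, str_secHom, str_secHom, sstr_smul]) (by
    rw [pt_secHom, ← smul_ι_pt, ← smul_ι_pt, secMap_smul, pt_secHom])
  toSpace p := by
    rw [← toSpace_pt, pt_secHom, ← toSpace_pt s p]
    exact φ.toSpace _

/-- Acting by `g` on the total space is injective and inverts `ev` on points. After applying `g`,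
both sides become `φ (pt _ z)`, on the right because `φ` commutes with `g`. -/
theorem ev_secHom (c : Q.obj (op U)) (s : D'.torsor.sheaf.obj (op U))
    (h : rs D.torsor.sheaf (𝟙 U) (D.torsor.act.smul c (baseMap φ s)) =
      baseMap φ (D'.torsor.act.smul c s))
    (z : D'.Sec (D'.torsor.act.smul c s) V) (g : G.obj (op V)) (hg : ga q g = rg Q (D'.sstr z) c)
    (hg' : ga q g = rg Q (D.sstr ((D.fibMap (𝟙 U) h).toFun (secHom φ _ z))) c) :
    ev c (baseMap φ s) ((D.fibMap (𝟙 U) h).toFun (secHom φ _ z)) g hg' =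
      secHom φ s (ev c s z g hg) := by
  refine pt_injective (by
    rw [str_ev, str_fibMap, str_secHom, str_secHom, str_ev, Category.comp_id]) ?_
  have e : ∀ x y : D.TotSec V, x.smul g = y.smul g → x = y := by
    intro x y hxy
    have := congrArg (D.totAction.smul g⁻¹) hxy
    have hx : ∀ x : D.TotSec V, D.totAction.smul g⁻¹ (x.smul g) = x := fun x => by
      refine (D.totAction.mul_smul g⁻¹ g x).symm.trans ?_
      rw [inv_mul_cancel]
      exact D.totAction.one_smul x
    exact (hx x).symm.trans (this.trans (hx y))
  refine e _ _ ?_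
  rw [smul_pt hg' rfl, pt_fibMap, pt_secHom, pt_secHom, ← secMap_smul, smul_pt hg rfl]

theorem secHom_fibMap (f : V ⟶ U) {s' : D'.torsor.sheaf.obj (op V)}
    {s : D'.torsor.sheaf.obj (op U)} (h : rs D'.torsor.sheaf f s = s')
    (h' : rs D.torsor.sheaf f (baseMap φ s) = baseMap φ s') (p : D'.Sec s' W) :
    secHom φ s ((D'.fibMap f h).toFun p) = (D.fibMap f h').toFun (secHom φ s' p) := by
  refine pt_injective (by rw [str_secHom, str_fibMap, str_fibMap, str_secHom]) ?_
  rw [pt_secHom, pt_fibMap, ← pt_secHom, pt_fibMap]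

/-- Two equivariant maps are compared value by value. By `fn_toTwist` the value at `g` is an `ev`
with lift `g⁻¹`, and `ev_secHom` applies. This supplies `τ_equivariant` for the lifted morphism. -/
theorem toTwist_secHom (c : Q.obj (op U)) (s : D'.torsor.sheaf.obj (op U))
    (h : rs D.torsor.sheaf (𝟙 U) (D.torsor.act.smul c (baseMap φ s)) =
      baseMap φ (D'.torsor.act.smul c s))
    (hc : rg Q (fibQuotHom φ s).base c = c) (z : D'.Sec (D'.torsor.act.smul c s) V) :
    toTwist c (baseMap φ s) ((D.fibMap (𝟙 U) h).toFun (secHom φ _ z)) =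
      ((fibQuotHom φ s).twist hQ hX hc).toFun (toTwist c s z) := by
  have hstr : (toTwist c (baseMap φ s) ((D.fibMap (𝟙 U) h).toFun (secHom φ _ z))).str =
      (toTwist c s z).str := by
    rw [str_toTwist, str_toTwist, str_fibMap, str_secHom, Category.comp_id]
  refine TwistSec.ext' (hstr.trans (Category.comp_id _).symm) fun {W} k g hg hg' => ?_
  have hg₁ : ga q g = (rg Q (k ≫ (toTwist c s z).str) c)⁻¹ := by rw [hg, hstr]
  change _ = secHom φ s ((toTwist c s z).fn k g hg₁)
  have c₁ : ga q g⁻¹ = rg Q (D'.sstr (rs (D'.fib _).torsor.sheaf k z)) c := by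
    rw [map_inv, hg₁, inv_inv, str_toTwist, sstr_rs]
  have e : rs (D.fib _).torsor.sheaf k ((D.fibMap (𝟙 U) h).toFun (secHom φ _ z)) =
      (D.fibMap (𝟙 U) h).toFun (secHom φ _ (rs (D'.fib _).torsor.sheaf k z)) := by
    rw [(D.fibMap (𝟙 U) h).res]
    exact congrArg _ ((fibQuotHom φ _).res k z)
  have c₂ : ga q g⁻¹ = rg Q (D.sstr ((D.fibMap (𝟙 U) h).toFun
      (secHom φ _ (rs (D'.fib _).torsor.sheaf k z)))) c := by
    rw [c₁, str_fibMap, str_secHom, Category.comp_id]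
  rw [fn_toTwist k c s z g hg₁ c₁, ← ev_secHom φ c s h _ _ c₁ c₂]
  exact (fn_toTwist k c _ _ g hg (by rw [c₂, e])).trans (ev_congr e _ _)

/-- The morphism of `[[X/H]/(G/H)]` induced by a morphism of total spaces. -/
def ofTotHom : StackQuotHom D' D where
  u := baseHom φ
  τ s := fibQuotHom φ s
  τ_iso s := QuotHom.isVertIso _ rfl
  τ_natural {V U} f s' s h h' := by
    refine QuotHom.ext' ?_ fun {W} p => ?_
    · change (D'.fibMap f h).base ≫ 𝟙 U = 𝟙 V ≫ (D.fibMap f h').base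
      rw [base_fibMap, base_fibMap, Category.comp_id, Category.id_comp]
    · exact secHom_fibMap φ f h h' p
  τ_equivariant {U} c s h h' := by
    refine QuotHom.ext' ?_ fun {V} z => ?_
    · change 𝟙 U ≫ (D.fibMap (𝟙 U) h).base ≫ (D.fibEqui c _).base = (D'.fibEqui c s).base ≫ 𝟙 U
      rw [base_fibMap, base_fibEqui, base_fibEqui, Category.comp_id, Category.comp_id]
    · exact toTwist_secHom φ c s h h' z

theorem totHom_ofTotHom : (ofTotHom φ).totHom hG = φ := by
  refine QuotHom.ext' rfl fun {U} x => ?_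
  change D'.TotSec U at x
  refine (pt_secHom φ x.s x.p).trans ?_
  rw [pt_self]
  rfl

end StackQuotObj

/-- The functor `[[X/H]/(G/H)] ⟶ [X/G]`. -/
def totFun (hQ : IsQuotient J ι q) (hX : Presieve.IsSheaf J X) (act : SpaceAction G X)
    (hG : Presieve.IsSheaf J (G ⋙ forget GrpCat.{max u v})) :
    CatOver.Fun (stackQuotient J (twistStackAction hQ hX act)) (quotientStack J act) where
  obj D := StackQuotObj.totObj D hG
  map Φ := StackQuotHom.totHom Φ hG
  base_map _ := rfl
  map_id _ := QuotHom.ext' rfl fun x => pt_self x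
  map_comp _ Ψ := QuotHom.ext' rfl fun _ => (StackQuotHom.totMap_pt Ψ _ _).symm

end TotalFunctor

/-! ## The object of `[[X/H]/(G/H)]` attached to a `G`-torsor -/

section Orbits

variable {C : Type u} [Category.{v} C] {J : GrothendieckTopology C}
  {G Q : Cᵒᵖ ⥤ GrpCat.{max u v}} {q : G ⟶ Q} {T : C}

/-- A section over `U` of the `Q`-torsor induced from a `G`-torsor `E` along `q : G ⟶ Q`: the graph
`rel` of a map `φ` from `E` to `Q`, defined over the structure morphism `str`, such that
`φ (g e) = φ e (q g)⁻¹`. If `Q = G/H`, these are the sections of `E/H`. -/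
structure OrbSec (q : G ⟶ Q) (E : Torsor J G T) (U : C) where
  str : U ⟶ T
  rel : ∀ {V : C}, (V ⟶ U) → E.sheaf.obj (op V) → Q.obj (op V) → Prop
  str_eq : ∀ {V : C} {k : V ⟶ U} {e : E.sheaf.obj (op V)} {d : Q.obj (op V)}, rel k e d →
    E.str e = k ≫ str
  exists_rel : ∀ {V : C} (k : V ⟶ U) (e : E.sheaf.obj (op V)), E.str e = k ≫ str →
    ∃ d, rel k e d
  rel_unique : ∀ {V : C} {k : V ⟶ U} {e : E.sheaf.obj (op V)} {d d' : Q.obj (op V)},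
    rel k e d → rel k e d' → d = d'
  rel_res : ∀ {W V : C} (j : W ⟶ V) {k : V ⟶ U} {e : E.sheaf.obj (op V)} {d : Q.obj (op V)},
    rel k e d → rel (j ≫ k) (rs E.sheaf j e) (rg Q j d)
  rel_smul : ∀ {V : C} {k : V ⟶ U} (g : G.obj (op V)) {e : E.sheaf.obj (op V)}
    {d : Q.obj (op V)}, rel k e d → rel k (E.act.smul g e) (d * (ga q g)⁻¹)

namespace OrbSec

variable {E : Torsor J G T} {U V : C}

/-- One implication suffices: both relations are graphs of functions with the same domain. -/
theorem ext_of_imp {s s' : OrbSec q E U} (hs : s.str = s'.str)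
    (h : ∀ {V : C} (k : V ⟶ U) (e : E.sheaf.obj (op V)) (d : Q.obj (op V)), s.rel k e d →
      s'.rel k e d) : s = s' := by
  have h' : ∀ {V : C} (k : V ⟶ U) (e : E.sheaf.obj (op V)) (d : Q.obj (op V)), s'.rel k e d →
      s.rel k e d := by
    intro V k e d hd
    obtain ⟨d', hd'⟩ := s.exists_rel k e (by rw [s'.str_eq hd, hs])
    rwa [s'.rel_unique hd (h k e d' hd')]
  obtain ⟨t, r, _, _, _, _, _⟩ := s
  obtain ⟨t', r', _, _, _, _, _⟩ := s'
  obtain rfl : t = t' := hs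
  obtain rfl : @r = @r' := by
    funext V k e d
    exact propext ⟨h k e d, h' k e d⟩
  rfl

/-- Restriction of sections. -/
@[reducible]
def restrict (f : V ⟶ U) (s : OrbSec q E U) : OrbSec q E V where
  str := f ≫ s.str
  rel k e d := s.rel (k ≫ f) e d
  str_eq h := by rw [s.str_eq h, Category.assoc]
  exists_rel k e h := s.exists_rel _ e (by rw [h, Category.assoc])
  rel_unique h h' := s.rel_unique h h'
  rel_res j _ _ _ h := by
    rw [Category.assoc]
    exact s.rel_res j h
  rel_smul g _ _ h := s.rel_smul g h

/-- The value of the equivariant map on a translate. -/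
theorem exists_rel_smul (s : OrbSec q E U) {k : V ⟶ U} {e e' : E.sheaf.obj (op V)}
    {d d' : Q.obj (op V)} (h : s.rel k e d) (h' : s.rel k e' d') :
    ∃ g : G.obj (op V), E.act.smul g e = e' ∧ d' = d * (ga q g)⁻¹ := by
  obtain ⟨g, rfl, -⟩ := E.simply_transitive e e' (by rw [s.str_eq h, s.str_eq h'])
  exact ⟨g, rfl, s.rel_unique h' (s.rel_smul g h)⟩

/-- The section determined by an element of the torsor. -/
def ofSection (q : G ⟶ Q) (e₀ : E.sheaf.obj (op U)) : OrbSec q E U where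
  str := E.str e₀
  rel {V} k e d := ∃ g : G.obj (op V), E.act.smul g (rs E.sheaf k e₀) = e ∧ d = (ga q g)⁻¹
  str_eq := by
    rintro V k _ _ ⟨g, rfl, -⟩
    rw [E.str_smul, E.str_res]
  exists_rel k e h := by
    obtain ⟨g, hg, -⟩ := E.simply_transitive (rs E.sheaf k e₀) e (by rw [E.str_res, h])
    exact ⟨_, g, hg, rfl⟩
  rel_unique := by
    rintro V k _ _ _ ⟨g, hg, rfl⟩ ⟨g', hg', rfl⟩
    rw [(E.simply_transitive _ _ (E.str_smul _ _).symm).unique rfl (hg'.trans hg.symm)]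
  rel_res := by
    rintro W V j k _ _ ⟨g, rfl, rfl⟩
    exact ⟨rg G j g, by rw [E.act.res_smul, rs_comp], by rw [map_inv, ga_rg]⟩
  rel_smul := by
    rintro V k g' _ _ ⟨g, rfl, rfl⟩
    exact ⟨g' * g, E.act.mul_smul _ _ _, by rw [map_mul, mul_inv_rev]⟩

end OrbSec

/-- The underlying presheaf of the `Q`-torsor induced from a `G`-torsor. -/
def orbPresheaf (q : G ⟶ Q) (E : Torsor J G T) : Cᵒᵖ ⥤ Type (max u v) where
  obj U := OrbSec q E U.unop
  map f := ↾fun s => s.restrict f.unop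
  map_id U := by
    ext s
    refine OrbSec.ext_of_imp (Category.id_comp _) fun k e d h => ?_
    change s.rel (k ≫ 𝟙 _) e d at h
    rwa [Category.comp_id] at h
  map_comp f g := by
    ext s
    refine OrbSec.ext_of_imp (Category.assoc _ _ _) fun k e d h => ?_
    change s.rel (k ≫ g.unop ≫ f.unop) e d at h
    change s.rel ((k ≫ g.unop) ≫ f.unop) e d
    rwa [Category.assoc]

/-- The graph is glued by imposing the local relations after restriction along the cover. Since `Q`
is a sheaf, the local values glue to exactly one value at each point of `E`, so the result is again
a graph. -/
theorem isSheaf_orbPresheaf [J.Subcanonical]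
    (hQs : Presieve.IsSheaf J (Q ⋙ forget GrpCat.{max u v})) (E : Torsor J G T) :
    Presieve.IsSheaf J (orbPresheaf q E) := by
  have hT : Presieve.IsSheaf J (yoneda.obj T) :=
    GrothendieckTopology.Subcanonical.isSheaf_of_isRepresentable _
  intro U S hS x hx
  have hx' : ∀ {W V : C} (j : W ⟶ V) (k : V ⟶ U) (hk : S k),
      (x k hk).restrict j = x (j ≫ k) (S.downward_closed hk j) := fun j k hk =>
    ((Presieve.compatible_iff_sieveCompatible _).1 hx k j hk).symm
  have hstr : ∀ {W V : C} (j : W ⟶ V) (k : V ⟶ U) (hk : S k) (hjk : S (j ≫ k)),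
      (x (j ≫ k) hjk).str = j ≫ (x k hk).str := fun j k hk hjk => by rw [← hx' j k hk]
  have hrel : ∀ {Z W V : C} (i : Z ⟶ W) (j : W ⟶ V) (k : V ⟶ U) (hk : S k) (hjk : S (j ≫ k))
      (e : E.sheaf.obj (op Z)) (d : Q.obj (op Z)),
      (x (j ≫ k) hjk).rel i e d ↔ (x k hk).rel (i ≫ j) e d := fun i j k hk hjk e d => by
    rw [← hx' j k hk]
  have hcongr : ∀ {W : C} {l l' : W ⟶ U} (_ : l = l') (hl : S l) (hl' : S l')
      {e e' : E.sheaf.obj (op W)} (_ : e = e') {d d' : Q.obj (op W)} (_ : d = d'),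
      (x l hl).rel (𝟙 W) e d → (x l' hl').rel (𝟙 W) e' d' := by
    rintro W l _ rfl hl hl' e _ rfl d _ rfl h
    exact h
  obtain ⟨t, ht⟩ := glue hT hS (fun V k hk => (x k hk).str)
    (fun W V j k hk => (hstr j k hk _).symm)
  replace ht : ∀ {V : C} (k : V ⟶ U) (hk : S k), k ≫ t = (x k hk).str := fun k hk => ht k hk
  -- The local relations are consulted only over identities, so that `W ⟶ V ⟶ U` enters solely
  -- through the index of the cover.
  let R : ∀ {V : C}, (V ⟶ U) → E.sheaf.obj (op V) → Q.obj (op V) → Prop := fun {V} k e d =>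
    E.str e = k ≫ t ∧ ∀ {W : C} (j : W ⟶ V) (hj : S (j ≫ k)),
      (x (j ≫ k) hj).rel (𝟙 W) (rs E.sheaf j e) (rg Q j d)
  have hstab : ∀ {Z W V : C} (i : Z ⟶ W) (j : W ⟶ V) (k : V ⟶ U) (hj : S (j ≫ k))
      (hij : S ((i ≫ j) ≫ k)) (e : E.sheaf.obj (op V)) (d : Q.obj (op W)),
      (x (j ≫ k) hj).rel (𝟙 W) (rs E.sheaf j e) d →
        (x ((i ≫ j) ≫ k) hij).rel (𝟙 Z) (rs E.sheaf (i ≫ j) e) (rg Q i d) := by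
    intro Z W V i j k hj hij e d h
    have hij' : S (i ≫ j ≫ k) := S.downward_closed hj i
    have := (x (j ≫ k) hj).rel_res i h
    rw [Category.comp_id, ← Category.id_comp i, ← hrel (𝟙 Z) i (j ≫ k) hj hij'] at this
    refine hcongr (Category.assoc _ _ _).symm hij' hij ?_ ?_ this
    · rw [Category.id_comp, rs_comp]
    · rw [Category.id_comp]
  refine ⟨({
    str := t
    rel := R
    str_eq := fun h => h.1
    exists_rel := ?_
    rel_unique := ?_
    rel_res := ?_
    rel_smul := ?_ } : OrbSec q E U), ?_, ?_⟩
  · intro V k e he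
    obtain ⟨d, hd⟩ := glueUnique hQs (J.pullback_stable k hS)
      (fun W j d => ∃ hj : S (j ≫ k), (x (j ≫ k) hj).rel (𝟙 W) (rs E.sheaf j e) d)
      (fun W j hj => by
        obtain ⟨d, hd⟩ := (x (j ≫ k) hj).exists_rel (𝟙 W) (rs E.sheaf j e) (by
          rw [E.str_res, he, Category.id_comp, ← Category.assoc]
          exact ht _ hj)
        exact ⟨d, hj, hd⟩)
      (by
        rintro W j d d' ⟨hj, h⟩ ⟨_, h'⟩
        exact (x _ hj).rel_unique h h')
      (by
        rintro Z W i j d ⟨hj, h⟩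
        have hij : S ((i ≫ j) ≫ k) := by
          rw [Category.assoc]
          exact S.downward_closed hj i
        exact ⟨hij, hstab i j k hj hij e d h⟩)
    exact ⟨d, he, fun j hj => (hd j hj).2⟩
  · intro V k e d d' h h'
    exact sep hQs (J.pullback_stable k hS) fun W j hj =>
      (x _ hj).rel_unique (h.2 j hj) (h'.2 j hj)
  · intro W V j k e d h
    refine ⟨by rw [E.str_res, h.1, Category.assoc], fun {Z} i hi => ?_⟩
    have hi' : S ((i ≫ j) ≫ k) := by rwa [Category.assoc]
    exact hcongr (Category.assoc _ _ _) hi' hi (rs_comp _ _ _ _) (rg_comp _ _ _ _) (h.2 (i ≫ j) hi')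
  · intro V k g e d h
    refine ⟨by rw [E.str_smul, h.1], fun {W} j hj => ?_⟩
    have := (x _ hj).rel_smul (rg G j g) (h.2 j hj)
    rwa [← E.act.res_smul, ga_rg, ← map_inv, ← map_mul] at this
  · intro V k hk
    refine OrbSec.ext_of_imp (ht k hk) fun {W} j e d h => ?_
    have hjk : S (𝟙 W ≫ j ≫ k) := by
      rw [Category.id_comp]
      exact S.downward_closed hk j
    have hjk' : S (j ≫ k) := S.downward_closed hk j
    have := hcongr (Category.id_comp _) hjk hjk' (rs_id _ _) (rg_id _ _) (h.2 (𝟙 W) hjk)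
    rwa [hrel (𝟙 W) j k hk hjk', Category.id_comp] at this
  · intro s hs
    change OrbSec q E U at s
    have hs' : ∀ {V : C} (k : V ⟶ U) (hk : S k), s.restrict k = x k hk := fun k hk => hs k hk
    have hst : s.str = t := sep hT hS fun V k hk => by
      change k ≫ s.str = k ≫ t
      rw [ht k hk, ← hs' k hk]
    refine OrbSec.ext_of_imp hst fun {V} k e d h => ⟨by rw [s.str_eq h, hst], fun {W} j hj => ?_⟩
    rw [← hs' _ hj]
    change s.rel (𝟙 W ≫ j ≫ k) _ _
    rw [Category.id_comp]
    exact s.rel_res j h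

/-- The action of `Q` on the induced torsor. -/
def orbAction (q : G ⟶ Q) (E : Torsor J G T) : SpaceAction Q (orbPresheaf q E) where
  smul {U} c (s : OrbSec q E U) := ({
    str := s.str
    rel := fun k e d => s.rel k e ((rg Q k c)⁻¹ * d)
    str_eq := fun h => s.str_eq h
    exists_rel := fun k e h => by
      obtain ⟨d, hd⟩ := s.exists_rel k e h
      exact ⟨rg Q k c * d, by rwa [inv_mul_cancel_left]⟩
    rel_unique := fun h h' => mul_left_cancel (s.rel_unique h h')
    rel_res := fun j _ _ _ h => by
      rw [rg_comp, ← map_inv, ← map_mul]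
      exact s.rel_res j h
    rel_smul := fun g _ _ h => by
      rw [← mul_assoc]
      exact s.rel_smul g h } : OrbSec q E U)
  one_smul s := OrbSec.ext_of_imp rfl fun k e d h => by
    change OrbSec.rel s k e ((rg Q k 1)⁻¹ * d) at h
    rwa [map_one, inv_one, one_mul] at h
  mul_smul c c' s := OrbSec.ext_of_imp rfl fun k e d h => by
    change OrbSec.rel s k e ((rg Q k (c * c'))⁻¹ * d) at h
    change OrbSec.rel s k e ((rg Q k c')⁻¹ * ((rg Q k c)⁻¹ * d))
    rwa [map_mul, mul_inv_rev, mul_assoc] at h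
  res_smul f c s := OrbSec.ext_of_imp rfl fun k e d h => by
    change OrbSec.rel s (k ≫ f) e ((rg Q (k ≫ f) c)⁻¹ * d) at h
    rwa [rg_comp] at h

variable [J.Subcanonical]

/-- The `Q`-torsor induced from a `G`-torsor along `q : G ⟶ Q`. -/
def orbTorsor (q : G ⟶ Q) (hQs : Presieve.IsSheaf J (Q ⋙ forget GrpCat.{max u v}))
    (E : Torsor J G T) : Torsor J Q T where
  sheaf := orbPresheaf q E
  isSheaf := isSheaf_orbPresheaf hQs E
  str s := OrbSec.str s
  str_res _ _ := rfl
  act := orbAction q E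
  str_smul _ _ := rfl
  simply_transitive {U} s s' hss := by
    change OrbSec q E U at s s'
    have hst : s.str = s'.str := hss
    obtain ⟨R, hR, hR'⟩ := E.locally_nonempty
    have hS : R.pullback s.str ∈ J U := J.pullback_stable s.str hR
    -- Translating `e` by `g` multiplies both values on the right by `(q g)⁻¹`, so a left factor
    -- relating them at one point relates them at every point.
    have indep : ∀ {V : C} (k : V ⟶ U) (c : Q.obj (op V)) {e e' : E.sheaf.obj (op V)}
        {d₁ d₂ d₁' d₂' : Q.obj (op V)}, s.rel k e d₁ → s'.rel k e d₂ → c * d₁ = d₂ →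
          s.rel k e' d₁' → s'.rel k e' d₂' → c * d₁' = d₂' := by
      intro V k c e e' d₁ d₂ d₁' d₂' h₁ h₂ hc h₁' h₂'
      obtain ⟨g, rfl, rfl⟩ := s.exists_rel_smul h₁ h₁'
      rw [s'.rel_unique h₂' (s'.rel_smul g h₂), ← hc, mul_assoc]
    -- Locally the translating section is `d' * d⁻¹`, for the values `d` and `d'` of `s` and `s'` at
    -- a common point of `E`.
    obtain ⟨c, hc⟩ := glueUnique hQs hS (fun V k (c : Q.obj (op V)) =>
        ∃ e d d', s.rel k e d ∧ s'.rel k e d' ∧ c * d = d')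
      (fun V k hk => by
        obtain ⟨e, he⟩ := hR' _ hk
        obtain ⟨d, hd⟩ := s.exists_rel k e he
        obtain ⟨d', hd'⟩ := s'.exists_rel k e (by rw [he, hst])
        exact ⟨d' * d⁻¹, e, d, d', hd, hd', inv_mul_cancel_right _ _⟩)
      (by
        rintro V k c c' ⟨e, d, d', h₁, h₂, h⟩ ⟨e', b, b', h₁', h₂', h'⟩
        exact mul_right_cancel (h.trans (indep k c' h₁' h₂' h' h₁ h₂).symm))
      (by
        rintro W V j k c ⟨e, d, d', h₁, h₂, h⟩
        exact ⟨_, _, _, s.rel_res j h₁, s'.rel_res j h₂, by rw [← h, map_mul]; rfl⟩)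
    refine ⟨c, OrbSec.ext_of_imp hst fun {V} k e d h => ?_, fun c' hc' => ?_⟩
    · change s.rel k e ((rg Q k c)⁻¹ * d) at h
      obtain ⟨d', hd'⟩ := s'.exists_rel k e (by rw [s.str_eq h, hst])
      suffices d' = d by rwa [← this]
      refine sep hQs (J.pullback_stable k hS) fun W j hj => ?_
      obtain ⟨e₁, b, b', h₁, h₂, hb⟩ := hc (j ≫ k) hj
      have := indep (j ≫ k) _ h₁ h₂ hb (s.rel_res j h) (s'.rel_res j hd')
      refine this.symm.trans ?_
      change rg Q (j ≫ k) c * rg Q j ((rg Q k c)⁻¹ * d) = rg Q j d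
      rw [rg_comp, ← map_mul, mul_inv_cancel_left]
    · refine sep hQs hS fun V k hk => ?_
      obtain ⟨e, d, d', h₁, h₂, h⟩ := hc k hk
      refine mul_right_cancel (b := d) (Eq.trans ?_ h.symm)
      subst hc'
      have h₂' : s.rel k e ((rg Q k c')⁻¹ * d') := h₂
      rw [s.rel_unique h₁ h₂']
      exact mul_inv_cancel_left _ _
  locally_nonempty := by
    obtain ⟨R, hR, hR'⟩ := E.locally_nonempty
    refine ⟨R, hR, fun U f hf => ?_⟩
    obtain ⟨e, he⟩ := hR' f hf
    exact ⟨OrbSec.ofSection q e, he⟩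

end Orbits

/-! ### The fibres of `E ⟶ E/H` and essential surjectivity -/

section OrbitFibres

variable {C : Type u} [Category.{v} C] {J : GrothendieckTopology C} [J.Subcanonical]
  {H G Q : Cᵒᵖ ⥤ GrpCat.{max u v}} {ι : H ⟶ G} {q : G ⟶ Q}

/-- The sections over `V` of the fibre of `E ⟶ E/H` over a section `s` of `E/H`. -/
@[ext]
structure FibSec {T : C} {E : Torsor J G T} {U : C} (s : OrbSec q E U) (V : C) where
  str : V ⟶ U
  pt : E.sheaf.obj (op V)
  rel : s.rel str pt 1

variable {T : C} {E : Torsor J G T} {U : C}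

/-- The fibre of `E ⟶ E/H` over a section `s` of `E/H`. -/
def fibPresheaf (s : OrbSec q E U) : Cᵒᵖ ⥤ Type (max u v) where
  obj V := FibSec s V.unop
  map f := ↾fun x => ⟨f.unop ≫ x.str, rs E.sheaf f.unop x.pt, by
    have := s.rel_res f.unop x.rel
    rwa [map_one] at this⟩
  map_id V := by
    ext x
    · exact Category.id_comp _
    · exact rs_id E.sheaf _
  map_comp f g := by
    ext x
    · exact Category.assoc _ _ _
    · exact rs_comp E.sheaf _ _ _

/-- Structure morphisms and points glue separately. The value of `s` at the glued point is locally
`1`, hence equal to `1` because `Q` is separated. -/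
theorem isSheaf_fibPresheaf (hQs : Presieve.IsSheaf J (Q ⋙ forget GrpCat.{max u v}))
    (s : OrbSec q E U) : Presieve.IsSheaf J (fibPresheaf s) := by
  intro V S hS x hx
  have hT : Presieve.IsSheaf J (yoneda.obj T) :=
    GrothendieckTopology.Subcanonical.isSheaf_of_isRepresentable _
  have hU : Presieve.IsSheaf J (yoneda.obj U) :=
    GrothendieckTopology.Subcanonical.isSheaf_of_isRepresentable _
  have hx' : ∀ {W W' : C} (j : W ⟶ W') (k : W' ⟶ V) (hk : S k),
      rs (fibPresheaf s) j (x k hk) = x (j ≫ k) (S.downward_closed hk j) := fun j k hk =>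
    ((Presieve.compatible_iff_sieveCompatible _).1 hx k j hk).symm
  obtain ⟨t, ht⟩ := glue hU hS (fun W k hk => FibSec.str (x k hk))
    (fun W W' j k hk => congrArg FibSec.str (hx' j k hk))
  obtain ⟨e, he⟩ := glue E.isSheaf hS (fun W k hk => FibSec.pt (x k hk))
    (fun W W' j k hk => congrArg FibSec.pt (hx' j k hk))
  replace ht : ∀ {W : C} (k : W ⟶ V) (hk : S k), k ≫ t = FibSec.str (x k hk) :=
    fun k hk => ht k hk
  have hstr : E.str e = t ≫ s.str := by
    refine sep hT hS fun W k hk => ?_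
    change k ≫ E.str e = k ≫ t ≫ s.str
    rw [← E.str_res, he k hk, ← Category.assoc, ht k hk]
    exact s.str_eq (FibSec.rel (x k hk))
  obtain ⟨d, hd⟩ := s.exists_rel t e hstr
  obtain rfl : d = 1 := by
    refine sep hQs hS fun W k hk => ?_
    refine s.rel_unique (s.rel_res k hd) ?_
    have h := FibSec.rel (x k hk)
    rw [← he k hk, ← ht k hk] at h
    rwa [show rs (Q ⋙ forget GrpCat.{max u v}) k (1 : Q.obj (op V)) = 1 from map_one (rg Q k)]
  refine ⟨(⟨t, e, hd⟩ : FibSec s V), fun W k hk => FibSec.ext (ht k hk) (he k hk),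
    fun y hy => ?_⟩
  change FibSec s V at y
  refine FibSec.ext ?_ ?_
  · refine sep hU hS fun W k hk => ?_
    exact (congrArg FibSec.str (hy k hk)).trans (ht k hk).symm
  · refine sep E.isSheaf hS fun W k hk => ?_
    exact (congrArg FibSec.pt (hy k hk)).trans (he k hk).symm

/-- The action of `H` on the fibres of `E ⟶ E/H`. -/
def fibAction (hQ : IsQuotient J ι q) (s : OrbSec q E U) : SpaceAction H (fibPresheaf s) where
  smul {V} h (x : FibSec s V) := (⟨x.str, E.act.smul (ga ι h) x.pt, by
    have := s.rel_smul (ga ι h) x.rel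
    rwa [(hQ.ker _).2 ⟨h, rfl⟩, inv_one, mul_one] at this⟩ : FibSec s V)
  one_smul x := FibSec.ext rfl
    ((congrArg (fun g => E.act.smul g _) (map_one _)).trans (E.act.one_smul _))
  mul_smul g h x := FibSec.ext rfl
    ((congrArg (fun g => E.act.smul g _) (map_mul _ _ _)).trans (E.act.mul_smul _ _ _))
  res_smul f h x := FibSec.ext rfl ((E.act.res_smul _ _ _).trans (by rw [← ga_rg]; rfl))

/-- The fibre of `E ⟶ E/H` over a section of `E/H`, as an `H`-torsor. -/
def fibTorsor (hQ : IsQuotient J ι q) (hQs : Presieve.IsSheaf J (Q ⋙ forget GrpCat.{max u v}))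
    (s : OrbSec q E U) : Torsor J H U where
  sheaf := fibPresheaf s
  isSheaf := isSheaf_fibPresheaf hQs s
  str x := FibSec.str x
  str_res _ _ := rfl
  act := fibAction hQ s
  str_smul _ _ := rfl
  simply_transitive {V} x x' hxx := by
    change FibSec s V at x x'
    have hstr : x.str = x'.str := hxx
    -- Both points have value `1`, so the element of `G` between them maps to `1` in `Q` and lies in
    -- `H`.
    obtain ⟨g, hg, hd⟩ := s.exists_rel_smul (k := x'.str) (by rw [← hstr]; exact x.rel) x'.rel
    obtain ⟨h, rfl⟩ := (hQ.ker g).1 (by rw [one_mul] at hd; exact inv_eq_one.1 hd.symm)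
    refine ⟨h, FibSec.ext hstr hg, fun h' hh' => hQ.injective _ _ ?_⟩
    exact (E.simply_transitive x.pt x'.pt (by rw [s.str_eq x.rel, s.str_eq x'.rel, hstr])).unique
      (congrArg FibSec.pt hh') hg
  locally_nonempty := by
    obtain ⟨R, hR, hR'⟩ := E.locally_nonempty
    have ex : ∀ ⦃V : C⦄ (k : V ⟶ U), R.pullback s.str k → ∃ S ∈ J V, ∀ ⦃W : C⦄ (j : W ⟶ V), S j →
        ∃ x : FibSec s W, x.str = j ≫ k := by
      intro V k hk
      obtain ⟨e, he⟩ := hR' _ hk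
      obtain ⟨d, hd⟩ := s.exists_rel k e he
      -- A point of value `d` is moved into the fibre by a local lift of `d`: the new value is `d *
      -- d⁻¹ = 1`.
      obtain ⟨S, hS, hS'⟩ := hQ.locally_surjective d
      refine ⟨S, hS, fun W j hj => ?_⟩
      obtain ⟨g, hg⟩ := hS' j hj
      refine ⟨⟨j ≫ k, E.act.smul g (rs E.sheaf j e), ?_⟩, rfl⟩
      have := s.rel_smul g (s.rel_res j hd)
      rwa [hg, mul_inv_cancel] at this
    choose S hS hS' using ex
    refine ⟨Sieve.bind (R.pullback s.str) fun V k hk => S k hk,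
      J.bind_covering (J.pullback_stable s.str hR) fun V k hk => hS k hk, ?_⟩
    rintro W _ ⟨V, j, k, hk, hj, rfl⟩
    exact hS' k hk j hj

variable {X : Cᵒᵖ ⥤ Type (max u v)} {act : SpaceAction G X}

/-- The fibre of `E ⟶ E/H` over a section of `E/H`, as an object of `[X/H]`. -/
def fibObj (hQ : IsQuotient J ι q) (hQs : Presieve.IsSheaf J (Q ⋙ forget GrpCat.{max u v}))
    (E : QuotObj J act T) (s : OrbSec q E.torsor U) : QuotObj J (act.restrict ι) U where
  torsor := fibTorsor hQ hQs s
  toSpace x := E.toSpace (FibSec.pt x)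
  toSpace_res _ _ := E.toSpace_res _ _
  toSpace_smul _ _ := E.toSpace_smul _ _

/-- The inclusion of fibres of `E ⟶ E/H` over restrictions. -/
def fibObjMap (hQ : IsQuotient J ι q) (hQs : Presieve.IsSheaf J (Q ⋙ forget GrpCat.{max u v}))
    (E : QuotObj J act T) {V : C} (f : V ⟶ U) {s' : OrbSec q E.torsor V} {s : OrbSec q E.torsor U}
    (h : s.restrict f = s') : QuotHom (fibObj hQ hQs E s') (fibObj hQ hQs E s) where
  base := f
  toFun {W} (x : FibSec s' W) := (⟨x.str ≫ f, x.pt, by subst h; exact x.rel⟩ : FibSec s W)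
  res k x := FibSec.ext (Category.assoc _ _ _).symm rfl
  str _ := rfl
  smul _ _ := rfl
  toSpace _ := rfl

/-- If `g` lies over `c⁻¹`, it maps the fibre over `c • s` to the fibre over `s`. -/
def FibSec.translate (c : Q.obj (op U)) (s : OrbSec q E U) {V W : C}
    (x : FibSec (q := q) ((orbAction q E).smul c s : OrbSec q E U) V) (j : W ⟶ V)
    (g : G.obj (op W)) (hg : ga q g = (rg Q (j ≫ x.str) c)⁻¹) : FibSec s W where
  str := j ≫ x.str
  pt := E.act.smul g (rs E.sheaf j x.pt)
  rel := by
    have h : s.rel x.str x.pt ((rg Q x.str c)⁻¹ * 1) := x.rel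
    have := s.rel_smul g (s.rel_res j h)
    rwa [hg, inv_inv, mul_one, map_inv, ← rg_comp, inv_mul_cancel] at this

/-- The isomorphism from the fibre over `c • s` to the twist by `c` of the fibre over `s`. -/
def fibObjEqui (hQ : IsQuotient J ι q) (hX : Presieve.IsSheaf J X)
    (hQs : Presieve.IsSheaf J (Q ⋙ forget GrpCat.{max u v}))
    (E : QuotObj J act T) (c : Q.obj (op U)) (s : OrbSec q E.torsor U) :
    QuotHom (fibObj hQ hQs E ((orbAction q E.torsor).smul c s : OrbSec q E.torsor U))
      ((fibObj hQ hQs E s).twist hQ hX c) where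
  base := 𝟙 U
  toFun {V} (x : FibSec _ V) := ({
    str := x.str
    fn := fun j g hg => x.translate c s j g hg
    str_fn := fun _ _ _ => rfl
    fn_res := fun i j g _ _ => FibSec.ext (Category.assoc _ _ _).symm
      ((E.torsor.act.res_smul _ _ _).trans (by rw [← rs_comp]; rfl))
    fn_smul := fun _ _ _ _ _ => FibSec.ext rfl (E.torsor.act.mul_smul _ _ _) } :
      TwistSec ι q (fibTorsor hQ hQs s) c V)
  res k x := TwistSec.ext' rfl fun j g _ _ => FibSec.ext (Category.assoc _ _ _)
    (congrArg (E.torsor.act.smul g) (rs_comp _ _ _ _))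
  str _ := (Category.comp_id _).symm
  smul h x := TwistSec.ext' rfl fun j g _ _ => FibSec.ext rfl (by
    refine (congrArg (E.torsor.act.smul g) (E.torsor.act.res_smul _ _ _)).trans ?_
    rw [← E.torsor.act.mul_smul, ← ga_rg]
    rfl)
  toSpace {V} x := by
    refine twistSpace_eq hQ hX (fibObj hQ hQs E s) c _ _ fun {W} j g hg => ?_
    change rs X j (E.toSpace _) = act.smul g⁻¹ (E.toSpace (E.torsor.act.smul g _))
    rw [E.toSpace_smul, ← act.mul_smul, inv_mul_cancel, act.one_smul, E.toSpace_res]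

/-- The object of `[[X/H]/(G/H)]` attached to an object `E` of `[X/G]`: the torsor `E/H` with the
fibres of `E ⟶ E/H`. -/
def orbObj (hQ : IsQuotient J ι q) (hX : Presieve.IsSheaf J X)
    (hQs : Presieve.IsSheaf J (Q ⋙ forget GrpCat.{max u v})) (E : QuotObj J act T) :
    StackQuotObj J (twistStackAction hQ hX act) T where
  torsor := orbTorsor q hQs E.torsor
  toStack := {
    obj := fun s => fibObj hQ hQs E s
    map := fun f _ _ h => fibObjMap hQ hQs E f h
    base_map := fun _ _ _ _ => rfl
    map_id := fun s h => QuotHom.ext' rfl fun x => FibSec.ext (Category.comp_id _) rfl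
    map_comp := fun g f _ _ _ hg hf h => QuotHom.ext' rfl fun x =>
      FibSec.ext (Category.assoc _ _ _).symm rfl
    equi := fun c s => fibObjEqui hQ hX hQs E c s
    equi_iso := fun c s => QuotHom.isVertIso _ rfl
    equi_natural := fun f _ _ _ _ h hq hs => QuotHom.ext'
      ((Category.comp_id _).trans (Category.id_comp _).symm) fun x =>
        TwistSec.ext' rfl fun j g _ _ => FibSec.ext (Category.assoc _ _ _).symm rfl
    -- Both composites send a point `z` to `g₂ ↦ (g₁ ↦ (g₁ g₂) z)`; what remains is bookkeeping of
    -- structure morphisms.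
    equi_mul := fun {U} c₂ c₁ s h h' => by
      refine QuotHom.ext' ?_ fun {V} z => ?_
      · change 𝟙 U ≫ 𝟙 U = 𝟙 U ≫ 𝟙 U ≫ 𝟙 U
        simp only [Category.comp_id]
      · change FibSec _ V at z
        refine TwistSec.ext' ?_ fun {W} k₂ g₂ hg₂ hg₂' => ?_
        · change z.str = (z.str ≫ 𝟙 U) ≫ 𝟙 U
          simp only [Category.comp_id]
        refine TwistSec.ext' ?_ fun {W'} k₁ g₁ hg₁ hg₁' => ?_
        · change k₂ ≫ z.str = k₂ ≫ z.str ≫ 𝟙 U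
          simp only [Category.comp_id]
        refine FibSec.ext ?_ ?_
        · change (k₁ ≫ k₂) ≫ z.str = k₁ ≫ k₂ ≫ z.str ≫ 𝟙 U
          simp only [Category.comp_id, Category.assoc]
        · change E.torsor.act.smul (g₁ * rg G k₁ g₂) (rs E.torsor.sheaf (k₁ ≫ k₂) z.pt) =
            E.torsor.act.smul g₁ (rs E.torsor.sheaf k₁
              (E.torsor.act.smul g₂ (rs E.torsor.sheaf k₂ z.pt)))
          rw [E.torsor.act.res_smul, E.torsor.act.mul_smul, rs_comp]
    equi_one := fun {U} s h => by
      refine QuotHom.ext' (Category.comp_id _).symm fun {V} z => ?_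
      change FibSec _ V at z
      refine TwistSec.ext' (Category.comp_id _).symm fun {W} k g hg hg' => ?_
      obtain ⟨x, rfl⟩ := TwistSec.exists_of_one hQ _ g hg
      refine Eq.trans ?_ (TwistSec.ofSection_fn hQ (fibTorsor hQ hQs s)
        ((fibObjMap hQ hQs E (𝟙 U) h).toFun z) k (ga ι x) hg' x rfl).symm
      refine FibSec.ext ?_ rfl
      change k ≫ z.str = k ≫ z.str ≫ 𝟙 U
      rw [Category.comp_id] }

/-- The point of `E` underlying a section of a fibre of `E ⟶ E/H`. -/
def fibPt {hQ : IsQuotient J ι q} {hX : Presieve.IsSheaf J X}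
    {hQs : Presieve.IsSheaf J (Q ⋙ forget GrpCat.{max u v})} {E : QuotObj J act T}
    {s : (orbObj hQ hX hQs E).torsor.sheaf.obj (op U)} {V : C} (p : (orbObj hQ hX hQs E).Sec s V) :
    E.torsor.sheaf.obj (op V) :=
  FibSec.pt p

open StackQuotObj

/-- The transition morphisms between fibres change the structure morphism but keep the underlying
point of `E`. -/
theorem fibPt_pt {hQ : IsQuotient J ι q} {hX : Presieve.IsSheaf J X}
    {hQs : Presieve.IsSheaf J (Q ⋙ forget GrpCat.{max u v})} {E : QuotObj J act T}
    (s : (orbObj hQ hX hQs E).torsor.sheaf.obj (op U)) {V : C}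
    (p : (orbObj hQ hX hQs E).Sec s V) : fibPt (pt s p).p = fibPt p :=
  congrArg fibPt (fibMap_pt s p)

/-- The canonical morphism from the total space of `E ⟶ E/H` to `E`. -/
def totObjOrbObj (hQ : IsQuotient J ι q) (hX : Presieve.IsSheaf J X)
    (hQs : Presieve.IsSheaf J (Q ⋙ forget GrpCat.{max u v}))
    (hG : Presieve.IsSheaf J (G ⋙ forget GrpCat.{max u v})) (E : QuotObj J act T) :
    QuotHom ((orbObj hQ hX hQs E).totObj hG) E where
  base := 𝟙 T
  toFun {U} (x : (orbObj hQ hX hQs E).TotSec U) := fibPt x.p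
  res {V U} f x := by
    change (orbObj hQ hX hQs E).TotSec U at x
    change rs E.torsor.sheaf f (fibPt x.p) = fibPt (x.res f).p
    exact (fibPt_pt x.s (rs ((orbObj hQ hX hQs E).fib x.s).torsor.sheaf f x.p)).symm
  str {U} x := by
    change (orbObj hQ hX hQs E).TotSec U at x
    have hx : FibSec.str (q := q) (s := (x.s : OrbSec q E.torsor U)) x.p = 𝟙 U := x.str_p
    refine (OrbSec.str_eq _ (FibSec.rel (s := (x.s : OrbSec q E.torsor U)) x.p)).trans ?_
    rw [hx, Category.id_comp]
    exact (Category.comp_id _).symm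
  smul {U} g x := by
    change (orbObj hQ hX hQs E).TotSec U at x
    change fibPt (x.smul g).p = E.torsor.act.smul g (fibPt x.p)
    obtain ⟨z, hz, hev, e⟩ := exists_smul_pt (ga q g) x.s x.p g (by rw [x.str_p, rg_id])
    rw [pt_self] at e
    -- For this family the equivariance isomorphism is translation, so `ev` at `g` is translation by
    -- `g⁻¹` in `E`.
    have h : fibPt x.p = E.torsor.act.smul g⁻¹ (rs E.torsor.sheaf (𝟙 U) (fibPt z)) :=
      congrArg fibPt hev.symm
    rw [e, fibPt_pt, h, ← E.torsor.act.mul_smul, mul_inv_cancel, E.torsor.act.one_smul, rs_id]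
  toSpace _ := rfl

/-- `[X/G]` is equivalent to `[[X/H]/(G/H)]`. -/
theorem equivalent_stackQuotient (hQ : IsQuotient J ι q) (hX : Presieve.IsSheaf J X)
    (hQs : Presieve.IsSheaf J (Q ⋙ forget GrpCat.{max u v}))
    (hG : Presieve.IsSheaf J (G ⋙ forget GrpCat.{max u v})) (act : SpaceAction G X) :
    (quotientStack J act).Equivalent (stackQuotient J (twistStackAction hQ hX act)) :=
  CatOver.equivalent_of_fullyFaithful (totFun hQ hX act hG)
    (fun _ _ h => StackQuotHom.totHom_injective hG h)
    (fun φ => ⟨ofTotHom φ, totHom_ofTotHom φ⟩)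
    -- No inverse to the canonical map has to be constructed: it lies over an identity, so it is
    -- invertible.
    (fun E => ⟨orbObj hQ hX hQs E, totObjOrbObj hQ hX hQs hG E, QuotHom.isVertIso _ rfl⟩)

end OrbitFibres

/-! ### Group schemes on the big étale site -/

section Schemes

open AlgebraicGeometry

variable {S : Scheme.{u}} {G H : Over S} [GrpObj G] [GrpObj H] (i : H ⟶ G) [IsMonHom.Normal i]

/-- A sheafification is a sheaf of groups, and the sheaf condition for groups can be checked on
underlying sets, the form in which the gluing arguments for `E/H` use it. -/
theorem isSheaf_quotientGroup :
    Presieve.IsSheaf (etaleSite S) (quotientGroup i ⋙ forget GrpCat.{u + 1}) :=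
  (isSheaf_iff_isSheaf_of_type _ _).1
    ((Presheaf.isSheaf_iff_isSheaf_forget (etaleSite S) _ (forget GrpCat.{u + 1})).1
      ((presheafToSheaf (etaleSite S) GrpCat.{u + 1}).obj _).property)

end Schemes

end QuotStack

end

/-- Beyond the general argument, schemes enter only through the subcanonicity of the étale topology,
which makes functors of points sheaves, and through `isQuotient_quotientSheaf`, by which the
sheafified quotient is locally covered by `G` with kernel `H`. -/
theorem lemma2p3 {S : AlgebraicGeometry.Scheme.{u}} (G H X : Over S) [GrpObj G] [GrpObj H]
    (i : H ⟶ G) [IsMonHom.Normal i] [ModObj G X] :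
    (QuotStack.quotientStack (QuotStack.etaleSite S) (QuotStack.schemeAction G X)).Equivalent
      (QuotStack.stackQuotient (QuotStack.etaleSite S) (QuotStack.quotientGroupAction i X)) :=
  QuotStack.equivalent_stackQuotient _ _ (QuotStack.isSheaf_quotientGroup i)
    (QuotStack.isSheaf_groupPoints G) _
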